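/- **Setting.** Types of nested values are $A,B,C ::= 1 \mid Base \mid A\times B \mid \mathrm{Bag}(C)$; the elements of a bag have multiplicities. *String representation.* A nested value over an active domain of $\sigma$ atomic values is written as a string: an atomic value as itself, the unit value as $\langle\rangle$, a pair as $\langle a,b\rangle$, a bag as $\{c_1,\dots,c_r\}$ (elements listed in some order, with repetitions). For a string $w$ of length $n$ the extended active domain has $m=\sigma+5+n$ elements, ordered as follows: the five delimiters, the $n$ positions of the string, the $\sigma$ atomic values. $N^{Str}$ is the relation $S(p,s)$, "the symbol of $w$ at position $p$ is $s$", given by $m^2$ bits, one for each pair of elements of the extended active domain in lexicographic order. *Bit representation of flat bags.* For a bag of $r$-tuples over the extended active domain, $F^{Bag}$ consists of $k$ bits for each of the $m^r$ possible tuples, in lexicographic order: the multiplicity of the tuple modulo $2^k$ in binary. *Shredding.* Let $v:\mathrm{Bag}(B)$ be given by a string representation $w$. Each occurrence of a bag in $w$ has as its label the position of its opening brace. The flat version $a^F$ of a value $a$ occurring in $w$ is the tuple obtained from $a$ by replacing each outermost bag in it by its label and leaving atomic values unchanged. The shredded version of $v$ consists of the flat bag $v^F$ of the tuples $c^F$,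 $c$ ranging over the listed elements of $v$, and, for each bag type $\mathrm{Bag}(C)$ occurring in $B$, of a dictionary, the flat bag that contains the tuple $(\ell,c^F)$ once for each occurrence in $v$ of a bag of type $\mathrm{Bag}(C)$, with label $\ell$, and each listed element $c$ of it. *$\mathrm{TC}_0$.* A partial function on bit strings is in $\mathrm{TC}_0$ if it is computed by a LOGSPACE-uniform family of circuits, one for each number $N$ of input bits, of polynomial size and constant depth, with and-, or-, majority- (and not-) gates of unbounded fan-in; a majority gate is true iff more than half of its inputs are true, and LOGSPACE-uniform means that a description of the $N$-th circuit can be computed from $1^N$ by a deterministic Turing machine in space $O(\log N)$. **Theorem.** For every type $B$ and every $k$, shredding nested bags of type $\mathrm{Bag}(B)$, i.e. the partial function that maps the $N^{Str}$ representation of any nested bag $v:\mathrm{Bag}(B)$, over an active domain of any size $\sigma$, to the $F^{Bag}$ representation with $k$-bit multiplicities of its shredded version ($v^F$ followed by its dictionaries), is in $\mathrm{TC}_0$. -/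

import Mathlib

namespace ShredTC0

/-! ## Boolean circuits with majority gates -/

/-- A gate. Numbers in `not`, `and`, `or`, `maj` refer to earlier gates of the circuit; `input i`
reads the `i`-th input bit (counting from `0`). Fan-in of `and`, `or`, `maj` is unbounded. -/
inductive Gate where
  | input (i : ℕ)
  | not (j : ℕ)
  | and (js : List ℕ)
  | or (js : List ℕ)
  | maj (js : List ℕ)

namespace Gate

/-- The gates that feed a gate. -/
def preds : Gate → List ℕ
  | input _ => []
  | not j => [j]
  | and js => js
  | or js => js
  | maj js => js

/-- The value of a gate, for input bits `x` and values `vals` of the earlier gates. A majority gate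
is true iff more than half of its inputs are true. -/
def eval (x vals : List Bool) : Gate → Bool
  | input i => x.getD i false
  | not j => !(vals.getD j false)
  | and js => js.all fun j => vals.getD j false
  | or js => js.any fun j => vals.getD j false
  | maj js => decide (js.length < 2 * js.countP fun j => vals.getD j false)

/-- The depth of a gate, given the depths of the earlier gates; input gates have depth `0`. -/
def depth (depths : List ℕ) : Gate → ℕ
  | input _ => 0
  | g => 1 + (g.preds.map fun j => depths.getD j 0).foldr max 0

end Gate

/-- A circuit: its gates in topological order, and the list of its output gates. -/
structure Circuit where
  gates : List Gate
  outs : List ℕ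

namespace Circuit

/-- `C` is a legal circuit on `N` input bits: gates read existing input bits and earlier gates. -/
def WellFormed (N : ℕ) (C : Circuit) : Prop :=
  (∀ i (h : i < C.gates.length), ∀ j ∈ (C.gates[i]).preds, j < i) ∧
  (∀ i, Gate.input i ∈ C.gates → i < N) ∧
  (∀ j ∈ C.outs, j < C.gates.length)

/-- The values of all gates on the input `x`. -/
def values (C : Circuit) (x : List Bool) : List Bool :=
  C.gates.foldl (fun vals g => vals ++ [g.eval x vals]) []

/-- The output bits on the input `x`. -/
def eval (C : Circuit) (x : List Bool) : List Bool :=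
  C.outs.map fun j => (C.values x).getD j false

/-- The depths of all gates. -/
def depths (C : Circuit) : List ℕ :=
  C.gates.foldl (fun ds g => ds ++ [g.depth ds]) []

/-- The depth of the circuit. -/
def depth (C : Circuit) : ℕ := C.depths.foldr max 0

/-- The size of the circuit: gates, wires and outputs. -/
def size (C : Circuit) : ℕ :=
  C.gates.length + (C.gates.map fun g => g.preds.length).sum + C.outs.length

end Circuit

/-- The finite alphabet in which circuits are written down. -/
inductive DescSym where
  | one | sep | tInput | tNot | tAnd | tOr | tMaj | tOuts

/-- A list of numbers written down: each number is a separator followed by its unary notation.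
(All numbers that occur are bounded by a polynomial, so for logarithmic space it makes no
difference whether they are written in unary or in binary.) -/
def descNums (js : List ℕ) : List DescSym :=
  js.flatMap fun j => .sep :: List.replicate j .one

/-- A gate written down: a tag for its kind, then its arguments. -/
def Gate.desc : Gate → List DescSym
  | .input i => .tInput :: descNums [i]
  | .not j => .tNot :: descNums [j]
  | .and js => .tAnd :: descNums js
  | .or js => .tOr :: descNums js
  | .maj js => .tMaj :: descNums js

/-- The description of a circuit: its gates in order, then its output gates. -/
def Circuit.desc (C : Circuit) : List DescSym :=
  C.gates.flatMap Gate.desc ++ .tOuts :: descNums C.outs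

/-! ## Logarithmic space -/

/-- Head moves. -/
inductive Dir where
  | left | stay | right

/-- What the input head sees: an end marker or an input symbol. -/
inductive InCell (I : Type) where
  | leftEnd
  | sym (a : I)
  | rightEnd

/-- A deterministic Turing machine with a two-way read-only input tape, finitely many two-way
infinite work tapes and a write-only output tape. In a step it may change state, move the input
head, write on and move along each work tape, and append finitely many symbols to the output.
`δ q a w = none` means that the machine halts. -/
structure Transducer (I O : Type) where
  Q : Type
  finQ : Finite Q
  Γ : Type
  finΓ : Finite Γ
  tapes : ℕ
  blank : Γ
  start : Q
  δ : Q → InCell I → (Fin tapes → Γ) → Option (Q × Dir × (Fin tapes → Γ × Dir) × List O)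

namespace Transducer

variable {I O : Type}

/-- Configurations. The input head is at `0` on the left end marker, at `i + 1` on the input symbol
with index `i`, and at `length + 1` on the right end marker. -/
structure Cfg (M : Transducer I O) where
  state : M.Q
  inPos : ℕ
  tape : Fin M.tapes → ℤ → M.Γ
  head : Fin M.tapes → ℤ
  output : List O

/-- The cell of the input tape at a position. -/
def inCell (x : List I) : ℕ → InCell I
  | 0 => .leftEnd
  | p + 1 => match x[p]? with
    | some a => .sym a
    | none => .rightEnd

/-- Moving the input head, which never leaves the end markers. -/
def moveIn (x : List I) (p : ℕ) : Dir → ℕ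
  | .left => p - 1
  | .stay => p
  | .right => min (p + 1) (x.length + 1)

/-- Moving a work head. -/
def moveWork (z : ℤ) : Dir → ℤ
  | .left => z - 1
  | .stay => z
  | .right => z + 1

/-- The initial configuration. -/
def init (M : Transducer I O) : M.Cfg where
  state := M.start
  inPos := 0
  tape := fun _ _ => M.blank
  head := fun _ => 0
  output := []

/-- What the machine does in a configuration, `none` if it halts there. -/
def action (M : Transducer I O) (x : List I) (c : M.Cfg) :
    Option (M.Q × Dir × (Fin M.tapes → M.Γ × Dir) × List O) :=
  M.δ c.state (inCell x c.inPos) fun i => c.tape i (c.head i)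

/-- One step; halting configurations are left as they are. -/
def next (M : Transducer I O) (x : List I) (c : M.Cfg) : M.Cfg :=
  match M.action x c with
  | none => c
  | some (q, d, w, o) =>
    { state := q
      inPos := moveIn x c.inPos d
      tape := fun i => Function.update (c.tape i) (c.head i) (w i).1
      head := fun i => moveWork (c.head i) (w i).2
      output := c.output ++ o }

/-- On the input `x` the machine halts with output `y`, and its work heads stay within distance
`s` of their starting cells. -/
def ComputesInSpace (M : Transducer I O) (x : List I) (y : List O) (s : ℕ) : Prop :=
  ∃ T : ℕ,
    M.action x ((M.next x)^[T] M.init) = none ∧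
    ((M.next x)^[T] M.init).output = y ∧
    ∀ t ≤ T, ∀ i, (((M.next x)^[t] M.init).head i).natAbs ≤ s

end Transducer

/-- `f` is computable by a deterministic Turing machine in space `O(log |x|)`. -/
def LogspaceComputable {I O : Type} (f : List I → List O) : Prop :=
  ∃ (M : Transducer I O) (c : ℕ), ∀ x : List I,
    M.ComputesInSpace x (f x) (c * (Nat.log 2 x.length + 1))

/-! ## The class TC⁰ -/

/-- A family of circuits is LOGSPACE-uniform: from `1^N` a description of the `N`-th circuit is
computable in logarithmic space. -/
def LogspaceUniform (C : ℕ → Circuit) : Prop :=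
  LogspaceComputable fun x : List Unit => (C x.length).desc

/-- The partial function on bit strings with graph `F` is computable in TC⁰: by a LOGSPACE-uniform
family of circuits, one for every number of input bits, of polynomial size and constant depth, with
and-, or-, not- and majority-gates of unbounded fan-in. -/
def InTC0 (F : Set (List Bool × List Bool)) : Prop :=
  ∃ C : ℕ → Circuit,
    (∀ N, (C N).WellFormed N) ∧
    (∃ p : Polynomial ℕ, ∀ N, (C N).size ≤ p.eval N) ∧
    (∃ d : ℕ, ∀ N, (C N).depth ≤ d) ∧
    LogspaceUniform C ∧
    ∀ x y, (x, y) ∈ F → (C x.length).eval x = y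

/-! ## Nested values and their string representation -/

/-- Types of nested values: the unit type, the type of atomic values, products and bags. -/
inductive Ty where
  | unit
  | base
  | prod (A B : Ty)
  | bag (C : Ty)
  deriving DecidableEq

/-- Nested values over an active domain with `σ` atomic values, with the elements of each bag
listed, with repetitions, in the order in which a string representation lists them. -/
def Val (σ : ℕ) : Ty → Type
  | .unit => Unit
  | .base => Fin σ
  | .prod A B => Val σ A × Val σ B
  | .bag C => List (Val σ C)

/-- The extended active domain: five delimiters, the string positions (counted from `0`), which
also serve as labels, and the atomic values. -/
inductive Sym (σ : ℕ) where
  | langle | rangle | comma | lbrace | rbrace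
  | pos (i : ℕ)
  | atom (a : Fin σ)

/-- The rank of a symbol in the total order on the extended active domain, for a string of length
`n`: first the delimiters, then the `n` positions, then the `σ` atomic values. -/
def Sym.rank {σ : ℕ} (n : ℕ) : Sym σ → ℕ
  | .langle => 0
  | .rangle => 1
  | .comma => 2
  | .lbrace => 3
  | .rbrace => 4
  | .pos i => 5 + i
  | .atom a => 5 + n + a

/-- The string representation of a nested value. -/
def str {σ : ℕ} : (A : Ty) → Val σ A → List (Sym σ)
  | .unit, _ => [.langle, .rangle]
  | .base, a => [.atom a]
  | .prod A B, (a, b) => .langle :: (str A a ++ .comma :: (str B b ++ [.rangle]))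
  | .bag C, l => .lbrace :: (List.intercalate [.comma] (List.map (str C) l) ++ [.rbrace])

/-! ## Shredding -/

/-- The elements of a bag of type `Bag(C)` paired with the positions where their representations
start, if the first one starts at position `p`. -/
def elems {σ : ℕ} (C : Ty) : ℕ → List (Val σ C) → List (Val σ C × ℕ)
  | _, [] => []
  | p, c :: l => (c, p) :: elems C (p + (str C c).length + 1) l

/-- The number of fields of the flat version `A^F` of the type `A`. -/
def width : Ty → ℕ
  | .unit => 0
  | .base => 1
  | .prod A B => width A + width B
  | .bag _ => 1

/-- The flat version `a^F`, as a list of fields, of a value `a` whose representation starts at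
position `p`: every bag is replaced by its label, the position of its opening brace. -/
def flat {σ : ℕ} : (A : Ty) → Val σ A → ℕ → List (Sym σ)
  | .unit, _, _ => []
  | .base, a, _ => [.atom a]
  | .prod A B, (a, b), p => flat A a (p + 1) ++ flat B b (p + 1 + (str A a).length + 1)
  | .bag _, _, p => [.pos p]

/-- The flat versions of the elements of a bag whose opening brace is at position `p`. -/
def flatElems {σ : ℕ} (C : Ty) (l : List (Val σ C)) (p : ℕ) : List (List (Sym σ)) :=
  (elems C (p + 1) l).map fun e => flat C e.1 e.2

/-- The dictionary for the bags of type `Bag(C)` that occur in a value `a` of type `A` whose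
representation starts at position `p`. It is listed as a bag of type `Bag(𝕃 × C^F)`: each such bag
contributes, for each of its elements `c`, the tuple of its label and `c^F`. -/
def dict {σ : ℕ} (C : Ty) : (A : Ty) → Val σ A → ℕ → List (List (Sym σ))
  | .unit, _, _ => []
  | .base, _, _ => []
  | .prod A B, (a, b), p =>
      dict C A a (p + 1) ++ dict C B b (p + 1 + (str A a).length + 1)
  | .bag A, l, p =>
      (if A = C then (flatElems A l p).map fun t => .pos p :: t else []) ++
        (elems A (p + 1) l).flatMap fun e => dict C A e.1 e.2

/-- The components of the shredding context `B^Γ`: one dictionary for every bag type `Bag(C)` in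
`B`, listed by `C`. -/
def ctxTypes : Ty → List Ty
  | .unit => []
  | .base => []
  | .prod A B => ctxTypes A ++ ctxTypes B
  | .bag C => C :: ctxTypes C

/-! ## Bit representations -/

/-- All `r`-tuples over `{0, …, m - 1}` in lexicographic order. -/
def tuples (m : ℕ) : ℕ → List (List ℕ)
  | 0 => [[]]
  | r + 1 => (List.range m).flatMap fun a => (tuples m r).map fun t => a :: t

/-- The representation `F^Set` of an `r`-ary relation over an ordered domain of size `m`: one bit
for each possible tuple. -/
def fSet (m r : ℕ) (R : List (List ℕ)) : List Bool :=
  (tuples m r).map fun t => decide (t ∈ R)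

/-- The representation `F^Bag` of a bag of `r`-tuples over an ordered domain of size `m`: for each
possible tuple the `k` bits (least significant first) of its multiplicity modulo `2^k`. -/
def fBag (k m r : ℕ) (X : List (List ℕ)) : List Bool :=
  (tuples m r).flatMap fun t =>
    (List.range k).map fun i => (X.count t % 2 ^ k).testBit i

/-- The length of the string representation of a nested bag. -/
def strLen {σ : ℕ} (B : Ty) (v : Val σ (.bag B)) : ℕ := (str (.bag B) v).length

/-- The size `σ + 5 + n` of the extended active domain. -/
def domSize {σ : ℕ} (B : Ty) (v : Val σ (.bag B)) : ℕ := σ + 5 + strLen B v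

/-- The representation `N^Str` of a nested bag: the binary relation `S(p,s)` that holds iff the
symbol at position `p` of the string is `s`, in the representation `F^Set`. -/
def nStr {σ : ℕ} (B : Ty) (v : Val σ (.bag B)) : List Bool :=
  fSet (domSize B v) 2 <| (str (.bag B) v).zipIdx.map fun e =>
    [(Sym.pos e.2 : Sym σ).rank (strLen B v), e.1.rank (strLen B v)]

/-- The shredded version of a nested bag `v` of type `Bag(B)`, in the representation `F^Bag` with
`k`-bit multiplicities: the flat bag `v^F` of type `Bag(B^F)`, followed by the dictionaries of the
context `v^Γ`. The string representation of `v` starts at position `0`. -/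
def shredBits (k : ℕ) {σ : ℕ} (B : Ty) (v : Val σ (.bag B)) : List Bool :=
  let ranks : List (List (Sym σ)) → List (List ℕ) := List.map (List.map (Sym.rank (strLen B v)))
  fBag k (domSize B v) (width B) (ranks (flatElems B v 0)) ++
    (ctxTypes B).flatMap fun C =>
      fBag k (domSize B v) (1 + width C) (ranks (dict C (.bag B) v 0))

/-- The graph of shredding for nested bags of type `Bag(B)`: from the representation `N^Str` to the
representation `F^Bag` with `k`-bit multiplicities, over active domains of any size. -/
def shredGraph (B : Ty) (k : ℕ) : Set (List Bool × List Bool) :=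
  {io | ∃ (σ : ℕ) (v : Val σ (.bag B)), io = (nStr B v, shredBits k B v)}

end ShredTC0

/-!
Shredding is definable by formulas with majority quantifiers over the extended active domain, and
such formulas can be turned into uniform circuits.

*Definability.* Give every opening bracket of a string, `⟨` or `{`, the weight `1` and every closing
bracket the weight `-1`. In the text that follows an opening bracket, a component of the value
opened by it starts exactly at those positions at which the weights so far add up to `0` without
having been negative, which do not carry a closing bracket, and which are the first position or
follow a comma (`Occ.child_prod`, `Occ.child_bag`). Sums of weights are compared by counting, so
there is a formula `childF` for this relation. Recursion on types then gives a formula `flatF` for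
the flat version of the value at a position, and a formula `dictF` for the pairs of the label of a
bag of type `Bag(C)` and the position of one of its elements. Different entries of a dictionary
have different positions (`nodup_items`), so a multiplicity is a number of positions, which is less
than the size of the domain, and its binary digits are definable by counting and arithmetic
(`bitF`).

*Circuits.* A formula becomes a bounded number of layers, one for each subformula, with one gate for
each assignment of its variables; the number of a gate is the number of gates in earlier layers plus
the lexicographic index of the assignment (`Form.compile_spec`). Comparisons `a < b` of polynomials
are majority gates that read the constant false `a` times and the constant true `b` times. The size
of the domain is the integer square root of the number of input bits.

*Uniformity.* The description of these circuits is written by nested loops whose bounds are the size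
of the domain or earlier loop variables, and every number is written in unary by such loops; no
other arithmetic or control structure is needed. Such a loop program runs on a transducer that
keeps the loop variables, in binary, on parallel tracks of one work tape
(`Prog.logspaceComputable`). As each wire of a circuit takes space in its description, the
polynomial bound on the output of a loop program also bounds the size of the circuits.
-/

namespace ShredTC0

/-! ### Binary counters -/

/-- Incrementing a number written in binary, least significant bit first. -/
def incr : List Bool → List Bool
  | [] => [true]
  | false :: l => true :: l
  | true :: l => false :: incr l

theorem bits_succ (n : ℕ) : (n + 1).bits = incr n.bits := by
  induction n using Nat.strong_induction_on with
  | _ n ih =>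
    rcases Nat.even_or_odd' n with ⟨j, rfl | rfl⟩
    · rcases Nat.eq_zero_or_pos j with rfl | hj
      · simp [incr]
      · rw [Nat.bit1_bits, Nat.bit0_bits j hj.ne', incr]
    · rw [show 2 * j + 1 + 1 = 2 * (j + 1) by ring, Nat.bit0_bits _ (by omega), Nat.bit1_bits,
        ih j (by omega), incr]

theorem bits_inj {m n : ℕ} : m.bits = n.bits ↔ m = n := by
  refine ⟨?_, congrArg _⟩
  induction m using Nat.strong_induction_on generalizing n with
  | _ m ih =>
    intro h
    have h1 := congrArg List.headI h
    have h2 := congrArg List.tail h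
    rw [← Nat.bodd_eq_bits_head, ← Nat.bodd_eq_bits_head] at h1
    rw [← Nat.div2_bits_eq_tail, ← Nat.div2_bits_eq_tail] at h2
    rcases Nat.eq_zero_or_pos m with rfl | hm
    · by_contra hn
      have := congrArg List.length h
      rw [Nat.zero_bits, Nat.size_eq_bits_len] at this
      exact hn (Nat.size_eq_zero.1 this.symm).symm
    · have h3 := ih m.div2 (by rw [Nat.div2_val]; omega) h2
      rw [← Nat.bodd_add_div2 m, ← Nat.bodd_add_div2 n, h1, h3]

/-! ### A register language for transducers -/

/-- Structured programs over registers of natural numbers, for a machine with a read-only input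
and a write-only output: emit a symbol, advance the input head, increment or clear a register,
repeat while two registers differ, repeat while the input is not exhausted. -/
inductive Stmt (R O : Type) where
  | skip
  | emit (o : O)
  | adv
  | inc (r : R)
  | clr (r : R)
  | seq (a b : Stmt R O)
  | whileNe (r s : R) (a : Stmt R O)
  | whileIn (a : Stmt R O)

/-- What a machine is doing: marking the home cell, executing a statement, or moving its work head
back to the home cell. -/
inductive Phase where
  | init | run | ret

instance : Finite Phase :=
  Finite.of_injective (fun ph : Phase => match ph with
    | .init => (0 : Fin 3)
    | .run => 1
    | .ret => 2) (by intro a b; cases a <;> cases b <;> simp)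

section Machine

variable {I R O : Type}

/-- The continuations (lists of statements still to be executed) that can arise while `s :: k` is
executed down to `k`. -/
def Stmt.conts : Stmt R O → List (Stmt R O) → Set (List (Stmt R O))
  | .seq a b, k => {.seq a b :: k} ∪ (a.conts (b :: k) ∪ b.conts k)
  | .whileNe r s a, k => {.whileNe r s a :: k} ∪ ({k} ∪ a.conts (.whileNe r s a :: k))
  | .whileIn a, k => {.whileIn a :: k} ∪ ({k} ∪ a.conts (.whileIn a :: k))
  | s, k => {s :: k, k}

theorem Stmt.conts_finite (s : Stmt R O) (k : List (Stmt R O)) : (s.conts k).Finite := by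
  induction s generalizing k with
  | seq a b iha ihb =>
    exact (Set.finite_singleton _).union ((iha _).union (ihb _))
  | whileNe r s a ih =>
    exact (Set.finite_singleton _).union ((Set.finite_singleton _).union (ih _))
  | whileIn a ih =>
    exact (Set.finite_singleton _).union ((Set.finite_singleton _).union (ih _))
  | _ => exact (Set.finite_singleton _).insert _

theorem Stmt.cons_mem_conts (s : Stmt R O) (k : List (Stmt R O)) : s :: k ∈ s.conts k := by
  cases s <;> simp [Stmt.conts]

theorem Stmt.mem_conts (s : Stmt R O) (k : List (Stmt R O)) : k ∈ s.conts k := by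
  induction s generalizing k with
  | seq a b iha ihb => simp [Stmt.conts, ihb]
  | _ => simp [Stmt.conts]

/-- A cell of the work tape: whether it is the home cell, and a bit or a blank for each register.
All registers are stored in binary on parallel tracks of one tape, least significant bits in the
home cell. -/
abbrev Cell (R : Type) : Type := Bool × (R → Option Bool)

/-- The transition function, on continuations. Register operations work through the digits from
the home cell outwards and then return home. -/
def Stmt.delta [DecidableEq R] (k : List (Stmt R O)) (ph : Phase) (a : InCell I) (w : Cell R) :
    Option ((List (Stmt R O) × Phase) × Dir × (Cell R × Dir) × List O) :=
  match ph, k with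
  | .init, k => some ((k, .run), .stay, ((true, w.2), .stay), [])
  | .ret, k =>
    if w.1 then some ((k, .run), .stay, (w, .stay), [])
    else some ((k, .ret), .stay, (w, .left), [])
  | .run, [] => none
  | .run, .skip :: k => some ((k, .run), .stay, (w, .stay), [])
  | .run, .emit o :: k => some ((k, .run), .stay, (w, .stay), [o])
  | .run, .adv :: k => some ((k, .run), .right, (w, .stay), [])
  | .run, .inc r :: k =>
    if w.2 r = some true then
      some ((.inc r :: k, .run), .stay, ((w.1, Function.update w.2 r (some false)), .right), [])
    else some ((k, .ret), .stay, ((w.1, Function.update w.2 r (some true)), .stay), [])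
  | .run, .clr r :: k =>
    if w.2 r = none then some ((k, .ret), .stay, (w, .stay), [])
    else some ((.clr r :: k, .run), .stay, ((w.1, Function.update w.2 r none), .right), [])
  | .run, .seq s t :: k => some ((s :: t :: k, .run), .stay, (w, .stay), [])
  | .run, .whileNe r s b :: k =>
    if w.2 r = w.2 s then
      if w.2 r = none then some ((k, .ret), .stay, (w, .stay), [])
      else some ((.whileNe r s b :: k, .run), .stay, (w, .right), [])
    else some ((b :: .whileNe r s b :: k, .ret), .stay, (w, .stay), [])
  | .run, .whileIn b :: k =>
    match a with
    | .rightEnd => some ((k, .run), .stay, (w, .stay), [])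
    | _ => some ((b :: .whileIn b :: k, .run), .stay, (w, .stay), [])

open Classical in
/-- A continuation as an element of the finite set `p.conts []`, with a junk value outside it. -/
noncomputable def Stmt.toCont (p : Stmt R O) (k : List (Stmt R O)) : p.conts [] :=
  if h : k ∈ p.conts [] then ⟨k, h⟩ else ⟨[p], p.cons_mem_conts []⟩

theorem Stmt.toCont_coe (p : Stmt R O) {k : List (Stmt R O)} (h : k ∈ p.conts []) :
    (p.toCont k : List (Stmt R O)) = k := by
  simp [toCont, h]

/-- The transducer that executes the program `p`. -/
noncomputable def Stmt.machine [Finite R] [DecidableEq R] (I : Type) (p : Stmt R O) :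
    Transducer I O where
  Q := p.conts [] × Phase
  finQ := by
    have := (p.conts_finite []).to_subtype
    infer_instance
  Γ := Cell R
  finΓ := inferInstance
  tapes := 1
  blank := (false, fun _ => none)
  start := (p.toCont [p], .init)
  δ := fun q a w => (Stmt.delta q.1 q.2 a (w 0)).map fun r =>
    ((p.toCont r.1.1, r.1.2), r.2.1, (fun _ => r.2.2.1), r.2.2.2)

/-- The tape with the digits `T r` on the track of register `r`. -/
def tapeOf (T : R → ℕ → Option Bool) : ℤ → Cell R :=
  fun z => (decide (z = 0), fun r => if 0 ≤ z then T r z.toNat else none)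

theorem tapeOf_natCast (T : R → ℕ → Option Bool) (h : ℕ) :
    tapeOf T h = (decide (h = 0), fun r => T r h) := by
  simp [tapeOf]

theorem update_tapeOf [DecidableEq R] (T : R → ℕ → Option Bool) (h : ℕ) (r : R)
    (x : Option Bool) :
    Function.update (tapeOf T) (h : ℤ)
      ((tapeOf T h).1, Function.update (tapeOf T h).2 r x) =
        tapeOf (Function.update T r (Function.update (T r) h x)) := by
  funext z
  by_cases hz : z = h
  · subst hz
    rw [Function.update_self, tapeOf_natCast, tapeOf_natCast]
    congr 1
    funext i
    by_cases hi : i = r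
    · subst hi; simp
    · simp [hi]
  · rw [Function.update_of_ne hz]
    unfold tapeOf
    congr 1
    funext i
    by_cases hi : i = r
    · subst hi
      split_ifs with h0
      · have : z.toNat ≠ h := by omega
        simp [this]
      · rfl
    · simp [hi]

/-- A finite list of digits as the content of a track. -/
def track (l : List Bool) : ℕ → Option Bool := fun j => l[j]?

theorem update_track_append (A l : List Bool) (b c : Bool) :
    Function.update (track (A ++ b :: l)) A.length (some c) = track (A ++ c :: l) := by
  funext j
  by_cases h : j = A.length
  · subst h; simp [track]
  · rw [Function.update_of_ne h, track, track, List.getElem?_append, List.getElem?_append]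
    split_ifs with h3
    · rfl
    · obtain ⟨u, hu⟩ : ∃ u, j - A.length = u + 1 := ⟨j - A.length - 1, by omega⟩
      simp [hu]

theorem update_track (A : List Bool) (c : Bool) :
    Function.update (track A) A.length (some c) = track (A ++ [c]) := by
  funext j
  by_cases h : j = A.length
  · subst h; simp [track]
  · rw [Function.update_of_ne h, track, track, List.getElem?_append]
    split_ifs with h3
    · rfl
    · rw [List.getElem?_eq_none (by omega), List.getElem?_eq_none (by simp; omega)]

end Machine

namespace Transducer

variable {I O : Type} {M : Transducer I O} {x : List I} {s : ℕ}

/-- The machine gets from one configuration to another while its work heads stay within distance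
`s` of their starting cells. -/
def Reach (M : Transducer I O) (x : List I) (s : ℕ) (c c' : M.Cfg) : Prop :=
  ∃ T : ℕ, (M.next x)^[T] c = c' ∧ ∀ t ≤ T, ∀ i, (((M.next x)^[t] c).head i).natAbs ≤ s

theorem Reach.refl {c : M.Cfg} (h : ∀ i, (c.head i).natAbs ≤ s) : M.Reach x s c c :=
  ⟨0, rfl, fun t ht => by obtain rfl : t = 0 := by omega
                          exact h⟩

theorem Reach.trans {a b c : M.Cfg} (h₁ : M.Reach x s a b) (h₂ : M.Reach x s b c) :
    M.Reach x s a c := by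
  obtain ⟨T, hT, hs⟩ := h₁
  obtain ⟨U, hU, hs'⟩ := h₂
  refine ⟨U + T, by rw [Function.iterate_add_apply, hT, hU], fun t ht => ?_⟩
  rcases le_total t T with h | h
  · exact hs t h
  · obtain ⟨u, rfl⟩ := Nat.exists_eq_add_of_le' h
    rw [Function.iterate_add_apply, hT]
    exact hs' u (by omega)

theorem Reach.head {a b c : M.Cfg} (h : ∀ i, (a.head i).natAbs ≤ s) (hb : M.next x a = b)
    (h₂ : M.Reach x s b c) : M.Reach x s a c := by
  obtain ⟨T, hT, hs⟩ := h₂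
  subst hb
  refine ⟨T + 1, hT, fun t ht => ?_⟩
  cases t with
  | zero => exact h
  | succ t => exact hs t (by omega)

end Transducer

namespace Stmt

open Transducer

theorem update_bits {R : Type} [DecidableEq R] (ρ : R → ℕ) (r : R) (n : ℕ) :
    Function.update (fun i => track (ρ i).bits) r (track n.bits) =
      fun i => track (Function.update ρ r n i).bits := by
  funext i
  by_cases h : i = r
  · subst h; simp
  · simp [h]

variable {I R O : Type} [DecidableEq R] [Finite R] {p : Stmt R O} {x : List I} {s : ℕ}

/-- The configuration with continuation `k`, phase `ph`, input head at `i`, digits `T` on the work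
tape, work head at `h`, and output `out`. -/
noncomputable def conf (I : Type) (p : Stmt R O) (k : List (Stmt R O)) (ph : Phase) (i : ℕ)
    (T : R → ℕ → Option Bool) (h : ℕ) (out : List O) : (p.machine I).Cfg where
  state := (p.toCont k, ph)
  inPos := i
  tape := fun _ => tapeOf T
  head := fun _ => h
  output := out

theorem head_conf_le {k : List (Stmt R O)} {ph : Phase} {i : ℕ} {T : R → ℕ → Option Bool}
    {h : ℕ} {out : List O} (hs : h ≤ s) :
    ∀ j, ((conf I p k ph i T h out).head j).natAbs ≤ s := fun j => by
  simpa [conf] using hs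

/-- A step according to the transition function on continuations. The successor continuation need
not be known to lie in the finite set of states here; this is needed only before the next step. -/
theorem next_conf {k k' : List (Stmt R O)} {ph ph' : Phase} {i h h' : ℕ}
    {T T' : R → ℕ → Option Bool} {out o : List O} {d d' : Dir} {w : Cell R}
    (hk : k ∈ p.conts [])
    (hd : delta k ph (inCell x i) (tapeOf T h) = some ((k', ph'), d, (w, d'), o))
    (hT : Function.update (tapeOf T) (h : ℤ) w = tapeOf T') (hh : moveWork h d' = h') :
    (p.machine I).next x (conf I p k ph i T h out) =
      conf I p k' ph' (moveIn x i d) T' h' (out ++ o) := by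
  have : (p.machine I).action x (conf I p k ph i T h out) =
      some ((p.toCont k', ph'), d, (fun _ => (w, d')), o) := by
    simp only [action, machine, conf, p.toCont_coe hk]
    erw [hd]
    rfl
  simp only [next, this]
  simp only [conf, hh, ← hT]
  rfl

theorem next_conf_stay {k k' : List (Stmt R O)} {ph ph' : Phase} {i h h' : ℕ}
    {T : R → ℕ → Option Bool} {out o : List O} {d d' : Dir} (hk : k ∈ p.conts [])
    (hd : delta k ph (inCell x i) (tapeOf T h) = some ((k', ph'), d, (tapeOf T h, d'), o))
    (hh : moveWork h d' = h') :
    (p.machine I).next x (conf I p k ph i T h out) =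
      conf I p k' ph' (moveIn x i d) T h' (out ++ o) :=
  next_conf hk hd (Function.update_eq_self _ _) hh

theorem reach_ret {k : List (Stmt R O)} {i h : ℕ} {T : R → ℕ → Option Bool} {out : List O}
    (hk : k ∈ p.conts []) (hs : h ≤ s) :
    (p.machine I).Reach x s (conf I p k .ret i T h out) (conf I p k .run i T 0 out) := by
  induction h with
  | zero =>
    refine Reach.head (head_conf_le hs) (next_conf_stay (d' := .stay) (h' := 0) (k' := k)
      (ph' := .run) (d := .stay) (o := []) hk ?_ rfl) ?_
    · simp [delta, tapeOf]
    · rw [List.append_nil]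
      exact Reach.refl (head_conf_le hs)
  | succ h ih =>
    refine Reach.head (head_conf_le hs) (next_conf_stay (d' := .left) (h' := h) (k' := k)
      (ph' := .ret) (d := .stay) (o := []) hk ?_ (by simp [moveWork])) ?_
    · have : ((h : ℤ) + 1) ≠ 0 := by omega
      simp [delta, tapeOf, this]
    · rw [List.append_nil]
      exact ih (by omega)

/-- The configuration with continuation `k` and registers `ρ`, with the work head at home. -/
noncomputable def confR (I : Type) (p : Stmt R O) (k : List (Stmt R O)) (i : ℕ) (ρ : R → ℕ)
    (out : List O) : (p.machine I).Cfg :=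
  conf I p k .run i (fun r => track (ρ r).bits) 0 out

/-- A statement that does not touch the work tape takes one step. -/
theorem reach_one {k k' : List (Stmt R O)} {i : ℕ} {ρ : R → ℕ} {out o : List O} {d : Dir}
    (hk : k ∈ p.conts [])
    (hd : ∀ w, delta k .run (inCell x i) w = some ((k', .run), d, (w, .stay), o)) :
    (p.machine I).Reach x s (confR I p k i ρ out) (confR I p k' (moveIn x i d) ρ (out ++ o)) :=
  Reach.head (head_conf_le (Nat.zero_le _)) (next_conf_stay hk (hd _) rfl)
    (Reach.refl (head_conf_le (Nat.zero_le _)))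

/-- The increment when the carry has reached cell `A.length`: the digits `A` are done. -/
theorem reach_inc_aux {k : List (Stmt R O)} {i : ℕ} {out : List O} {r : R}
    (hc : (inc r).conts k ⊆ p.conts []) (l : List Bool) :
    ∀ (T : R → ℕ → Option Bool) (A : List Bool), T r = track (A ++ l) →
    (A ++ incr l).length ≤ s →
    (p.machine I).Reach x s (conf I p (inc r :: k) .run i T A.length out)
      (conf I p k .run i (Function.update T r (track (A ++ incr l))) 0 out) := by
  have h1 : inc r :: k ∈ p.conts [] := hc (cons_mem_conts _ _)
  have h2 : k ∈ p.conts [] := hc (mem_conts _ _)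
  induction l with
  | nil =>
    intro T A hT hs
    simp only [List.length_append] at hs
    refine Reach.head (head_conf_le (by omega)) (next_conf (h' := A.length) (k' := k)
      (ph' := .ret) (d := .stay) (o := []) h1 ?_ (update_tapeOf T _ r (some true))
      (by rfl : moveWork _ .stay = _)) ?_
    · simp [delta, tapeOf, hT, track]
    · rw [List.append_nil, hT, List.append_nil, update_track]
      exact reach_ret h2 (by omega)
  | cons b l ih =>
    intro T A hT hs
    simp only [List.length_append] at hs
    cases b with
    | false =>
      refine Reach.head (head_conf_le (by omega)) (next_conf (h' := A.length) (k' := k)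
        (ph' := .ret) (d := .stay) (o := []) h1 ?_
        (update_tapeOf T _ r (some true)) (by rfl : moveWork _ .stay = _)) ?_
      · simp [delta, tapeOf, hT, track]
      · rw [List.append_nil, hT, update_track_append]
        exact reach_ret h2 (by omega)
    | true =>
      simp only [incr, List.length_cons] at hs
      refine Reach.head (head_conf_le (by omega)) (next_conf (h' := A.length + 1)
        (k' := inc r :: k) (ph' := .run) (d := .stay) (o := []) h1 ?_
        (update_tapeOf T _ r (some false)) (by simp [moveWork] : moveWork _ .right = _)) ?_
      · simp [delta, tapeOf, hT, track]
      · rw [List.append_nil, hT, update_track_append]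
        have := ih (Function.update T r (track (A ++ false :: l))) (A ++ [false]) (by simp)
          (by simp; omega)
        simpa [incr, moveIn] using this

theorem reach_inc {k : List (Stmt R O)} {i : ℕ} {ρ : R → ℕ} {out : List O} {r : R}
    (hc : (inc r).conts k ⊆ p.conts []) (hs : (ρ r + 1).size ≤ s) :
    (p.machine I).Reach x s (confR I p (inc r :: k) i ρ out)
      (confR I p k i (Function.update ρ r (ρ r + 1)) out) := by
  have := reach_inc_aux (x := x) (s := s) (i := i) (out := out) hc (ρ r).bits
    (fun r => track (ρ r).bits) [] rfl
    (by rw [List.nil_append, ← bits_succ, Nat.size_eq_bits_len]; exact hs)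
  rw [List.nil_append, ← bits_succ, update_bits] at this
  exact this

/-- Clearing a register when the first `h` digits are erased already. -/
theorem reach_clr_aux {k : List (Stmt R O)} {i : ℕ} {out : List O} {r : R}
    (hc : (clr r).conts k ⊆ p.conts []) (l : List Bool) :
    ∀ (T : R → ℕ → Option Bool) (h : ℕ),
    (T r = fun j => if j < h then none else track l (j - h)) → h + l.length ≤ s →
    (p.machine I).Reach x s (conf I p (clr r :: k) .run i T h out)
      (conf I p k .run i (Function.update T r (track [])) 0 out) := by
  have h1 : clr r :: k ∈ p.conts [] := hc (cons_mem_conts _ _)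
  have h2 : k ∈ p.conts [] := hc (mem_conts _ _)
  induction l with
  | nil =>
    intro T h hT hs
    have hT' : T r = track [] := by rw [hT]; funext j; simp [track]
    rw [← hT', Function.update_eq_self]
    refine Reach.head (head_conf_le (by omega)) (next_conf_stay (h' := h) (k' := k)
      (ph' := .ret) (d := .stay) (d' := .stay) (o := []) h1 ?_ rfl) ?_
    · simp [delta, tapeOf, hT', track]
    · rw [List.append_nil]
      exact reach_ret h2 (by omega)
  | cons b l ih =>
    intro T h hT hs
    simp only [List.length_cons] at hs
    refine Reach.head (head_conf_le (by omega)) (next_conf (h' := h + 1)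
        (k' := clr r :: k) (ph' := .run) (d := .stay) (o := []) h1 ?_
        (update_tapeOf T _ r none) (by simp [moveWork] : moveWork _ .right = _)) ?_
    · simp [delta, tapeOf, hT, track]
    · rw [List.append_nil]
      have := ih (Function.update T r (Function.update (T r) h none)) (h + 1) ?_ (by omega)
      · simpa [moveIn] using this
      · rw [Function.update_self, hT]
        funext j
        by_cases hj : j = h
        · subst hj; simp
        · rw [Function.update_of_ne hj]
          split_ifs with h3 h4 h4
          · rfl
          · omega
          · omega
          · obtain ⟨u, rfl⟩ : ∃ u, j = h + 1 + u := ⟨j - (h + 1), by omega⟩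
            simp [track, show h + 1 + u - h = u + 1 by omega]

theorem reach_clr {k : List (Stmt R O)} {i : ℕ} {ρ : R → ℕ} {out : List O} {r : R}
    (hc : (clr r).conts k ⊆ p.conts []) (hs : (ρ r).size ≤ s) :
    (p.machine I).Reach x s (confR I p (clr r :: k) i ρ out)
      (confR I p k i (Function.update ρ r 0) out) := by
  have := reach_clr_aux (x := x) (s := s) (i := i) (out := out) hc (ρ r).bits
    (fun r => track (ρ r).bits) 0 (by simp) (by rw [Nat.size_eq_bits_len]; omega)
  rw [← Nat.zero_bits, update_bits] at this
  exact this

/-- The comparison of two registers when their first `h` digits have been found to agree. -/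
theorem reach_whileNe_aux {k : List (Stmt R O)} {i : ℕ} {out : List O} {r r' : R}
    {a : Stmt R O} (hc : (whileNe r r' a).conts k ⊆ p.conts []) {T : R → ℕ → Option Bool}
    (l : List Bool) : ∀ (l' : List Bool) (h : ℕ), (∀ j, T r (h + j) = track l j) →
    (∀ j, T r' (h + j) = track l' j) → h + l.length ≤ s →
    (p.machine I).Reach x s (conf I p (whileNe r r' a :: k) .run i T h out)
      (conf I p (if l = l' then k else a :: whileNe r r' a :: k) .run i T 0 out) := by
  have h1 : whileNe r r' a :: k ∈ p.conts [] := hc (cons_mem_conts _ _)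
  have h2 : k ∈ p.conts [] := hc (mem_conts _ _)
  have h3 : a :: whileNe r r' a :: k ∈ p.conts [] :=
    hc (Or.inr (Or.inr (cons_mem_conts _ _)))
  have hne : ∀ (h : ℕ), T r h ≠ T r' h → h ≤ s →
      (p.machine I).Reach x s (conf I p (whileNe r r' a :: k) .run i T h out)
      (conf I p (a :: whileNe r r' a :: k) .run i T 0 out) := by
    intro h hT hs
    refine Reach.head (head_conf_le hs) (next_conf_stay (h' := h)
      (k' := a :: whileNe r r' a :: k)
      (ph' := .ret) (d := .stay) (d' := .stay) (o := []) h1 ?_ rfl) ?_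
    · simp [delta, tapeOf, hT]
    · rw [List.append_nil]
      exact reach_ret h3 hs
  induction l with
  | nil =>
    intro l' h hr hr' hs
    have hr0 := hr 0
    have hr0' := hr' 0
    rw [Nat.add_zero] at hr0 hr0'
    cases l' with
    | nil =>
      refine Reach.head (head_conf_le (by omega)) (next_conf_stay (h' := h) (k' := k)
        (ph' := .ret) (d := .stay) (d' := .stay) (o := []) h1 ?_ rfl) ?_
      · simp [delta, tapeOf, hr0, hr0', track]
      · rw [List.append_nil]
        exact reach_ret h2 (by omega)
    | cons b l' => exact hne h (by rw [hr0, hr0']; simp [track]) (by omega)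
  | cons b l ih =>
    intro l' h hr hr' hs
    have hr0 := hr 0
    have hr0' := hr' 0
    rw [Nat.add_zero] at hr0 hr0'
    simp only [List.length_cons] at hs
    cases l' with
    | nil => exact hne h (by rw [hr0, hr0']; simp [track]) (by omega)
    | cons b' l' =>
      by_cases hb : b = b'
      · subst hb
        refine Reach.head (head_conf_le (by omega)) (next_conf_stay (h' := h + 1)
          (k' := whileNe r r' a :: k) (ph' := .run) (d := .stay) (d' := .right) (o := []) h1 ?_
          (by simp [moveWork])) ?_
        · simp [delta, tapeOf, hr0, hr0', track]
        · rw [List.append_nil]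
          have := ih l' (h + 1)
            (fun j => by rw [show h + 1 + j = h + (j + 1) by ring, hr]; simp [track])
            (fun j => by rw [show h + 1 + j = h + (j + 1) by ring, hr']; simp [track]) (by omega)
          simpa [moveIn] using this
      · rw [if_neg (by simp [hb])]
        exact hne h (by rw [hr0, hr0']; simp [track, hb]) (by omega)

theorem reach_whileNe {k : List (Stmt R O)} {i : ℕ} {ρ : R → ℕ} {out : List O} {r r' : R}
    {a : Stmt R O} (hc : (whileNe r r' a).conts k ⊆ p.conts []) (hs : (ρ r).size ≤ s) :
    (p.machine I).Reach x s (confR I p (whileNe r r' a :: k) i ρ out)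
      (confR I p (if ρ r = ρ r' then k else a :: whileNe r r' a :: k) i ρ out) := by
  have := reach_whileNe_aux (x := x) (s := s) (i := i) (out := out) hc
    (T := fun r => track (ρ r).bits) (ρ r).bits (ρ r').bits 0 (by simp) (by simp)
    (by rw [Nat.size_eq_bits_len]; omega)
  simp only [bits_inj] at this
  exact this

theorem reach_whileIn {k : List (Stmt R O)} {i : ℕ} {ρ : R → ℕ} {out : List O}
    {a : Stmt R O} (hc : (whileIn a).conts k ⊆ p.conts []) (hi : i ≤ x.length + 1) :
    (p.machine I).Reach x s (confR I p (whileIn a :: k) i ρ out)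
      (confR I p (if i = x.length + 1 then k else a :: whileIn a :: k) i ρ out) := by
  have h1 : whileIn a :: k ∈ p.conts [] := hc (cons_mem_conts _ _)
  have := reach_one (x := x) (s := s) (ρ := ρ) (out := out) (i := i) (o := []) (d := .stay)
    (k' := if i = x.length + 1 then k else a :: whileIn a :: k) h1 ?_
  · simpa [moveIn] using this
  · intro w
    cases i with
    | zero => simp [delta, inCell]
    | succ i =>
      by_cases h : i = x.length
      · simp [delta, inCell, h]
      · have : x[i]? = some (x[i]'(by omega)) := List.getElem?_eq_getElem _
        simp [delta, inCell, this, h]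

theorem update_blank {R : Type} :
    Function.update (fun _ : ℤ => ((false, fun _ => none) : Cell R)) 0 (true, fun _ => none) =
      tapeOf fun _ => track [] := by
  funext z
  by_cases hz : z = 0
  · subst hz
    simp [tapeOf, track]
  · simp [tapeOf, track, hz]

/-- A program that runs from the initial configuration to an empty continuation computes its output
in the given space. -/
theorem computesInSpace {i : ℕ} {ρ : R → ℕ} {y : List O}
    (h : (p.machine I).Reach x s (confR I p [p] 0 (fun _ => 0) []) (confR I p [] i ρ y)) :
    (p.machine I).ComputesInSpace x y s := by
  have h0 : (p.machine I).next x (p.machine I).init = confR I p [p] 0 (fun _ => 0) [] := by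
    have ha : (p.machine I).action x (p.machine I).init =
        some ((p.toCont [p], .run), .stay, (fun _ => ((true, fun _ => none), .stay)), []) := by
      simp only [action, machine, init, p.toCont_coe (cons_mem_conts _ _)]
      rfl
    simp only [next, ha, confR, conf]
    congr
    funext _
    exact update_blank.trans (by simp)
  have h1 : (p.machine I).Reach x s (p.machine I).init (confR I p [] i ρ y) :=
    Reach.head (by simp [init]) h0 h
  obtain ⟨T, hT, hs⟩ := h1
  refine ⟨T, ?_, by rw [hT]; rfl, hs⟩
  rw [hT]
  simp [action, machine, confR, conf, p.toCont_coe (mem_conts p []), delta]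

end Stmt

/-! ### Loop programs -/

/-- Programs whose only effect is their output and whose only control structure is
`for v < b do ..` with a register `b` as bound. The loop variable is the first register not yet in
use. -/
inductive Prog (O : Type) where
  | nil
  | emit (o : O)
  | seq (a b : Prog O)
  | loop (b : ℕ) (a : Prog O)

namespace Prog

variable {O : Type}

/-- The output of a program when the first `d` registers are in use and `e` gives their values. -/
def sem : Prog O → ℕ → (ℕ → ℕ) → List O
  | nil, _, _ => []
  | emit o, _, _ => [o]
  | seq a b, d, e => a.sem d e ++ b.sem d e
  | loop b a, d, e => (List.range (e b)).flatMap fun i => a.sem (d + 1) (Function.update e d i)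

/-- All loop bounds are registers in use. -/
def WF : Prog O → ℕ → Prop
  | nil, _ => True
  | emit _, _ => True
  | seq a b, d => a.WF d ∧ b.WF d
  | loop b a, d => b < d ∧ a.WF (d + 1)

/-- The nesting depth of the loops. -/
def height : Prog O → ℕ
  | nil => 0
  | emit _ => 0
  | seq a b => max a.height b.height
  | loop _ a => a.height + 1

/-- A polynomial bound on the length of the output in terms of the values of the registers. -/
noncomputable def lenPoly : Prog O → Polynomial ℕ
  | nil => 0
  | emit _ => 1
  | seq a b => a.lenPoly + b.lenPoly
  | loop _ a => .X * a.lenPoly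

theorem length_sem_le (P : Prog O) {N : ℕ} : ∀ (d : ℕ) (e : ℕ → ℕ), (∀ i, e i ≤ N) →
    (P.sem d e).length ≤ P.lenPoly.eval N := by
  induction P with
  | nil => simp [sem]
  | emit o => simp [sem, lenPoly]
  | seq a b iha ihb =>
    intro d e he
    simpa [sem, lenPoly] using add_le_add (iha d e he) (ihb d e he)
  | loop b a ih =>
    intro d e he
    simp only [sem, lenPoly, List.length_flatMap, Polynomial.eval_mul, Polynomial.eval_X]
    refine (List.sum_le_card_nsmul _ (a.lenPoly.eval N) ?_).trans ?_
    · intro l hl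
      obtain ⟨i, hi, rfl⟩ := List.mem_map.1 hl
      refine ih _ _ fun j => ?_
      by_cases hj : j = d
      · subst hj
        simpa using (List.mem_range.1 hi).le.trans (he b)
      · simpa [hj] using he j
    · simpa using Nat.mul_le_mul_right _ (he b)

/-- The register with a given number. There is one register more than loop variables, as register
`0` holds an argument, and always at least two. -/
abbrev reg (t i : ℕ) : Fin (t + 2) := Fin.ofNat (t + 2) i

theorem reg_ne {t i j : ℕ} (hi : i < t + 2) (hj : j < t + 2) (h : i ≠ j) : reg t i ≠ reg t j := by
  intro h'
  apply h
  simpa [Fin.ext_iff, Nat.mod_eq_of_lt hi, Nat.mod_eq_of_lt hj] using h'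

/-- Repeat `a` while register `v` runs from `0` to the value of register `b`. -/
def forLoop {R : Type} (v b : R) (a : Stmt R O) : Stmt R O :=
  .seq (.clr v) (.whileNe v b (.seq a (.inc v)))

/-- Loop programs in the register language, with `t + 2` registers. -/
def toStmt (t : ℕ) : Prog O → ℕ → Stmt (Fin (t + 2)) O
  | nil, _ => .skip
  | emit o, _ => .emit o
  | seq a b, d => .seq (a.toStmt t d) (b.toStmt t d)
  | loop b a, d => forLoop (reg t d) (reg t b) (a.toStmt t (d + 1))

end Prog

open Transducer Stmt

section Conts

variable {R O : Type} {p : Stmt R O} {k : List (Stmt R O)}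

theorem Stmt.conts_seq_left {a b : Stmt R O} (hc : (seq a b).conts k ⊆ p.conts []) :
    a.conts (b :: k) ⊆ p.conts [] :=
  fun _ h => hc (Or.inr (Or.inl h))

theorem Stmt.conts_seq_right {a b : Stmt R O} (hc : (seq a b).conts k ⊆ p.conts []) :
    b.conts k ⊆ p.conts [] :=
  fun _ h => hc (Or.inr (Or.inr h))

theorem Stmt.conts_whileNe {r r' : R} {a : Stmt R O}
    (hc : (whileNe r r' a).conts k ⊆ p.conts []) :
    a.conts (whileNe r r' a :: k) ⊆ p.conts [] :=
  fun _ h => hc (Or.inr (Or.inr h))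

theorem Stmt.conts_whileIn {a : Stmt R O} (hc : (whileIn a).conts k ⊆ p.conts []) :
    a.conts (whileIn a :: k) ⊆ p.conts [] :=
  fun _ h => hc (Or.inr (Or.inr h))

end Conts

section Run

variable {I R O : Type} [DecidableEq R] [Finite R] {p : Stmt R O} {x : List I} {s : ℕ}
  {k : List (Stmt R O)} {i : ℕ} {ρ : R → ℕ} {out : List O}

theorem Stmt.reach_skip (hc : skip.conts k ⊆ p.conts []) :
    (p.machine I).Reach x s (confR I p (skip :: k) i ρ out) (confR I p k i ρ out) := by
  simpa [moveIn] using reach_one (x := x) (s := s) (i := i) (ρ := ρ) (out := out)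
    (hc (cons_mem_conts _ _)) (d := .stay) (k' := k) (o := []) fun w => rfl

theorem Stmt.reach_emit {o : O} (hc : (emit o).conts k ⊆ p.conts []) :
    (p.machine I).Reach x s (confR I p (emit o :: k) i ρ out) (confR I p k i ρ (out ++ [o])) := by
  simpa [moveIn] using reach_one (x := x) (s := s) (i := i) (ρ := ρ) (out := out)
    (hc (cons_mem_conts _ _)) (d := .stay) (k' := k) (o := [o]) fun w => rfl

theorem Stmt.reach_adv (hc : adv.conts k ⊆ p.conts []) :
    (p.machine I).Reach x s (confR I p (adv :: k) i ρ out)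
      (confR I p k (min (i + 1) (x.length + 1)) ρ out) := by
  simpa [moveIn] using reach_one (x := x) (s := s) (i := i) (ρ := ρ) (out := out)
    (hc (cons_mem_conts _ _)) (d := .right) (k' := k) (o := []) fun w => rfl

theorem Stmt.reach_seq {a b : Stmt R O} (hc : (seq a b).conts k ⊆ p.conts []) :
    (p.machine I).Reach x s (confR I p (seq a b :: k) i ρ out)
      (confR I p (a :: b :: k) i ρ out) := by
  simpa [moveIn] using reach_one (x := x) (s := s) (i := i) (ρ := ρ) (out := out)
    (hc (cons_mem_conts _ _)) (d := .stay) (k' := a :: b :: k) (o := []) fun w => rfl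

/-- A loop that advances the input head as often as register `b` says. -/
theorem Stmt.reach_advLoop {v b : R} (hvb : v ≠ b)
    (hc : (Prog.forLoop v b adv).conts k ⊆ p.conts []) (hi : i ≤ x.length + 1)
    (hv : (ρ v).size ≤ s) (hb : (ρ b).size ≤ s) :
    (p.machine I).Reach x s (confR I p (Prog.forLoop v b adv :: k) i ρ out)
      (confR I p k (min (i + ρ b) (x.length + 1)) (Function.update ρ v (ρ b)) out) := by
  refine (reach_seq hc).trans ?_
  refine (reach_clr (conts_seq_left hc) hv).trans ?_
  have hc' := conts_seq_right hc
  have key : ∀ (j u i' : ℕ), u + j = ρ b → i' = min (i + u) (x.length + 1) →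
      (p.machine I).Reach x s (confR I p (whileNe v b (seq adv (inc v)) :: k) i'
        (Function.update ρ v u) out)
      (confR I p k (min (i + ρ b) (x.length + 1)) (Function.update ρ v (ρ b)) out) := by
    intro j
    induction j with
    | zero =>
      intro u i' hu hi'
      obtain rfl : u = ρ b := hu
      refine (reach_whileNe hc' (by simpa using hb)).trans ?_
      rw [if_pos (by simp [hvb.symm]), hi']
      exact Reach.refl (head_conf_le (Nat.zero_le _))
    | succ j ih =>
      intro u i' hu hi'
      refine (reach_whileNe hc' ?_).trans ?_
      · simpa using (Nat.size_le_size (by omega)).trans hb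
      rw [if_neg (by simp [hvb.symm]; omega)]
      have hc2 := conts_whileNe hc'
      refine (reach_seq hc2).trans ?_
      refine (reach_adv (conts_seq_left hc2)).trans ?_
      refine (reach_inc (conts_seq_right hc2) ?_).trans ?_
      · simpa using (Nat.size_le_size (by omega)).trans hb
      simp only [Function.update_self, Function.update_idem]
      exact ih (u + 1) _ (by omega) (by omega)
  exact key (ρ b) 0 i (by simp) (by omega)

end Run

section Compile

variable {I O : Type} {t : ℕ} {p : Stmt (Fin (t + 2)) O} {x : List I} {s : ℕ}

/-- The execution of a loop program produces its output; the registers in use keep their values. -/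
theorem Prog.reach_toStmt {i B : ℕ} (hB : B.size ≤ s) (P : Prog O) :
    ∀ (d : ℕ) (e : ℕ → ℕ) (k : List (Stmt (Fin (t + 2)) O)) (ρ : Fin (t + 2) → ℕ)
      (out : List O),
    P.WF d → d + P.height ≤ t + 2 → (P.toStmt t d).conts k ⊆ p.conts [] →
    (∀ j < d, ρ (reg t j) = e j) → (∀ r, ρ r ≤ B) →
    ∃ ρ', (∀ j < d, ρ' (reg t j) = e j) ∧ (∀ r, ρ' r ≤ B) ∧
      (p.machine I).Reach x s (confR I p (P.toStmt t d :: k) i ρ out)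
        (confR I p k i ρ' (out ++ P.sem d e)) := by
  have hB' : ∀ n ≤ B, n.size ≤ s := fun n hn => (Nat.size_le_size hn).trans hB
  induction P with
  | nil =>
    intro d e k ρ out _ _ hc hρ hρB
    exact ⟨ρ, hρ, hρB, by simpa [sem, toStmt] using reach_skip hc⟩
  | emit o =>
    intro d e k ρ out _ _ hc hρ hρB
    exact ⟨ρ, hρ, hρB, reach_emit hc⟩
  | seq a b iha ihb =>
    intro d e k ρ out hw hh hc hρ hρB
    simp only [height] at hh
    obtain ⟨ρ₁, h1, h1', r1⟩ := iha d e (b.toStmt t d :: k) ρ out hw.1 (by omega)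
      (conts_seq_left hc) hρ hρB
    obtain ⟨ρ₂, h2, h2', r2⟩ := ihb d e k ρ₁ (out ++ a.sem d e) hw.2 (by omega)
      (conts_seq_right hc) h1 h1'
    refine ⟨ρ₂, h2, h2', (reach_seq hc).trans (r1.trans ?_)⟩
    simpa [sem] using r2
  | loop b a ih =>
    intro d e k ρ out hw hh hc hρ hρB
    simp only [height] at hh
    have hd : d < t + 2 := by omega
    have hbd : b < d := hw.1
    have hne : ∀ j < d, reg t j ≠ reg t d := fun j hj => reg_ne (by omega) hd (by omega)
    have hc' := conts_seq_right hc
    have hc2 := conts_whileNe hc'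
    have heB : e b ≤ B := by rw [← hρ b hbd]; exact hρB _
    have key : ∀ (j u : ℕ) (ρ : Fin (t + 2) → ℕ) (out : List O), u + j = e b →
        (∀ j < d, ρ (reg t j) = e j) → ρ (reg t d) = u → (∀ r, ρ r ≤ B) →
        ∃ ρ', (∀ j < d, ρ' (reg t j) = e j) ∧ (∀ r, ρ' r ≤ B) ∧
        (p.machine I).Reach x s (confR I p (whileNe (reg t d) (reg t b)
            (.seq (a.toStmt t (d + 1)) (.inc (reg t d))) :: k) i ρ out)
          (confR I p k i ρ' (out ++ (List.range' u j).flatMap fun i =>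
            a.sem (d + 1) (Function.update e d i))) := by
      intro j
      induction j with
      | zero =>
        intro u ρ out hu hρ hρd hρB
        refine ⟨ρ, hρ, hρB, (reach_whileNe hc' (hB' _ (hρB _))).trans ?_⟩
        rw [if_pos (by rw [hρ b hbd, hρd]; omega)]
        rw [List.range'_zero, List.flatMap_nil, List.append_nil]
        exact Reach.refl (head_conf_le (Nat.zero_le _))
      | succ j ihj =>
        intro u ρ out hu hρ hρd hρB
        obtain ⟨ρ₁, h1, h1', r1⟩ := ih (d + 1) (Function.update e d u)
          (inc (reg t d) :: whileNe (reg t d) (reg t b)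
            (.seq (a.toStmt t (d + 1)) (.inc (reg t d))) :: k) ρ out hw.2 (by omega)
          (conts_seq_left hc2) (fun j hj => by
            rcases Nat.lt_succ_iff_lt_or_eq.1 hj with h | rfl
            · rw [hρ j h, Function.update_of_ne h.ne]
            · rw [hρd, Function.update_self]) hρB
        have h1d : ρ₁ (reg t d) = u := by simpa using h1 d (by omega)
        obtain ⟨ρ₂, h2, h2', r2⟩ := ihj (u + 1)
          (Function.update ρ₁ (reg t d) (ρ₁ (reg t d) + 1))
          (out ++ a.sem (d + 1) (Function.update e d u)) (by omega)
          (fun j hj => by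
            rw [Function.update_of_ne (hne j hj), h1 j (by omega), Function.update_of_ne hj.ne])
          (by rw [Function.update_self, h1d])
          (fun r => by
            by_cases hr : r = reg t d
            · subst hr; rw [Function.update_self, h1d]; omega
            · rw [Function.update_of_ne hr]; exact h1' r)
        refine ⟨ρ₂, h2, h2', (reach_whileNe hc' (hB' _ (hρB _))).trans ?_⟩
        rw [if_neg (by rw [hρ b hbd, hρd]; omega)]
        refine (reach_seq hc2).trans (r1.trans ?_)
        refine (reach_inc (conts_seq_right hc2) (hB' _ (by omega))).trans ?_
        simpa [List.range'_succ] using r2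
    obtain ⟨ρ', h1, h2, r⟩ := key (e b) 0 (Function.update ρ (reg t d) 0) out (by simp)
      (fun j hj => by rw [Function.update_of_ne (hne j hj), hρ j hj]) (by simp)
      (fun r => by
        by_cases hr : r = reg t d
        · subst hr; simp
        · rw [Function.update_of_ne hr]; exact hρB r)
    refine ⟨ρ', h1, h2, (reach_seq hc).trans
      ((reach_clr (conts_seq_left hc) (hB' _ (hρB _))).trans ?_)⟩
    rw [sem, List.range_eq_range']
    exact r

/-- Increments register `0` and advances the input head by `2 * r + 3`, where `r` is the old value
of the register, until the input is exhausted. -/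
def sqrtLoop (t : ℕ) (O : Type) : Stmt (Fin (t + 2)) O :=
  .whileIn (.seq (Prog.forLoop (Prog.reg t 1) (Prog.reg t 0) .adv)
    (.seq (Prog.forLoop (Prog.reg t 1) (Prog.reg t 0) .adv)
      (.seq .adv (.seq .adv (.seq .adv (.inc (Prog.reg t 0)))))))

/-- Computes the integer square root of the length of the input in register `0`: the input head is
kept at position `(r + 1) ^ 2`, where `r` is the value of register `0`. -/
def sqrtStmt (t : ℕ) (O : Type) : Stmt (Fin (t + 2)) O := .seq .adv (sqrtLoop t O)

theorem reach_sqrtStmt {k : List (Stmt (Fin (t + 2)) O)}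
    (hc : (sqrtStmt t O).conts k ⊆ p.conts []) (hs : x.length.size ≤ s) :
    ∃ ρ : Fin (t + 2) → ℕ, ρ (Prog.reg t 0) = x.length.sqrt ∧ (∀ r, ρ r ≤ x.length) ∧
      (p.machine I).Reach x s (confR I p (sqrtStmt t O :: k) 0 (fun _ => 0) [])
        (confR I p k (x.length + 1) ρ []) := by
  have hB' : ∀ n ≤ x.length, n.size ≤ s := fun n hn => (Nat.size_le_size hn).trans hs
  have h10 : Prog.reg t 1 ≠ Prog.reg t 0 := Prog.reg_ne (by omega) (by omega) (by omega)
  have hc1 := conts_seq_right hc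
  have hc2 := conts_whileIn hc1
  have hc3 := conts_seq_right hc2
  have hc4 := conts_seq_right hc3
  have hc5 := conts_seq_right hc4
  have hc6 := conts_seq_right hc5
  have hsq := Nat.sqrt_le_self x.length
  have key : ∀ (j : ℕ) (ρ : Fin (t + 2) → ℕ), ρ (Prog.reg t 0) + j = x.length.sqrt →
      (∀ r, ρ r ≤ x.length) →
      ∃ ρ' : Fin (t + 2) → ℕ, ρ' (Prog.reg t 0) = x.length.sqrt ∧ (∀ r, ρ' r ≤ x.length) ∧
      (p.machine I).Reach x s (confR I p (sqrtLoop t O :: k)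
        (min ((ρ (Prog.reg t 0) + 1) ^ 2) (x.length + 1)) ρ [])
        (confR I p k (x.length + 1) ρ' []) := by
    intro j
    induction j with
    | zero =>
      intro ρ h0 hρ
      refine ⟨ρ, h0, hρ, (reach_whileIn hc1 (by omega)).trans ?_⟩
      -- At the square root, the head has been moved to the right end marker.
      have : x.length + 1 ≤ (ρ (Prog.reg t 0) + 1) ^ 2 := by
        rw [Nat.add_zero] at h0
        rw [h0]
        exact Nat.lt_succ_sqrt' _
      rw [min_eq_right this, if_pos rfl]
      exact Reach.refl (head_conf_le (Nat.zero_le _))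
    | succ j ih =>
      intro ρ h0 hρ
      set r := ρ (Prog.reg t 0) with hr
      have hlt : (r + 1) ^ 2 < x.length + 1 := by
        have : r + 1 ≤ x.length.sqrt := by omega
        have := Nat.le_sqrt'.1 this
        omega
      obtain ⟨ρ', h1, h2, h3⟩ := ih (Function.update (Function.update ρ (Prog.reg t 1) r)
          (Prog.reg t 0) (r + 1)) (by simp; omega) (fun q => by
            by_cases hq : q = Prog.reg t 0
            · subst hq; rw [Function.update_self]; omega
            · rw [Function.update_of_ne hq]
              by_cases hq : q = Prog.reg t 1
              · subst hq; rw [Function.update_self]; omega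
              · rw [Function.update_of_ne hq]; exact hρ q)
      refine ⟨ρ', h1, h2, (reach_whileIn hc1 (by omega)).trans ?_⟩
      rw [min_eq_left hlt.le, if_neg hlt.ne]
      refine (reach_seq hc2).trans ?_
      refine (reach_advLoop h10 (conts_seq_left hc2) hlt.le (hB' _ (hρ _)) (hB' _ (hρ _))).trans ?_
      refine (reach_seq hc3).trans ?_
      refine (reach_advLoop h10 (conts_seq_left hc3) (by omega)
        (by simpa using hB' _ (hρ _))
        (by rw [Function.update_of_ne h10.symm]; exact hB' _ (hρ _))).trans ?_
      refine (reach_seq hc4).trans ((reach_adv (conts_seq_left hc4)).trans ?_)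
      refine (reach_seq hc5).trans ((reach_adv (conts_seq_left hc5)).trans ?_)
      refine (reach_seq hc6).trans ((reach_adv (conts_seq_left hc6)).trans ?_)
      refine (reach_inc (conts_seq_right hc6) ?_).trans ?_
      · simp only [Function.update_of_ne h10.symm, ← hr]
        exact hB' _ (by omega)
      simp only [Function.update_of_ne h10.symm, Function.update_idem, Function.update_self,
        ← hr] at h3 ⊢
      rw [sqrtLoop] at h3
      convert h3 using 2
      -- The head has moved from one square to the next.
      have : (r + 1 + 1) ^ 2 = (r + 1) ^ 2 + r + r + 3 := by ring
      omega
  obtain ⟨ρ', h1, h2, h3⟩ := key x.length.sqrt (fun _ => 0) (by simp) (by simp)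
  refine ⟨ρ', h1, h2, (reach_seq hc).trans ((reach_adv (conts_seq_left hc)).trans ?_)⟩
  simpa using h3

end Compile

/-- The output of a loop program, as a function of the integer square root of the length of the
input, is computable in logarithmic space. -/
theorem Prog.logspaceComputable {I O : Type} (P : Prog O) (hP : P.WF 1) :
    LogspaceComputable fun x : List I => P.sem 1 fun _ => x.length.sqrt := by
  set t := P.height
  set p : Stmt (Fin (t + 2)) O := .seq (sqrtStmt t O) (P.toStmt t 1) with hp
  refine ⟨p.machine I, 1, fun x => ?_⟩
  have hs : x.length.size ≤ 1 * (Nat.log 2 x.length + 1) := by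
    rw [one_mul, Nat.size_le]
    exact Nat.lt_pow_succ_log_self one_lt_two _
  have hc : p.conts [] ⊆ p.conts [] := subset_rfl
  obtain ⟨ρ, h1, h2, h3⟩ := reach_sqrtStmt (x := x) (conts_seq_left hc) hs
  obtain ⟨ρ', -, -, h4⟩ := P.reach_toStmt (I := I) (x := x) (i := x.length + 1) hs 1
    (fun _ => x.length.sqrt)
    [] ρ [] hP (by omega) (conts_seq_right hc) (fun j hj => by
      obtain rfl : j = 0 := by omega
      exact h1) h2
  exact computesInSpace ((reach_seq hc).trans (h3.trans h4))

/-! ### Programs that write numbers -/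

/-- Polynomial expressions in registers. -/
inductive Exp where
  | const (c : ℕ)
  | var (i : ℕ)
  | add (a b : Exp)
  | mul (a b : Exp)

namespace Exp

/-- The value of an expression. -/
def val (e : ℕ → ℕ) : Exp → ℕ
  | const c => c
  | var i => e i
  | add a b => a.val e + b.val e
  | mul a b => a.val e * b.val e

/-- Only the first `d` registers occur. -/
def WF (d : ℕ) : Exp → Prop
  | const _ => True
  | var i => i < d
  | add a b => a.WF d ∧ b.WF d
  | mul a b => a.WF d ∧ b.WF d

theorem val_congr {d : ℕ} {e e' : ℕ → ℕ} (h : ∀ j < d, e' j = e j) {a : Exp} (ha : a.WF d) :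
    a.val e' = a.val e := by
  induction a with
  | const c => rfl
  | var i => exact h i ha
  | add a b iha ihb => rw [val, val, iha ha.1, ihb ha.2]
  | mul a b iha ihb => rw [val, val, iha ha.1, ihb ha.2]

theorem WF.mono {d d' : ℕ} (h : d ≤ d') {a : Exp} (ha : a.WF d) : a.WF d' := by
  induction a with
  | const c => trivial
  | var i => exact lt_of_lt_of_le ha h
  | add a b iha ihb => exact ⟨iha ha.1, ihb ha.2⟩
  | mul a b iha ihb => exact ⟨iha ha.1, ihb ha.2⟩

/-- The number `m ^ n` of `n`-tuples, where register `0` holds `m`. -/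
def pow : ℕ → Exp
  | 0 => const 1
  | n + 1 => mul (pow n) (var 0)

/-- The lexicographic index of the tuple in the registers `1, …, n`, where register `0` holds the
size of the domain. -/
def idx : ℕ → Exp
  | 0 => const 0
  | n + 1 => add (mul (idx n) (var 0)) (var (n + 1))

theorem val_pow (e : ℕ → ℕ) (n : ℕ) : (pow n).val e = e 0 ^ n := by
  induction n with
  | zero => rfl
  | succ n ih => rw [pow, val, ih, pow_succ]; rfl

theorem WF_pow (n : ℕ) : (pow n).WF 1 := by
  induction n with
  | zero => trivial
  | succ n ih => exact ⟨ih, Nat.one_pos⟩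

theorem WF_idx (n : ℕ) : (idx n).WF (n + 1) := by
  induction n with
  | zero => trivial
  | succ n ih => exact ⟨⟨ih.mono (by omega), Nat.succ_pos _⟩, Nat.lt_succ_self _⟩

end Exp

namespace Prog

variable {O : Type}

/-- Run the programs of a list one after the other. -/
def seqs (l : List (Prog O)) : Prog O := l.foldr seq nil

/-- Run a program as often as an expression says. -/
def rep : Exp → Prog O → Prog O
  | .const c, P => seqs (List.replicate c P)
  | .var i, P => loop i P
  | .add a b, P => seq (rep a P) (rep b P)
  | .mul a b, P => rep a (rep b P)

theorem sem_seqs (l : List (Prog O)) (d : ℕ) (e : ℕ → ℕ) :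
    (seqs l).sem d e = l.flatMap fun P => P.sem d e := by
  induction l with
  | nil => rfl
  | cons P l ih => rw [List.flatMap_cons, ← ih]; rfl

theorem WF_seqs {l : List (Prog O)} {d : ℕ} (h : ∀ P ∈ l, P.WF d) : (seqs l).WF d := by
  induction l with
  | nil => trivial
  | cons P l ih =>
    exact ⟨h P (by simp), ih fun Q hQ => h Q (by simp [hQ])⟩

/-- Repeating a program whose output depends only on the first `d` registers. The statement is about
all numbers `d' ≥ d` of registers in use, as repetitions are nested. -/
theorem sem_rep {x : Exp} {d : ℕ} (hx : x.WF d) {e : ℕ → ℕ} : ∀ {P : Prog O} {s : List O},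
    (∀ d' ≥ d, ∀ e' : ℕ → ℕ, (∀ j < d, e' j = e j) → P.sem d' e' = s) →
    ∀ d' ≥ d, ∀ e' : ℕ → ℕ, (∀ j < d, e' j = e j) →
      (rep x P).sem d' e' = (List.replicate (x.val e) s).flatten := by
  induction x with
  | const c =>
    intro P s hP d' hd e' he
    simp [rep, sem_seqs, Exp.val, List.flatMap_replicate, hP d' hd e' he]
  | var i =>
    intro P s hP d' hd e' he
    have hi : i < d := hx
    have : ∀ j, P.sem (d' + 1) (Function.update e' d' j) = s := fun j =>
      hP _ (by omega) _ fun l hl => by rw [Function.update_of_ne (by omega), he l hl]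
    simp [rep, sem, this, Exp.val, he i hi, List.flatMap, List.map_const']
  | add a b iha ihb =>
    intro P s hP d' hd e' he
    rw [rep, sem, iha hx.1 hP d' hd e' he, ihb hx.2 hP d' hd e' he, Exp.val, List.replicate_add,
      List.flatten_append]
  | mul a b iha ihb =>
    intro P s hP d' hd e' he
    rw [rep, iha hx.1 (ihb hx.2 hP) d' hd e' he, Exp.val]
    induction a.val e with
    | zero => simp
    | succ n ih => 
      rw [List.replicate_succ, List.flatten_cons, ih, add_mul, one_mul, add_comm (n * _),
        List.replicate_add, List.flatten_append]

theorem WF_rep {x : Exp} {d : ℕ} (hx : x.WF d) : ∀ {P : Prog O}, (∀ d' ≥ d, P.WF d') →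
    ∀ d' ≥ d, (rep x P).WF d' := by
  induction x with
  | const c =>
    intro P hP d' hd
    exact WF_seqs fun Q hQ => by rw [List.eq_of_mem_replicate hQ]; exact hP d' hd
  | var i =>
    intro P hP d' hd
    exact ⟨lt_of_lt_of_le hx hd, hP _ (by omega)⟩
  | add a b iha ihb =>
    intro P hP d' hd
    exact ⟨iha hx.1 hP d' hd, ihb hx.2 hP d' hd⟩
  | mul a b iha ihb =>
    intro P hP d' hd
    exact iha hx.1 (ihb hx.2 hP) d' hd

/-- Write down the value of an expression. -/
def num (x : Exp) : Prog DescSym := seq (emit .sep) (rep x (emit .one))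

theorem sem_num {x : Exp} {d d' : ℕ} (hx : x.WF d) {e e' : ℕ → ℕ} (hd : d ≤ d')
    (he : ∀ j < d, e' j = e j) : (num x).sem d' e' = descNums [x.val e] := by
  have := sem_rep (O := DescSym) hx (e := e) (P := emit .one) (s := [.one])
    (fun _ _ _ _ => rfl) d' hd e' he
  rw [num, sem, this]
  simp [descNums, sem]

theorem WF_num {x : Exp} {d d' : ℕ} (hx : x.WF d) (hd : d ≤ d') : (num x).WF d' :=
  ⟨trivial, WF_rep (P := emit DescSym.one) hx (fun _ _ => trivial) d' hd⟩

end Prog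

/-! ### Layers of gates -/

/-- A part of a list of gate numbers: the number `x` repeated `c` times, or the numbers `x` where
the first free register runs through the domain, whose size is in register `0`. -/
inductive Item where
  | rep (c x : Exp)
  | rng (x : Exp)

namespace Item

/-- The gate numbers that an item stands for. -/
def nums (d : ℕ) (e : ℕ → ℕ) : Item → List ℕ
  | rep c x => List.replicate (c.val e) (x.val e)
  | rng x => (List.range (e 0)).map fun j => x.val (Function.update e d j)

/-- Only the first `d` registers and the bound one occur. -/
def WF (d : ℕ) : Item → Prop
  | rep c x => c.WF d ∧ x.WF d
  | rng x => x.WF (d + 1)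

/-- The program that writes the gate numbers of an item. -/
def prog : Item → Prog DescSym
  | rep c x => Prog.rep c (Prog.num x)
  | rng x => .loop 0 (Prog.num x)

theorem sem_prog {d : ℕ} {i : Item} (h : i.WF d) (e : ℕ → ℕ) :
    i.prog.sem d e = descNums (i.nums d e) := by
  cases i with
  | rep c x =>
    rw [prog, Prog.sem_rep h.1 (e := e) (s := descNums [x.val e])
      (fun d' hd e' he => Prog.sem_num h.2 hd he) d le_rfl e (fun _ _ => rfl)]
    simp [nums, descNums, List.flatMap_replicate]
  | rng x =>
    have : ∀ j, (Prog.num x).sem (d + 1) (Function.update e d j) =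
        descNums [x.val (Function.update e d j)] := fun j =>
      Prog.sem_num h le_rfl (fun _ _ => rfl)
    simp [prog, Prog.sem, this, nums, descNums, List.flatMap_map]

theorem WF_prog {d : ℕ} (hd : 0 < d) {i : Item} (h : i.WF d) : i.prog.WF d := by
  cases i with
  | rep c x => exact Prog.WF_rep h.1 (fun d' hd => Prog.WF_num h.2 hd) d le_rfl
  | rng x => exact ⟨hd, Prog.WF_num h le_rfl⟩

end Item

/-- A gate whose arguments depend on registers. -/
inductive Template where
  | input (x : Exp)
  | not (x : Exp)
  | and (l : List Item)
  | or (l : List Item)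
  | maj (l : List Item)

namespace Template

/-- The gate for given values of the first `d` registers. -/
def gate (d : ℕ) (e : ℕ → ℕ) : Template → Gate
  | input x => .input (x.val e)
  | not x => .not (x.val e)
  | and l => .and (l.flatMap (Item.nums d e))
  | or l => .or (l.flatMap (Item.nums d e))
  | maj l => .maj (l.flatMap (Item.nums d e))

/-- Only the first `d` registers and bound ones occur. -/
def WF (d : ℕ) : Template → Prop
  | input x => x.WF d
  | not x => x.WF d
  | and l => ∀ i ∈ l, i.WF d
  | or l => ∀ i ∈ l, i.WF d
  | maj l => ∀ i ∈ l, i.WF d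

/-- The program that writes the gate. -/
def prog : Template → Prog DescSym
  | input x => .seq (.emit .tInput) (Prog.num x)
  | not x => .seq (.emit .tNot) (Prog.num x)
  | and l => .seq (.emit .tAnd) (Prog.seqs (l.map Item.prog))
  | or l => .seq (.emit .tOr) (Prog.seqs (l.map Item.prog))
  | maj l => .seq (.emit .tMaj) (Prog.seqs (l.map Item.prog))

theorem sem_items {d : ℕ} {l : List Item} (h : ∀ i ∈ l, i.WF d) (e : ℕ → ℕ) :
    (Prog.seqs (l.map Item.prog)).sem d e = descNums (l.flatMap (Item.nums d e)) := by
  rw [Prog.sem_seqs, List.flatMap_map, descNums, List.flatMap_assoc]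
  induction l with
  | nil => rfl
  | cons i l ih =>
    rw [List.flatMap_cons, List.flatMap_cons, ih fun j hj => h j (by simp [hj]),
      Item.sem_prog (h i (by simp))]
    rfl

theorem sem_prog {d : ℕ} {g : Template} (h : g.WF d) (e : ℕ → ℕ) :
    g.prog.sem d e = (g.gate d e).desc := by
  cases g with
  | input x =>
    rw [prog, Prog.sem, Prog.sem_num h le_rfl (fun _ _ => rfl)]
    rfl
  | not x =>
    rw [prog, Prog.sem, Prog.sem_num h le_rfl (fun _ _ => rfl)]
    rfl
  | and l => rw [prog, Prog.sem, sem_items h]; rfl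
  | or l => rw [prog, Prog.sem, sem_items h]; rfl
  | maj l => rw [prog, Prog.sem, sem_items h]; rfl

theorem WF_prog {d : ℕ} (hd : 0 < d) {g : Template} (h : g.WF d) : g.prog.WF d := by
  have key : ∀ l : List Item, (∀ i ∈ l, i.WF d) → (Prog.seqs (l.map Item.prog)).WF d := by
    intro l hl
    refine Prog.WF_seqs fun P hP => ?_
    obtain ⟨i, hi, rfl⟩ := List.mem_map.1 hP
    exact Item.WF_prog hd (hl i hi)
  cases g with
  | input x => exact ⟨trivial, Prog.WF_num h le_rfl⟩
  | not x => exact ⟨trivial, Prog.WF_num h le_rfl⟩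
  | and l => exact ⟨trivial, key l h⟩
  | or l => exact ⟨trivial, key l h⟩
  | maj l => exact ⟨trivial, key l h⟩

end Template

/-- The assignments of the registers `1, …, n` to elements of the domain `{0, …, m - 1}` in
lexicographic order. Register `0` holds `m`. -/
def envs (m : ℕ) : ℕ → List (ℕ → ℕ)
  | 0 => [fun _ => m]
  | n + 1 => (envs m n).flatMap fun e => (List.range m).map fun a => Function.update e (n + 1) a

theorem env_zero {m n : ℕ} {e : ℕ → ℕ} (he : e ∈ envs m n) : e 0 = m := by
  induction n generalizing e with
  | zero =>
    rw [envs, List.mem_singleton] at he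
    rw [he]
  | succ n ih =>
    simp only [envs, List.mem_flatMap, List.mem_map, List.mem_range] at he
    obtain ⟨e', he', a, -, rfl⟩ := he
    rw [Function.update_of_ne (by omega), ih he']

theorem update_mem_envs {m n a : ℕ} {e : ℕ → ℕ} (he : e ∈ envs m n) (ha : a < m) :
    Function.update e (n + 1) a ∈ envs m (n + 1) := by
  simp only [envs, List.mem_flatMap, List.mem_map, List.mem_range]
  exact ⟨e, he, a, ha, rfl⟩

theorem env_lt {m n : ℕ} {e : ℕ → ℕ} (he : e ∈ envs m n) {i : ℕ} (h1 : 1 ≤ i) (h2 : i ≤ n) :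
    e i < m := by
  induction n generalizing e with
  | zero => omega
  | succ n ih =>
    simp only [envs, List.mem_flatMap, List.mem_map, List.mem_range] at he
    obtain ⟨e', he', a, ha, rfl⟩ := he
    by_cases hi : i = n + 1
    · subst hi; simpa using ha
    · rw [Function.update_of_ne hi]
      exact ih he' (by omega)

theorem length_envs (m n : ℕ) : (envs m n).length = m ^ n := by
  induction n with
  | zero => rfl
  | succ n ih => simp [envs, List.length_flatMap, ih, pow_succ]

theorem getElem?_flatMap_block {α β : Type*} {l : List α} {f : α → List β} {m : ℕ}
    (hf : ∀ a ∈ l, (f a).length = m) {i j : ℕ} {a : α} (ha : l[i]? = some a) (hj : j < m) :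
    (l.flatMap f)[i * m + j]? = (f a)[j]? := by
  induction l generalizing i with
  | nil => simp at ha
  | cons b l ih =>
    have hb := hf b (by simp)
    rw [List.flatMap_cons, List.getElem?_append]
    cases i with
    | zero =>
      obtain rfl : b = a := by simpa using ha
      rw [if_pos (by omega)]
      simp
    | succ i =>
      rw [if_neg (by rw [hb, add_mul]; omega), hb,
        show (i + 1) * m + j - m = i * m + j by rw [add_mul]; omega]
      exact ih (fun a ha => hf a (by simp [ha])) (by simpa using ha)

theorem getElem?_envs {m n : ℕ} {e : ℕ → ℕ} (he : e ∈ envs m n) :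
    (envs m n)[(Exp.idx n).val e]? = some e := by
  induction n generalizing e with
  | zero =>
    rw [envs, List.mem_singleton] at he
    subst he
    rfl
  | succ n ih =>
    simp only [envs, List.mem_flatMap, List.mem_map, List.mem_range] at he
    obtain ⟨e', he', a, ha, rfl⟩ := he
    have h1 : (Exp.idx n).val (Function.update e' (n + 1) a) = (Exp.idx n).val e' :=
      Exp.val_congr (fun j hj => Function.update_of_ne (by omega) _ _) (Exp.WF_idx n)
    simp only [Exp.idx, Exp.val, h1, Function.update_self]
    rw [Function.update_of_ne (by omega), env_zero he', envs,
      getElem?_flatMap_block (a := e') (by simp) (ih he') ha]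
    simp [ha]

theorem idx_lt {m n : ℕ} {e : ℕ → ℕ} (he : e ∈ envs m n) : (Exp.idx n).val e < m ^ n := by
  rw [← length_envs]
  exact (List.getElem?_eq_some_iff.1 (getElem?_envs he)).1

/-- Run a program for all assignments of the registers `1, …, n`. -/
def Prog.nest {O : Type} : ℕ → Prog O → Prog O
  | 0, P => P
  | n + 1, P => nest n (.loop 0 P)

theorem Prog.sem_nest {O : Type} (m n : ℕ) (P : Prog O) :
    (Prog.nest n P).sem 1 (fun _ => m) = (envs m n).flatMap fun e => P.sem (n + 1) e := by
  induction n generalizing P with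
  | zero => simp [nest, envs]
  | succ n ih =>
    rw [nest, ih, envs, List.flatMap_assoc]
    refine List.flatMap_congr fun e he => ?_
    rw [sem, env_zero he, List.flatMap_map]

theorem Prog.WF_nest {O : Type} {n : ℕ} {P : Prog O} (h : P.WF (n + 1)) : (nest n P).WF 1 := by
  induction n generalizing P with
  | zero => exact h
  | succ n ih => exact ih ⟨by omega, h⟩

/-- A layer of a circuit: one gate for every assignment of the registers `1, …, arity`. -/
structure Layer where
  arity : ℕ
  tmpl : Template

namespace Layer

/-- The gates of a layer over a domain of size `m`. -/
def gates (m : ℕ) (L : Layer) : List Gate :=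
  (envs m L.arity).map fun e => L.tmpl.gate (L.arity + 1) e

/-- The program that writes a layer. -/
def prog (L : Layer) : Prog DescSym := Prog.nest L.arity L.tmpl.prog

/-- Only registers in use occur. -/
def WF (L : Layer) : Prop := L.tmpl.WF (L.arity + 1)

theorem sem_prog {L : Layer} (h : L.WF) (m : ℕ) :
    L.prog.sem 1 (fun _ => m) = (L.gates m).flatMap Gate.desc := by
  rw [prog, Prog.sem_nest, gates, List.flatMap_map]
  exact List.flatMap_congr fun e _ => Template.sem_prog h e

theorem WF_prog {L : Layer} (h : L.WF) : L.prog.WF 1 :=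
  Prog.WF_nest (Template.WF_prog (Nat.succ_pos _) h)

theorem length_gates (m : ℕ) (L : Layer) : (L.gates m).length = m ^ L.arity := by
  rw [gates, List.length_map, length_envs]

end Layer

/-! ### Evaluating a circuit layer by layer -/

/-- Computes a value for each element of a list from the values of the earlier elements. -/
def scan {α β : Type*} (F : α → List β → β) (l : List α) : List β :=
  l.foldl (fun vs a => vs ++ [F a vs]) []

section Scan

variable {α β : Type*} {F : α → List β → β}

theorem scan_concat (l : List α) (a : α) : scan F (l ++ [a]) = scan F l ++ [F a (scan F l)] := by
  simp [scan]

theorem length_scan (l : List α) : (scan F l).length = l.length := by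
  induction l using List.reverseRecOn with
  | nil => rfl
  | append_singleton l a ih => simp [scan_concat, ih]

theorem scan_append_prefix (l l' : List α) : ∃ r, scan F (l ++ l') = scan F l ++ r := by
  induction l' using List.reverseRecOn with
  | nil => exact ⟨[], by simp⟩
  | append_singleton l' a ih =>
    obtain ⟨r, hr⟩ := ih
    exact ⟨r ++ [F a (scan F (l ++ l'))], by
      rw [← List.append_assoc, scan_concat, hr, List.append_assoc]⟩

theorem getD_scan_append (l l' : List α) (b : β) {j : ℕ} (hj : j < l.length) :
    (scan F (l ++ l')).getD j b = (scan F l).getD j b := by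
  obtain ⟨r, hr⟩ := scan_append_prefix (F := F) l l'
  rw [hr, List.getD_append _ _ _ _ (by rwa [length_scan])]

/-- If elements of `l'` do not depend on each other, their values are computed from those of `l`. -/
theorem scan_append (l l' : List α)
    (h : ∀ a ∈ l', ∀ ws, F a (scan F l ++ ws) = F a (scan F l)) :
    scan F (l ++ l') = scan F l ++ l'.map fun a => F a (scan F l) := by
  induction l' using List.reverseRecOn with
  | nil => simp
  | append_singleton l' a ih =>
    rw [← List.append_assoc, scan_concat, ih fun a ha => h a (by simp [ha]), h a (by simp)]
    simp

end Scan

theorem Gate.eval_append {g : Gate} {x vs : List Bool} (h : ∀ j ∈ g.preds, j < vs.length)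
    (ws : List Bool) : g.eval x (vs ++ ws) = g.eval x vs := by
  have key : ∀ j ∈ g.preds, (vs ++ ws).getD j false = vs.getD j false := fun j hj =>
    List.getD_append _ _ _ _ (h j hj)
  cases g with
  | input i => rfl
  | not j => simp only [eval]; rw [key j (by simp [preds])]
  | and js =>
    simp only [eval]
    rw [Bool.eq_iff_iff, List.all_eq_true, List.all_eq_true]
    exact forall₂_congr fun j hj => by rw [key j hj]
  | or js =>
    simp only [eval]
    rw [Bool.eq_iff_iff, List.any_eq_true, List.any_eq_true]
    exact exists_congr fun j => and_congr_right fun hj => by rw [key j hj]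
  | maj js =>
    simp only [eval]
    rw [List.countP_congr fun j hj => by rw [key j hj]]

theorem Gate.depth_append {g : Gate} {vs : List ℕ} (h : ∀ j ∈ g.preds, j < vs.length)
    (ws : List ℕ) : g.depth (vs ++ ws) = g.depth vs := by
  have key : (g.preds.map fun j => (vs ++ ws).getD j 0) = g.preds.map fun j => vs.getD j 0 :=
    List.map_congr_left fun j hj => List.getD_append _ _ _ _ (h j hj)
  cases g <;> simp only [depth, key]

theorem foldr_max_le {l : List ℕ} {D : ℕ} (h : ∀ a ∈ l, a ≤ D) : l.foldr max 0 ≤ D := by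
  induction l with
  | nil => exact Nat.zero_le _
  | cons a l ih => exact max_le (h a (by simp)) (ih fun b hb => h b (by simp [hb]))

theorem Gate.depth_le {g : Gate} {vs : List ℕ} {D : ℕ} (h : ∀ a ∈ vs, a ≤ D) :
    g.depth vs ≤ D + 1 := by
  have key : (g.preds.map fun j => vs.getD j 0).foldr max 0 ≤ D := by
    refine foldr_max_le fun a ha => ?_
    obtain ⟨j, -, rfl⟩ := List.mem_map.1 ha
    by_cases hj : j < vs.length
    · rw [List.getD_eq_getElem _ _ hj]
      exact h _ (List.getElem_mem _)
    · rw [List.getD_eq_default _ _ (by omega)]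
      exact Nat.zero_le _
  cases g with
  | input i => exact Nat.zero_le _
  | _ => simp only [depth]; omega

/-- The values of the gates in a list. -/
def gateVals (x : List Bool) (G : List Gate) : List Bool := scan (fun g vs => g.eval x vs) G

/-- The gates form a legal circuit on `N` inputs of depth at most `D`. -/
structure GoodGates (N D : ℕ) (G : List Gate) : Prop where
  preds : ∀ i (h : i < G.length), ∀ j ∈ (G[i]).preds, j < i
  inputs : ∀ i, Gate.input i ∈ G → i < N
  depth : ∀ a ∈ scan (fun g ds => g.depth ds) G, a ≤ D

/-- A gate that reads inputs among `N` and gates among `K`. -/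
def Gate.Reads (N K : ℕ) (g : Gate) : Prop :=
  (∀ j ∈ g.preds, j < K) ∧ ∀ i, g = .input i → i < N

theorem GoodGates.append {N D : ℕ} {G G' : List Gate} (h : GoodGates N D G)
    (h' : ∀ g ∈ G', g.Reads N G.length) : GoodGates N (D + 1) (G ++ G') where
  preds i hi j hj := by
    by_cases h1 : i < G.length
    · rw [List.getElem_append_left h1] at hj
      exact h.preds i h1 j hj
    · rw [List.getElem_append_right (by omega)] at hj
      have := (h' _ (List.getElem_mem _)).1 j hj
      omega
  inputs i hi := by
    rcases List.mem_append.1 hi with h1 | h1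
    · exact h.inputs i h1
    · exact (h' _ h1).2 i rfl
  depth a ha := by
    rw [scan_append _ _ fun g hg ws => Gate.depth_append
      (fun j hj => by rw [length_scan]; exact (h' g hg).1 j hj) ws] at ha
    rcases List.mem_append.1 ha with h1 | h1
    · exact (h.depth a h1).trans (Nat.le_succ _)
    · obtain ⟨g, -, rfl⟩ := List.mem_map.1 h1
      exact Gate.depth_le h.depth

theorem gateVals_append {N : ℕ} {x : List Bool} {G G' : List Gate}
    (h' : ∀ g ∈ G', g.Reads N G.length) :
    gateVals x (G ++ G') = gateVals x G ++ G'.map fun g => g.eval x (gateVals x G) :=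
  scan_append _ _ fun g hg ws => Gate.eval_append
    (fun j hj => by rw [length_scan]; exact (h' g hg).1 j hj) ws

theorem getD_gateVals_append {x : List Bool} {G G' : List Gate} {j : ℕ} (hj : j < G.length) :
    (gateVals x (G ++ G')).getD j false = (gateVals x G).getD j false :=
  getD_scan_append _ _ _ hj

/-- The value of the gate of a layer for an assignment, found at its lexicographic index. -/
theorem getD_gateVals_layer {N m : ℕ} {x : List Bool} {G : List Gate} {L : Layer}
    (h' : ∀ g ∈ L.gates m, g.Reads N G.length) {e : ℕ → ℕ} (he : e ∈ envs m L.arity) :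
    (gateVals x (G ++ L.gates m)).getD (G.length + (Exp.idx L.arity).val e) false =
      (L.tmpl.gate (L.arity + 1) e).eval x (gateVals x G) := by
  rw [gateVals_append h', List.getD_append_right _ _ _ _ (by simp [gateVals, length_scan])]
  simp [gateVals, length_scan, Layer.gates, List.getD_eq_getElem?_getD, getElem?_envs he]

/-! ### Formulas with majority quantifiers -/

/-- Formulas about an input string read as a binary relation on `{0, …, m - 1}`. Variables are
registers; a formula in context `n` may use the variables `1, …, n` and, in expressions, register
`0`, which holds `m`. The two formulas under `maj` are in context `n + 1`. -/
inductive Form where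
  | inp (i j : ℕ)
  | lt (a b : Exp)
  | not (φ : Form)
  | and (φ ψ : Form)
  | maj (φ ψ : Form)

namespace Form

/-- The truth value of a formula in context `n`: `inp i j` says that the pair of variables is in
the input relation, and `maj φ ψ` that the numbers of `y` with `φ` and of `y` with `ψ` add up to
more than `m`. -/
def eval (x : List Bool) : Form → ℕ → (ℕ → ℕ) → Bool
  | inp i j, _, e => x.getD (e i * e 0 + e j) false
  | lt a b, _, e => decide (a.val e < b.val e)
  | not φ, n, e => !φ.eval x n e
  | and φ ψ, n, e => φ.eval x n e && ψ.eval x n e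
  | maj φ ψ, n, e => decide (e 0 <
      (List.range (e 0)).countP (fun y => φ.eval x (n + 1) (Function.update e (n + 1) y)) +
      (List.range (e 0)).countP (fun y => ψ.eval x (n + 1) (Function.update e (n + 1) y)))

/-- The formula is in context `n`. -/
def WS : Form → ℕ → Prop
  | inp i j, n => (1 ≤ i ∧ i ≤ n) ∧ (1 ≤ j ∧ j ≤ n)
  | lt a b, n => a.WF (n + 1) ∧ b.WF (n + 1)
  | not φ, n => φ.WS n
  | and φ ψ, n => φ.WS n ∧ ψ.WS n
  | maj φ ψ, n => φ.WS (n + 1) ∧ ψ.WS (n + 1)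

end Form

/-- Layers of gates, the number of the first gate of the layer with the result, and the number of
the next free gate. -/
structure Compiled where
  layers : List Layer
  root : Exp
  next : Exp

/-- Appends a layer, whose gates are the new results. -/
def Compiled.snoc (Ls : List Layer) (next : Exp) (L : Layer) : Compiled where
  layers := Ls ++ [L]
  root := next
  next := next.add (Exp.pow L.arity)

/-- Layers that evaluate a formula in context `n` for all values of its variables, where `b` is the
number of the first free gate. The gates `0` and `1` are the constants false and true, so that a
majority gate that reads gate `0` `a` times and gate `1` `b` times decides `a < b`. -/
def Form.compile : Form → ℕ → Exp → Compiled
  | inp i j, n, b => .snoc [] b ⟨n, .input (((Exp.var i).mul (.var 0)).add (.var j))⟩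
  | lt s t, n, b => .snoc [] b ⟨n, .maj [.rep s (.const 0), .rep t (.const 1)]⟩
  | not φ, n, b =>
    let r := φ.compile n b
    .snoc r.layers r.next ⟨n, .not (r.root.add (Exp.idx n))⟩
  | and φ ψ, n, b =>
    let r := φ.compile n b
    let r' := ψ.compile n r.next
    .snoc (r.layers ++ r'.layers) r'.next
      ⟨n, .and [.rep (.const 1) (r.root.add (Exp.idx n)),
        .rep (.const 1) (r'.root.add (Exp.idx n))]⟩
  | maj φ ψ, n, b =>
    let r := φ.compile (n + 1) b
    let r' := ψ.compile (n + 1) r.next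
    .snoc (r.layers ++ r'.layers) r'.next
      ⟨n, .maj [.rng (r.root.add (Exp.idx (n + 1))), .rng (r'.root.add (Exp.idx (n + 1)))]⟩

/-- The gates `G` form a legal circuit with `b` gates, the first two of which are constants. -/
structure Base (N m D : ℕ) (G : List Gate) (b : Exp) : Prop where
  good : GoodGates N D G
  len : G.length = b.val fun _ => m
  wf : b.WF 1
  two : 2 ≤ G.length
  zero : ∀ x, (gateVals x G).getD 0 false = false
  one : ∀ x, (gateVals x G).getD 1 false = true

/-- Appending the layers of `r` to the gates `G` is legal and computes `f`, in context `n`. -/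
structure Spec (N m D : ℕ) (G : List Gate) (r : Compiled) (n : ℕ)
    (f : List Bool → (ℕ → ℕ) → Bool) : Prop where
  base : Base N m (D + r.layers.length) (G ++ r.layers.flatMap (Layer.gates m)) r.next
  wf : r.root.WF 1
  layers : ∀ L ∈ r.layers, L.WF
  lt : ∀ e ∈ envs m n, (r.root.add (Exp.idx n)).val e <
    (G ++ r.layers.flatMap (Layer.gates m)).length
  val : ∀ e ∈ envs m n, ∀ x, (gateVals x (G ++ r.layers.flatMap (Layer.gates m))).getD
    ((r.root.add (Exp.idx n)).val e) false = f x e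

section Spec

variable {N m D : ℕ} {G : List Gate} {b : Exp}

theorem Exp.val_eq_of_env {n : ℕ} {e : ℕ → ℕ} (he : e ∈ envs m n) {a : Exp} (ha : a.WF 1) :
    a.val e = a.val fun _ => m :=
  Exp.val_congr (fun j hj => by
    obtain rfl : j = 0 := by omega
    exact env_zero he) ha

/-- Appending a layer to layers whose gates it reads. -/
theorem Spec.snoc {Ls : List Layer} {L : Layer} {f : List Bool → (ℕ → ℕ) → Bool}
    (h : Base N m (D + Ls.length) (G ++ Ls.flatMap (Layer.gates m)) b)
    (hLs : ∀ L ∈ Ls, L.WF) (hL : L.WF)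
    (hr : ∀ e ∈ envs m L.arity, (L.tmpl.gate (L.arity + 1) e).Reads N
      (G ++ Ls.flatMap (Layer.gates m)).length)
    (hv : ∀ e ∈ envs m L.arity, ∀ x, (L.tmpl.gate (L.arity + 1) e).eval x
      (gateVals x (G ++ Ls.flatMap (Layer.gates m))) = f x e) :
    Spec N m D G (.snoc Ls b L) L.arity f := by
  have hr' : ∀ g ∈ L.gates m, g.Reads N (G ++ Ls.flatMap (Layer.gates m)).length := by
    intro g hg
    obtain ⟨e, he, rfl⟩ := List.mem_map.1 hg
    exact hr e he
  have hG : G ++ (Compiled.snoc Ls b L).layers.flatMap (Layer.gates m) =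
      G ++ Ls.flatMap (Layer.gates m) ++ L.gates m := by
    simp [Compiled.snoc]
  have hroot : ∀ e ∈ envs m L.arity, (b.add (Exp.idx L.arity)).val e =
      (G ++ Ls.flatMap (Layer.gates m)).length + (Exp.idx L.arity).val e := fun e he => by
    rw [Exp.val, Exp.val_eq_of_env he h.wf, h.len]
  constructor
  · rw [hG]
    refine ⟨?_, ?_, ⟨h.wf, Exp.WF_pow _⟩, ?_, fun x => ?_, fun x => ?_⟩
    · have := h.good.append hr'
      simpa [Compiled.snoc, add_assoc] using this
    · rw [List.length_append, h.len, Layer.length_gates]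
      simp [Compiled.snoc, Exp.val, Exp.val_pow]
    · rw [List.length_append]
      exact h.two.trans (Nat.le_add_right _ _)
    · rw [getD_gateVals_append (by have := h.two; omega), h.zero]
    · rw [getD_gateVals_append (by have := h.two; omega), h.one]
  · exact h.wf
  · intro L' hL'
    rcases List.mem_append.1 hL' with h1 | h1
    · exact hLs L' h1
    · rw [List.mem_singleton.1 h1]; exact hL
  · intro e he
    rw [hG, show (Compiled.snoc Ls b L).root = b from rfl, hroot e he]
    have := idx_lt he
    simp only [List.length_append, Layer.length_gates]
    omega
  · intro e he x
    rw [hG, show (Compiled.snoc Ls b L).root = b from rfl, hroot e he,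
      getD_gateVals_layer hr' he, hv e he]

/-- The results of two formulas remain available when the layers of the second are appended to those
of the first. -/
theorem Spec.append {r r' : Compiled} {n n' : ℕ} {f f' : List Bool → (ℕ → ℕ) → Bool}
    (h : Spec N m D G r n f)
    (h' : Spec N m (D + r.layers.length) (G ++ r.layers.flatMap (Layer.gates m)) r' n' f') :
    Base N m (D + (r.layers ++ r'.layers).length)
      (G ++ (r.layers ++ r'.layers).flatMap (Layer.gates m)) r'.next ∧
    (∀ L ∈ r.layers ++ r'.layers, L.WF) ∧
    (∀ e ∈ envs m n, (r.root.add (Exp.idx n)).val e <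
      (G ++ (r.layers ++ r'.layers).flatMap (Layer.gates m)).length) ∧
    (∀ e ∈ envs m n', (r'.root.add (Exp.idx n')).val e <
      (G ++ (r.layers ++ r'.layers).flatMap (Layer.gates m)).length) ∧
    (∀ e ∈ envs m n, ∀ x, (gateVals x (G ++ (r.layers ++ r'.layers).flatMap
      (Layer.gates m))).getD ((r.root.add (Exp.idx n)).val e) false = f x e) ∧
    (∀ e ∈ envs m n', ∀ x, (gateVals x (G ++ (r.layers ++ r'.layers).flatMap
      (Layer.gates m))).getD ((r'.root.add (Exp.idx n')).val e) false = f' x e) := by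
  have hG : G ++ (r.layers ++ r'.layers).flatMap (Layer.gates m) =
      G ++ r.layers.flatMap (Layer.gates m) ++ r'.layers.flatMap (Layer.gates m) := by simp
  rw [hG, List.length_append, ← add_assoc]
  refine ⟨h'.base, ?_, ?_, h'.lt, ?_, h'.val⟩
  · intro L hL
    rcases List.mem_append.1 hL with h1 | h1
    · exact h.layers L h1
    · exact h'.layers L h1
  · intro e he
    rw [List.length_append]
    exact (h.lt e he).trans_le (Nat.le_add_right _ _)
  · intro e he x
    rw [getD_gateVals_append (h.lt e he), h.val e he]

/-- Compiled formulas compute their truth values. -/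
theorem Form.compile_spec (hm : m * m ≤ N) (φ : Form) : ∀ (n : ℕ) {b : Exp} {G : List Gate}
    {D : ℕ}, φ.WS n → Base N m D G b →
    Spec N m D G (φ.compile n b) n fun x e => φ.eval x n e := by
  induction φ with
  | inp i j =>
    intro n b G D hφ hb
    refine Spec.snoc (Ls := []) (L := ⟨n, _⟩) (by simpa using hb) (by simp)
      ⟨⟨Nat.lt_succ_of_le hφ.1.2, Nat.succ_pos _⟩, Nat.lt_succ_of_le hφ.2.2⟩ ?_ ?_
    · intro e he
      refine ⟨by simp [Template.gate, Gate.preds], fun k hk => ?_⟩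
      simp only [Template.gate, Gate.input.injEq, Exp.val, env_zero he] at hk
      have h1 := env_lt he hφ.1.1 hφ.1.2
      have h2 := env_lt he hφ.2.1 hφ.2.2
      nlinarith
    · intro e he x
      rfl
  | lt s t =>
    intro n b G D hφ hb
    refine Spec.snoc (Ls := []) (L := ⟨n, _⟩) (by simpa using hb) (by simp) ?_ ?_ ?_
    · intro i hi
      rcases List.mem_pair.1 hi with rfl | rfl
      · exact ⟨hφ.1, trivial⟩
      · exact ⟨hφ.2, trivial⟩
    · intro e he
      refine ⟨fun j hj => ?_, by simp [Template.gate]⟩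
      have := hb.two
      simp only [Template.gate, Gate.preds, Item.nums, Exp.val, List.flatMap_cons,
        List.flatMap_nil, List.append_nil, List.mem_append, List.mem_replicate] at hj
      simp only [List.flatMap_nil, List.append_nil]
      omega
    · intro e he x
      have h0 := hb.zero x
      have h1 := hb.one x
      simp only [Template.gate, Item.nums, Exp.val, List.flatMap_cons,
        List.flatMap_nil, List.append_nil, Gate.eval, List.length_append, List.length_replicate,
        List.countP_append, List.countP_replicate, h0, h1, Form.eval]
      simp only [Bool.false_eq_true, if_false, if_true, decide_eq_decide]
      omega
  | not φ ih =>
    intro n b G D hφ hb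
    have h := ih n hφ hb
    refine Spec.snoc (L := ⟨n, _⟩) h.base h.layers
      ⟨h.wf.mono (Nat.succ_le_succ (Nat.zero_le _)), Exp.WF_idx n⟩ ?_ ?_
    · intro e he
      refine ⟨fun j hj => ?_, by simp [Template.gate]⟩
      simp only [Template.gate, Gate.preds, List.mem_singleton] at hj
      subst hj
      exact h.lt e he
    · intro e he x
      simp only [Template.gate, Gate.eval, h.val e he x, Form.eval]
  | and φ ψ ihφ ihψ =>
    intro n b G D hφ hb
    have h := ihφ n hφ.1 hb
    have h' := ihψ n hφ.2 h.base
    obtain ⟨hb', hL, lt, lt', v, v'⟩ := h.append h'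
    have one_le : 1 ≤ n + 1 := Nat.succ_le_succ (Nat.zero_le _)
    refine Spec.snoc (L := ⟨n, _⟩) hb' hL ?_ ?_ ?_
    · intro i hi
      rcases List.mem_pair.1 hi with rfl | rfl
      · exact ⟨trivial, h.wf.mono one_le, Exp.WF_idx n⟩
      · exact ⟨trivial, h'.wf.mono one_le, Exp.WF_idx n⟩
    · intro e he
      refine ⟨fun j hj => ?_, by simp [Template.gate]⟩
      simp only [Template.gate, Gate.preds, Item.nums, List.flatMap_cons, List.flatMap_nil,
        List.append_nil, List.mem_append, List.mem_replicate] at hj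
      rcases hj with ⟨-, rfl⟩ | ⟨-, rfl⟩
      · exact lt e he
      · exact lt' e he
    · intro e he x
      have h1 : (Exp.const 1).val e = 1 := rfl
      simp only [Template.gate, Item.nums, List.flatMap_cons, List.flatMap_nil, h1,
        List.append_nil, Gate.eval, List.all_append, List.replicate_one, List.all_cons,
        List.all_nil, Bool.and_true, v e he x, v' e he x, Form.eval]
  | maj φ ψ ihφ ihψ =>
    intro n b G D hφ hb
    have h := ihφ (n + 1) hφ.1 hb
    have h' := ihψ (n + 1) hφ.2 h.base
    obtain ⟨hb', hL, lt, lt', v, v'⟩ := h.append h'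
    have one_le : 1 ≤ n + 1 + 1 := Nat.succ_le_succ (Nat.zero_le _)
    refine Spec.snoc (L := ⟨n, _⟩) hb' hL ?_ ?_ ?_
    · intro i hi
      rcases List.mem_pair.1 hi with rfl | rfl
      · exact ⟨h.wf.mono one_le, Exp.WF_idx _⟩
      · exact ⟨h'.wf.mono one_le, Exp.WF_idx _⟩
    · intro e he
      refine ⟨fun j hj => ?_, by simp [Template.gate]⟩
      simp only [Template.gate, Gate.preds, Item.nums, List.flatMap_cons, List.flatMap_nil,
        List.append_nil, List.mem_append, List.mem_map, List.mem_range, env_zero he] at hj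
      rcases hj with ⟨y, hy, rfl⟩ | ⟨y, hy, rfl⟩
      · exact lt _ (update_mem_envs he hy)
      · exact lt' _ (update_mem_envs he hy)
    · intro e he x
      simp only [Template.gate, Item.nums, List.flatMap_cons, List.flatMap_nil, List.append_nil,
        Gate.eval, List.length_append, List.length_map, List.length_range, List.countP_append,
        List.countP_map, Form.eval, env_zero he, decide_eq_decide]
      have key : ∀ {r : Exp} {χ : Form} {vs : List Bool}, (∀ e ∈ envs m (n + 1),
          vs.getD ((r.add (Exp.idx (n + 1))).val e) false = χ.eval x (n + 1) e) →
          (List.range m).countP ((fun j => vs.getD j false) ∘ fun y =>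
            (r.add (Exp.idx (n + 1))).val (Function.update e (n + 1) y)) =
          (List.range m).countP fun y => χ.eval x (n + 1) (Function.update e (n + 1) y) :=
        fun hr => List.countP_congr fun y hy =>
          by rw [Function.comp_apply, hr _ (update_mem_envs he (List.mem_range.1 hy))]
      rw [key fun e he => v e he x, key fun e he => v' e he x]
      omega

/-! ### Circuits from formulas -/

/-- Layers for a list of formulas in context `n`. -/
def compileForms (n : ℕ) : List Form → Exp → List Layer × List Exp × Exp
  | [], b => ([], [], b)
  | φ :: l, b =>
    let r := φ.compile n b
    let s := compileForms n l r.next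
    (r.layers ++ s.1, r.root :: s.2.1, s.2.2)

/-- Layers for a list of contexts with lists of formulas. -/
def compileAll : List (ℕ × List Form) → Exp → List Layer × List (ℕ × List Exp) × Exp
  | [], b => ([], [], b)
  | c :: l, b =>
    let r := compileForms c.1 c.2 b
    let s := compileAll l r.2.2
    (r.1 ++ s.1, (c.1, r.2.1) :: s.2.1, s.2.2)

theorem compileForms_spec (hm : m * m ≤ N) {n : ℕ} (l : List Form) : ∀ {b : Exp}
    {G : List Gate} {D : ℕ}, (∀ φ ∈ l, φ.WS n) → Base N m D G b →
    let r := compileForms n l b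
    let G' := G ++ r.1.flatMap (Layer.gates m)
    Base N m (D + r.1.length) G' r.2.2 ∧ (∀ L ∈ r.1, L.WF) ∧ (∀ a ∈ r.2.1, a.WF 1) ∧
    (∀ e ∈ envs m n, ∀ a ∈ r.2.1, (a.add (Exp.idx n)).val e < G'.length) ∧
    ∀ e ∈ envs m n, ∀ x, (r.2.1.map fun a =>
      (gateVals x G').getD ((a.add (Exp.idx n)).val e) false) = l.map fun φ => φ.eval x n e := by
  induction l with
  | nil =>
    intro b G D _ hb
    simpa [compileForms] using hb
  | cons φ l ih =>
    intro b G D hl hb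
    have h := φ.compile_spec hm n (hl φ (by simp)) hb
    obtain ⟨h1, h2, h3, h4, h5⟩ := ih (fun ψ hψ => hl ψ (by simp [hψ])) h.base
    simp only [compileForms, List.flatMap_append, ← List.append_assoc, List.length_append,
      ← add_assoc] at h1 h2 h3 h4 h5 ⊢
    refine ⟨h1, ?_, ?_, ?_, ?_⟩
    · intro L hL
      rcases List.mem_append.1 hL with h' | h'
      · exact h.layers L h'
      · exact h2 L h'
    · intro a ha
      rcases List.mem_cons.1 ha with rfl | h'
      · exact h.wf
      · exact h3 a h'
    · intro e he a ha
      rcases List.mem_cons.1 ha with rfl | h'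
      · have := h.lt e he
        simp only [List.length_append] at this
        omega
      · exact h4 e he a h'
    · intro e he x
      rw [List.map_cons, List.map_cons, h5 e he x, getD_gateVals_append (h.lt e he), h.val e he x]

theorem compileAll_spec (hm : m * m ≤ N) (cs : List (ℕ × List Form)) : ∀ {b : Exp}
    {G : List Gate} {D : ℕ}, (∀ c ∈ cs, ∀ φ ∈ c.2, φ.WS c.1) → Base N m D G b →
    let r := compileAll cs b
    let G' := G ++ r.1.flatMap (Layer.gates m)
    Base N m (D + r.1.length) G' r.2.2 ∧ (∀ L ∈ r.1, L.WF) ∧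
    (∀ c ∈ r.2.1, ∀ a ∈ c.2, a.WF 1) ∧
    (∀ c ∈ r.2.1, ∀ e ∈ envs m c.1, ∀ a ∈ c.2, (a.add (Exp.idx c.1)).val e < G'.length) ∧
    ∀ x, (r.2.1.flatMap fun c => (envs m c.1).flatMap fun e => c.2.map fun a =>
      (gateVals x G').getD ((a.add (Exp.idx c.1)).val e) false) =
        cs.flatMap fun c => (envs m c.1).flatMap fun e => c.2.map fun φ => φ.eval x c.1 e := by
  induction cs with
  | nil =>
    intro b G D _ hb
    simpa [compileAll] using hb
  | cons c cs ih =>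
    intro b G D hl hb
    obtain ⟨g1, g2, g3, g4, g5⟩ := compileForms_spec hm c.2 (hl c (by simp)) hb
    obtain ⟨h1, h2, h3, h4, h5⟩ := ih (fun ψ hψ => hl ψ (by simp [hψ])) g1
    simp only [compileAll, List.flatMap_append, ← List.append_assoc, List.length_append,
      ← add_assoc] at g1 g4 g5 h1 h2 h3 h4 h5 ⊢
    refine ⟨h1, ?_, ?_, ?_, ?_⟩
    · intro L hL
      rcases List.mem_append.1 hL with h' | h'
      · exact g2 L h'
      · exact h2 L h'
    · intro a ha
      rcases List.mem_cons.1 ha with rfl | h'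
      · exact g3
      · exact h3 a h'
    · intro c' hc e he a ha
      rcases List.mem_cons.1 hc with rfl | h'
      · exact lt_of_lt_of_le (g4 e he a ha) (Nat.le_add_right _ _)
      · exact h4 c' h' e he a ha
    · intro x
      rw [List.flatMap_cons, List.flatMap_cons, h5 x]
      congr 1
      refine List.flatMap_congr fun e he => ?_
      rw [← g5 e he x]
      refine List.map_congr_left fun a ha => ?_
      rw [getD_gateVals_append (by simpa using g4 e he a ha)]

end Spec

/-- The two constant gates. -/
def constLayers : List Layer := [⟨0, .or []⟩, ⟨0, .and []⟩]

theorem base_constLayers (N m : ℕ) :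
    Base N m 2 (constLayers.flatMap (Layer.gates m)) (.const 2) := by
  have h : constLayers.flatMap (Layer.gates m) = [.or [], .and []] := rfl
  rw [h]
  refine ⟨⟨?_, by simp, ?_⟩, rfl, trivial, le_rfl, fun x => rfl, fun x => rfl⟩
  · intro i hi j hj
    rcases i with _ | _ | i
    · simp [Gate.preds] at hj
    · simp [Gate.preds] at hj
    · simp at hi
  · intro a ha
    simp [scan, Gate.depth, Gate.preds] at ha
    omega

/-- The layers of the circuit for a list of contexts with lists of formulas. -/
def formLayers (cs : List (ℕ × List Form)) : List Layer :=
  constLayers ++ (compileAll cs (.const 2)).1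

/-- The circuit that evaluates lists of formulas on a domain of size `m`: for each context in turn,
and for each assignment of its variables in lexicographic order, the values of its formulas. -/
def formCircuit (cs : List (ℕ × List Form)) (m : ℕ) : Circuit where
  gates := (formLayers cs).flatMap (Layer.gates m)
  outs := (compileAll cs (.const 2)).2.1.flatMap fun c => (envs m c.1).flatMap fun e =>
    c.2.map fun a => (a.add (Exp.idx c.1)).val e

/-- The program that writes the circuit. -/
def formProg (cs : List (ℕ × List Form)) : Prog DescSym :=
  .seq (Prog.seqs ((formLayers cs).map Layer.prog)) (.seq (.emit .tOuts)
    (Prog.seqs ((compileAll cs (.const 2)).2.1.map fun c =>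
      Prog.nest c.1 (Prog.seqs (c.2.map fun a => Prog.num (a.add (Exp.idx c.1)))))))

/-- The output of the circuit: the truth values of the formulas. -/
def formOutput (cs : List (ℕ × List Form)) (m : ℕ) (x : List Bool) : List Bool :=
  cs.flatMap fun c => (envs m c.1).flatMap fun e => c.2.map fun φ => φ.eval x c.1 e

section

variable {cs : List (ℕ × List Form)} (hcs : ∀ c ∈ cs, ∀ φ ∈ c.2, φ.WS c.1)

include hcs

theorem formLayers_WF : ∀ L ∈ formLayers cs, L.WF := by
  obtain ⟨-, h2, -⟩ := compileAll_spec (N := 0) (m := 0) le_rfl cs hcs (base_constLayers 0 0)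
  intro L hL
  rcases List.mem_append.1 hL with h | h
  · rcases List.mem_pair.1 h with rfl | rfl <;> simp [Layer.WF, Template.WF]
  · exact h2 L h

theorem formRoots_WF : ∀ c ∈ (compileAll cs (.const 2)).2.1, ∀ a ∈ c.2,
    (a.add (Exp.idx c.1)).WF (c.1 + 1) := by
  obtain ⟨-, -, h3, -⟩ := compileAll_spec (N := 0) (m := 0) le_rfl cs hcs (base_constLayers 0 0)
  exact fun c hc a ha => ⟨(h3 c hc a ha).mono (by omega), Exp.WF_idx _⟩

theorem formProg_WF : (formProg cs).WF 1 := by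
  refine ⟨Prog.WF_seqs fun P hP => ?_, trivial, Prog.WF_seqs fun P hP => ?_⟩
  · obtain ⟨L, hL, rfl⟩ := List.mem_map.1 hP
    exact Layer.WF_prog (formLayers_WF hcs L hL)
  · obtain ⟨c, hc, rfl⟩ := List.mem_map.1 hP
    refine Prog.WF_nest (Prog.WF_seqs fun P hP => ?_)
    obtain ⟨a, ha, rfl⟩ := List.mem_map.1 hP
    exact Prog.WF_num (formRoots_WF hcs c hc a ha) le_rfl

theorem sem_formProg (m : ℕ) :
    (formProg cs).sem 1 (fun _ => m) = (formCircuit cs m).desc := by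
  rw [formProg, Prog.sem, Prog.sem, Prog.sem_seqs, Prog.sem_seqs, List.flatMap_map,
    List.flatMap_map, Circuit.desc, formCircuit, List.flatMap_assoc]
  congr 1
  · exact List.flatMap_congr fun L hL => Layer.sem_prog (formLayers_WF hcs L hL) m
  · refine congrArg (List.cons DescSym.tOuts) ?_
    rw [descNums, List.flatMap_assoc]
    refine List.flatMap_congr fun c hc => ?_
    rw [Prog.sem_nest, List.flatMap_assoc]
    refine List.flatMap_congr fun e _ => ?_
    rw [Prog.sem_seqs, List.flatMap_map, List.flatMap_map]
    refine List.flatMap_congr fun a ha => ?_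
    rw [Prog.sem_num (formRoots_WF hcs c hc a ha) le_rfl (fun _ _ => rfl)]
    simp [descNums]

end

theorem length_descNums (js : List ℕ) : js.length ≤ (descNums js).length := by
  induction js with
  | nil => simp
  | cons j js ih =>
    simp only [descNums, List.flatMap_cons, List.length_append, List.length_cons] at ih ⊢
    omega

/-- A circuit is not larger than its description. -/
theorem Circuit.size_le_length_desc (C : Circuit) : C.size ≤ C.desc.length := by
  have h : ∀ G : List Gate, G.length + (G.map fun g => g.preds.length).sum ≤
      (G.flatMap Gate.desc).length := by
    intro G
    induction G with
    | nil => simp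
    | cons g G ih =>
      have hg : 1 + g.preds.length ≤ g.desc.length := by
        cases g with
        | input i => simp [Gate.preds, Gate.desc]
        | not j =>
          have := length_descNums [j]
          simp only [Gate.preds, Gate.desc, List.length_cons] at this ⊢
          omega
        | and js | or js | maj js =>
          have := length_descNums js
          simp only [Gate.preds, Gate.desc, List.length_cons] at this ⊢
          omega
      simp only [List.flatMap_cons, List.length_append, List.length_cons, List.map_cons,
        List.sum_cons] at ih ⊢
      omega
  have h1 := h C.gates
  have h2 := length_descNums C.outs
  simp only [size, desc, List.length_append, List.length_cons]
  omega

/-- A partial function that is given by formulas with majority quantifiers on inputs of square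
length is in TC⁰. -/
theorem inTC0_of_forms {cs : List (ℕ × List Form)} (hcs : ∀ c ∈ cs, ∀ φ ∈ c.2, φ.WS c.1)
    {F : Set (List Bool × List Bool)}
    (hF : ∀ x y, (x, y) ∈ F → ∃ m, x.length = m * m ∧ y = formOutput cs m x) : InTC0 F := by
  have hspec := fun N => compileAll_spec (N := N) (m := N.sqrt) (Nat.sqrt_le N) cs hcs
    (base_constLayers N N.sqrt)
  have hg : ∀ m, (formCircuit cs m).gates = constLayers.flatMap (Layer.gates m) ++
      (compileAll cs (.const 2)).1.flatMap (Layer.gates m) := fun m => by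
    simp [formCircuit, formLayers]
  refine ⟨fun N => formCircuit cs N.sqrt, fun N => ?_, ⟨(formProg cs).lenPoly, fun N => ?_⟩,
    ⟨2 + (compileAll cs (.const 2)).1.length, fun N => ?_⟩, ?_, ?_⟩
  · obtain ⟨h1, -, -, h4, -⟩ := hspec N
    rw [← hg] at h1 h4
    refine ⟨h1.good.preds, h1.good.inputs, fun j hj => ?_⟩
    simp only [formCircuit, List.mem_flatMap, List.mem_map] at hj
    obtain ⟨c, hc, e, he, a, ha, rfl⟩ := hj
    exact h4 c hc e he a ha
  · refine (Circuit.size_le_length_desc _).trans ?_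
    rw [← sem_formProg hcs]
    exact Prog.length_sem_le _ _ _ fun _ => Nat.sqrt_le_self N
  · obtain ⟨h1, -⟩ := hspec N
    rw [← hg] at h1
    exact foldr_max_le h1.good.depth
  · have := (formProg cs).logspaceComputable (I := Unit) (formProg_WF hcs)
    simpa only [LogspaceUniform, sem_formProg hcs] using this
  · intro x y hxy
    obtain ⟨m, hx, rfl⟩ := hF x y hxy
    have hm : x.length.sqrt = m := by rw [hx, Nat.sqrt_eq]
    obtain ⟨-, -, -, -, h5⟩ := hspec x.length
    have h5 := h5 x
    rw [← hg, hm] at h5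
    simp only [formOutput]
    rw [← h5, hm, Circuit.eval, formCircuit, List.map_flatMap]
    refine List.flatMap_congr fun c _ => ?_
    rw [List.map_flatMap]
    refine List.flatMap_congr fun e _ => ?_
    rw [List.map_map]
    rfl

section Strings

/-! ### Bracket structure of string representations -/

/-- Ranks of opening brackets. -/
def isOp (s : ℕ) : Bool := decide (s = 0 ∨ s = 3)

/-- Ranks of closing brackets. -/
def isCl (s : ℕ) : Bool := decide (s = 1 ∨ s = 4)

/-- The brackets in a string are balanced. -/
def Dyck (u : List ℕ) : Prop :=
  (∀ i, (u.take i).countP isCl ≤ (u.take i).countP isOp) ∧ u.countP isOp = u.countP isCl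

/-- The string is balanced but none of its proper nonempty prefixes is, and it neither begins with
a closing bracket nor ends with a comma: the property of representations of values that the
recognition of components relies on. -/
structure Tok (s : List ℕ) : Prop where
  bal : s.countP isOp = s.countP isCl
  strict : ∀ i, 0 < i → i < s.length → (s.take i).countP isCl < (s.take i).countP isOp
  head : ∃ c, s[0]? = some c ∧ isCl c = false
  last : s[s.length - 1]? ≠ some 2

/-- In a text `s` that follows an opening bracket, a component of the value opened by this bracket
starts at offset `j`. -/
def Ch (s : List ℕ) (j : ℕ) : Prop :=
  (∀ i ≤ j, (s.take i).countP isCl ≤ (s.take i).countP isOp) ∧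
  (s.take j).countP isOp = (s.take j).countP isCl ∧
  (j = 0 ∨ s[j - 1]? = some 2) ∧ ∃ c, s[j]? = some c ∧ isCl c = false

theorem Dyck.append {u v : List ℕ} (hu : Dyck u) (hv : Dyck v) : Dyck (u ++ v) := by
  refine ⟨fun i => ?_, by rw [List.countP_append, List.countP_append, hu.2, hv.2]⟩
  rw [List.take_append, List.countP_append, List.countP_append]
  exact add_le_add (hu.1 i) (hv.1 _)

theorem dyck_nil : Dyck [] := ⟨by simp, rfl⟩

theorem dyck_comma : Dyck [2] := by
  refine ⟨fun i => ?_, rfl⟩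
  cases i <;> simp [isCl]

theorem Tok.length_pos {s : List ℕ} (h : Tok s) : 0 < s.length := by
  obtain ⟨c, hc, -⟩ := h.head
  exact (List.getElem?_eq_some_iff.1 hc).1

theorem Tok.dyck {s : List ℕ} (h : Tok s) : Dyck s := by
  refine ⟨fun i => ?_, h.bal⟩
  rcases Nat.eq_zero_or_pos i with rfl | hi
  · simp
  · by_cases h' : i < s.length
    · exact (h.strict i hi h').le
    · rw [List.take_of_length_le (by omega), h.bal]

theorem Dyck.tok {u : List ℕ} (h : Dyck u) {o c : ℕ} (ho : isOp o = true) (hc : isCl c = true) :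
    Tok (o :: (u ++ [c])) := by
  have ho' : isCl o = false := by
    simp only [isOp, isCl, decide_eq_true_eq, decide_eq_false_iff_not] at ho ⊢
    omega
  have hc' : isOp c = false := by
    simp only [isOp, isCl, decide_eq_true_eq, decide_eq_false_iff_not] at hc ⊢
    omega
  refine ⟨?_, fun i h0 hi => ?_, ⟨o, rfl, ho'⟩, ?_⟩
  · simp [ho, hc, ho', hc', h.2]
  · obtain ⟨i, rfl⟩ := Nat.exists_eq_add_of_lt h0
    simp only [List.length_cons, List.length_append, List.length_nil] at hi
    have := h.1 i
    rw [Nat.zero_add, List.take_succ_cons, List.take_append_of_le_length (by omega)]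
    simp only [List.countP_cons, ho, ho']
    simp only [Bool.false_eq_true, if_false, if_true]
    omega
  · intro hl
    simp at hl
    subst hl
    simp [isCl] at hc

section Ch

variable {s t : List ℕ}

theorem Tok.ch_zero (h : Tok s) (t : List ℕ) : Ch (s ++ t) 0 := by
  obtain ⟨c, hc, hc'⟩ := h.head
  refine ⟨fun i hi => ?_, by simp, Or.inl rfl, c, ?_, hc'⟩
  · obtain rfl : i = 0 := by omega
    simp
  · rw [List.getElem?_append_left h.length_pos, hc]

theorem Tok.not_ch (h : Tok s) {j : ℕ} (h0 : 0 < j) (hj : j ≤ s.length) : ¬ Ch (s ++ t) j := by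
  rintro ⟨-, h1, h2, -⟩
  rcases hj.lt_or_eq with hlt | rfl
  · rw [List.take_append_of_le_length hj] at h1
    exact (h.strict j h0 hlt).ne' h1
  · rcases h2 with h2 | h2
    · omega
    · rw [List.getElem?_append_left (by omega)] at h2
      exact h.last h2

theorem take_append_cons (s t : List ℕ) (c i : ℕ) :
    (s ++ c :: t).take (s.length + 1 + i) = s ++ c :: t.take i := by
  rw [List.take_append, List.take_of_length_le (by omega),
    show s.length + 1 + i - s.length = i + 1 by omega, List.take_succ_cons]

/-- After a first component and a comma, further components start where they start in the rest. -/
theorem Tok.ch_comma (h : Tok s) {j : ℕ} :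
    Ch (s ++ 2 :: t) j ↔ j = 0 ∨ ∃ i, j = s.length + 1 + i ∧ Ch t i := by
  have hget : ∀ i, (s ++ 2 :: t)[s.length + 1 + i]? = t[i]? := fun i => by
    rw [List.getElem?_append_right (by omega),
      show s.length + 1 + i - s.length = i + 1 by omega, List.getElem?_cons_succ]
  have hcl : ∀ i, ((s ++ 2 :: t).take (s.length + 1 + i)).countP isCl =
      s.countP isOp + (t.take i).countP isCl := fun i => by
    rw [take_append_cons, List.countP_append, List.countP_cons, h.bal]
    rfl
  have hop : ∀ i, ((s ++ 2 :: t).take (s.length + 1 + i)).countP isOp =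
      s.countP isOp + (t.take i).countP isOp := fun i => by
    rw [take_append_cons, List.countP_append, List.countP_cons]
    rfl
  constructor
  · intro hj
    rcases Nat.eq_zero_or_pos j with h0 | h0
    · exact Or.inl h0
    · right
      have hlt : s.length < j := by
        by_contra hle
        exact h.not_ch h0 (by omega) hj
      obtain ⟨i, rfl⟩ : ∃ i, j = s.length + 1 + i := ⟨j - (s.length + 1), by omega⟩
      refine ⟨i, rfl, ?_⟩
      obtain ⟨h1, h2, h3, h4⟩ := hj
      refine ⟨fun k hk => ?_, ?_, ?_, ?_⟩
      · have := h1 (s.length + 1 + k) (by omega)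
        rw [hcl, hop] at this
        omega
      · rw [hcl, hop] at h2
        omega
      · rcases Nat.eq_zero_or_pos i with rfl | hi
        · exact Or.inl rfl
        · right
          rcases h3 with h3 | h3
          · omega
          · rwa [show s.length + 1 + i - 1 = s.length + 1 + (i - 1) by omega, hget] at h3
      · rwa [hget] at h4
  · rintro (rfl | ⟨i, rfl, h1, h2, h3, h4⟩)
    · exact h.ch_zero _
    · refine ⟨fun k hk => ?_, ?_, ?_, ?_⟩
      · by_cases hk' : k ≤ s.length
        · rw [List.take_append_of_le_length hk']
          exact h.dyck.1 k
        · obtain ⟨l, rfl⟩ : ∃ l, k = s.length + 1 + l := ⟨k - (s.length + 1), by omega⟩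
          rw [hcl, hop]
          have := h1 l (by omega)
          omega
      · rw [hcl, hop]
        omega
      · right
        rcases Nat.eq_zero_or_pos i with rfl | hi
        · simp
        · rcases h3 with h3 | h3
          · omega
          · rwa [show s.length + 1 + i - 1 = s.length + 1 + (i - 1) by omega, hget]
      · rwa [hget]

/-- After a first component and a closing bracket, there are no further components. -/
theorem Tok.ch_close (h : Tok s) {c : ℕ} (hc : isCl c = true) {j : ℕ} :
    Ch (s ++ c :: t) j ↔ j = 0 := by
  constructor
  · intro hj
    by_contra h0
    have hlt : s.length < j := by
      by_contra hle
      exact h.not_ch (by omega) (by omega) hj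
    have h1 := hj.1 (s.length + 1 + 0) (by omega)
    have hc' : isOp c = false := by
      simp only [isOp, isCl, decide_eq_true_eq, decide_eq_false_iff_not] at hc ⊢
      omega
    rw [take_append_cons, List.countP_append, List.countP_append, h.bal] at h1
    simp [hc, hc'] at h1
  · rintro rfl
    exact h.ch_zero _

theorem not_ch_close {c : ℕ} (hc : isCl c = true) {j : ℕ} : ¬ Ch (c :: t) j := by
  rintro ⟨h1, -, -, d, h3, h4⟩
  have hc' : isOp c = false := by
    simp only [isOp, isCl, decide_eq_true_eq, decide_eq_false_iff_not] at hc ⊢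
    omega
  rcases Nat.eq_zero_or_pos j with rfl | hj
  · simp only [List.getElem?_cons_zero, Option.some.injEq] at h3
    subst h3
    simp [hc] at h4
  · have := h1 1 hj
    simp [hc, hc'] at this

end Ch

/-! ### Occurrences of values in a string -/

/-- The string representation of a value in terms of ranks, for strings of length `n`. -/
def rstr {σ : ℕ} (n : ℕ) (A : Ty) (a : Val σ A) : List ℕ := (str A a).map (Sym.rank n)

/-- The representation of a list of values, separated by commas. -/
def rlist {σ : ℕ} (n : ℕ) (C : Ty) (l : List (Val σ C)) : List ℕ :=
  (List.intercalate [.comma] (l.map (str C))).map (Sym.rank n)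

variable {σ n : ℕ}

theorem length_rstr (A : Ty) (a : Val σ A) : (rstr n A a).length = (str A a).length :=
  List.length_map _

theorem rstr_prod (A B : Ty) (a : Val σ A) (b : Val σ B) :
    rstr n (.prod A B) (a, b) = 0 :: (rstr n A a ++ 2 :: (rstr n B b ++ [1])) := by
  simp [rstr, str, Sym.rank]

theorem rstr_bag (C : Ty) (l : List (Val σ C)) :
    rstr n (.bag C) l = 3 :: (rlist n C l ++ [4]) := by
  simp [rstr, rlist, str, Sym.rank]

theorem rlist_nil (C : Ty) : rlist n C ([] : List (Val σ C)) = [] := rfl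

theorem rlist_singleton (C : Ty) (c : Val σ C) : rlist n C [c] = rstr n C c := by
  simp [rlist, rstr, List.intercalate]

theorem rlist_cons_cons (C : Ty) (c d : Val σ C) (l : List (Val σ C)) :
    rlist n C (c :: d :: l) = rstr n C c ++ 2 :: rlist n C (d :: l) := by
  simp [rlist, rstr, List.intercalate, Sym.rank]

theorem length_bag (C : Ty) (l : List (Val σ C)) :
    (str (.bag C) l).length = (rlist n C l).length + 2 := by
  have h := rstr_bag (n := n) C l
  refine (length_rstr (n := n) (.bag C) l).symm.trans ?_
  rw [h]
  simp

theorem length_prod (A B : Ty) (a : Val σ A) (b : Val σ B) :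
    (str (.prod A B) (a, b)).length = (str A a).length + (str B b).length + 3 := by
  have h := rstr_prod (n := 0) A B a b
  refine (length_rstr (n := 0) (.prod A B) (a, b)).symm.trans ?_
  rw [h]
  simp [length_rstr]
  omega

/-- Representations of values have the bracket structure that the recognition of components relies
on. -/
theorem tok_rstr : ∀ (A : Ty) (a : Val σ A), Tok (rstr n A a)
  | .unit, _ => dyck_nil.tok (o := 0) (c := 1) rfl rfl
  | .base, a => by
    have h : rstr n .base a = [5 + n + Fin.val (n := σ) a] := rfl
    have h1 : isOp (5 + n + Fin.val (n := σ) a) = false := by simp [isOp]; omega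
    have h2 : isCl (5 + n + Fin.val (n := σ) a) = false := by simp [isCl]; omega
    rw [h]
    refine ⟨by simp [h1, h2], fun i h0 hi => ?_, ⟨_, rfl, h2⟩, ?_⟩
    · simp at hi
      omega
    · simp
      omega
  | .prod A B, (a, b) => by
    rw [rstr_prod]
    have := ((tok_rstr A a).dyck.append (dyck_comma.append (tok_rstr B b).dyck)).tok
      (o := 0) (c := 1) rfl rfl
    simpa using this
  | .bag C, l => by
    have h := rstr_bag (n := n) C l
    rw [h]
    clear h
    refine Dyck.tok ?_ rfl rfl
    induction l with
    | nil => exact dyck_nil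
    | cons c l ih =>
      cases l with
      | nil =>
        rw [rlist_singleton]
        exact (tok_rstr C c).dyck
      | cons d l =>
        rw [rlist_cons_cons]
        exact (tok_rstr C c).dyck.append (dyck_comma.append ih)

/-- The value `a` occurs in the text `R` at position `p`. -/
def Occ (n : ℕ) (R : List ℕ) (A : Ty) (a : Val σ A) (p : ℕ) : Prop :=
  ∃ Y, R.drop p = rstr n A a ++ Y

variable {R : List ℕ}

/-- The text behind an initial part of the text at position `p`. -/
theorem drop_of_drop {p k : ℕ} {s Y : List ℕ} (h : R.drop p = s ++ Y) (hk : k = p + s.length) :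
    R.drop k = Y := by
  subst hk
  rw [← List.drop_drop, h, List.drop_left]

theorem Occ.fst {A B : Ty} {a : Val σ A} {b : Val σ B} {p : ℕ}
    (h : Occ n R (.prod A B) (a, b) p) : Occ n R A a (p + 1) := by
  obtain ⟨Y, hY⟩ := h
  rw [rstr_prod] at hY
  exact ⟨2 :: (rstr n B b ++ [1]) ++ Y, drop_of_drop (s := [0]) (by simpa using hY) rfl⟩

theorem Occ.snd {A B : Ty} {a : Val σ A} {b : Val σ B} {p : ℕ}
    (h : Occ n R (.prod A B) (a, b) p) : Occ n R B b (p + 1 + (str A a).length + 1) := by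
  obtain ⟨Y, hY⟩ := h
  rw [rstr_prod] at hY
  exact ⟨[1] ++ Y, drop_of_drop (s := 0 :: (rstr n A a ++ [2])) (by simpa using hY)
    (by simp [length_rstr]; omega)⟩

theorem occ_elems {C : Ty} (l : List (Val σ C)) : ∀ {p : ℕ} {Y : List ℕ},
    R.drop p = rlist n C l ++ Y → ∀ e ∈ elems C p l, Occ n R C e.1 e.2 := by
  induction l with
  | nil => simp [elems]
  | cons c l ih =>
    intro p Y hY e he
    rw [elems, List.mem_cons] at he
    cases l with
    | nil =>
      rw [rlist_singleton] at hY
      rcases he with rfl | he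
      · exact ⟨Y, hY⟩
      · simp [elems] at he
    | cons d l =>
      rw [rlist_cons_cons, List.append_assoc] at hY
      rcases he with rfl | he
      · exact ⟨_, hY⟩
      · refine ih (Y := Y) (drop_of_drop (p := p) (s := rstr n C c ++ [2]) ?_ ?_) e he
        · simpa using hY
        · simp [length_rstr, add_assoc]

theorem Occ.elem {C : Ty} {l : List (Val σ C)} {p : ℕ} (h : Occ n R (.bag C) l p)
    {e : Val σ C × ℕ} (he : e ∈ elems C (p + 1) l) : Occ n R C e.1 e.2 := by
  obtain ⟨Y, hY⟩ := h
  rw [rstr_bag] at hY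
  exact occ_elems l (Y := 4 :: Y) (drop_of_drop (s := [3]) (by simpa using hY) rfl) e he

/-- In the text `R`, a component of the value at position `p` starts at position `q`. -/
def Child (R : List ℕ) (p q : ℕ) : Prop := p < q ∧ Ch (R.drop (p + 1)) (q - (p + 1))

theorem Occ.child_prod {A B : Ty} {a : Val σ A} {b : Val σ B} {p q : ℕ}
    (h : Occ n R (.prod A B) (a, b) p) :
    Child R p q ↔ q = p + 1 ∨ q = p + 1 + (str A a).length + 1 := by
  obtain ⟨Y, hY⟩ := h
  rw [rstr_prod] at hY
  have h1 : R.drop (p + 1) = rstr n A a ++ 2 :: (rstr n B b ++ 1 :: Y) :=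
    drop_of_drop (s := [0]) (by simpa using hY) rfl
  rw [Child, h1, (tok_rstr A a).ch_comma, length_rstr]
  simp only [(tok_rstr B b).ch_close (c := 1) rfl]
  constructor
  · rintro ⟨h2, h3 | ⟨i, h3, rfl⟩⟩ <;> omega
  · rintro (rfl | rfl)
    · exact ⟨by omega, Or.inl (by omega)⟩
    · exact ⟨by omega, Or.inr ⟨0, by omega, rfl⟩⟩

theorem le_of_mem_elems {C : Ty} {l : List (Val σ C)} {p : ℕ} :
    ∀ e ∈ elems C p l, p ≤ e.2 := by
  induction l generalizing p with
  | nil => simp [elems]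
  | cons c l ih =>
    intro e he
    rw [elems, List.mem_cons] at he
    rcases he with rfl | he
    · exact le_rfl
    · have := ih e he
      omega

theorem ch_rlist {C : Ty} (l : List (Val σ C)) : ∀ {p j : ℕ} {Y : List ℕ},
    Ch (rlist n C l ++ 4 :: Y) j ↔ ∃ e ∈ elems C p l, e.2 = p + j := by
  induction l with
  | nil =>
    intro p j Y
    simpa [elems, rlist_nil] using not_ch_close (c := 4) rfl
  | cons c l ih =>
    intro p j Y
    cases l with
    | nil =>
      rw [rlist_singleton, (tok_rstr C c).ch_close rfl]
      simp [elems]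
    | cons d l =>
      rw [rlist_cons_cons, List.append_assoc, List.cons_append, (tok_rstr C c).ch_comma, elems]
      simp only [ih (p := p + (str C c).length + 1), List.exists_mem_cons_iff, length_rstr]
      refine or_congr (by omega) ⟨?_, ?_⟩
      · rintro ⟨i, rfl, e, he, hi⟩
        exact ⟨e, he, by omega⟩
      · rintro ⟨e, he, hj⟩
        have := le_of_mem_elems e he
        exact ⟨j - ((str C c).length + 1), by omega, e, he, by omega⟩

theorem Occ.child_bag {C : Ty} {l : List (Val σ C)} {p q : ℕ} (h : Occ n R (.bag C) l p) :
    Child R p q ↔ ∃ e ∈ elems C (p + 1) l, e.2 = q := by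
  obtain ⟨Y, hY⟩ := h
  rw [rstr_bag] at hY
  have h1 : R.drop (p + 1) = rlist n C l ++ 4 :: Y :=
    drop_of_drop (s := [3]) (by simpa using hY) rfl
  rw [Child, h1, ch_rlist l (p := p + 1)]
  constructor
  · rintro ⟨h2, e, he, h3⟩
    exact ⟨e, he, by omega⟩
  · rintro ⟨e, he, rfl⟩
    have := le_of_mem_elems e he
    exact ⟨by omega, e, he, by omega⟩

end Strings

section Formulas

/-! ### The entries of a dictionary -/

variable {σ n : ℕ} {R : List ℕ}

/-- The entries of the dictionary `dict C A a p`, each consisting of the label, the position of the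
element that it describes, and the flat version of this element. -/
def items (C : Ty) : (A : Ty) → Val σ A → ℕ → List (ℕ × ℕ × List (Sym σ))
  | .unit, _, _ => []
  | .base, _, _ => []
  | .prod A B, (a, b), p =>
      items C A a (p + 1) ++ items C B b (p + 1 + (str A a).length + 1)
  | .bag A, l, p =>
      (if A = C then (elems A (p + 1) l).map fun e => (p, e.2, flat A e.1 e.2) else []) ++
        (elems A (p + 1) l).flatMap fun e => items C A e.1 e.2

theorem map_items (C : Ty) : ∀ (A : Ty) (a : Val σ A) (p : ℕ),
    ((items C A a p).map fun t => Sym.pos t.1 :: t.2.2) = dict C A a p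
  | .unit, _, _ => rfl
  | .base, _, _ => rfl
  | .prod A B, (a, b), p => by
    rw [items, dict, List.map_append, map_items C A, map_items C B]
  | .bag A, l, p => by
    rw [items, dict, List.map_append, List.map_flatMap]
    congr 1
    · split_ifs <;> simp [flatElems]
    · exact List.flatMap_congr fun e _ => map_items C A _ _

/-- Bags of type `Bag(C)` do not occur in values whose type is not larger than `C`. -/
theorem items_eq_nil (C : Ty) : ∀ (A : Ty) (a : Val σ A) (p : ℕ), sizeOf A ≤ sizeOf C →
    items C A a p = []
  | .unit, _, _, _ => rfl
  | .base, _, _, _ => rfl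
  | .prod A B, (a, b), p, h => by
    simp only [Ty.prod.sizeOf_spec] at h
    rw [items, items_eq_nil C A _ _ (by omega), items_eq_nil C B _ _ (by omega)]
    rfl
  | .bag A, l, p, h => by
    simp only [Ty.bag.sizeOf_spec] at h
    have hne : A ≠ C := by
      rintro rfl
      omega
    rw [items, if_neg hne, List.nil_append, List.flatMap_eq_nil_iff]
    exact fun e _ => items_eq_nil C A _ _ (by omega)

theorem str_length_pos (A : Ty) (a : Val σ A) : 0 < (str A a).length := by
  rw [← length_rstr (n := 0)]
  exact (tok_rstr A a).length_pos

theorem add_length_le_of_mem_elems {C : Ty} {l : List (Val σ C)} {p : ℕ} :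
    ∀ e ∈ elems C p l, e.2 + (str C e.1).length ≤ p + (rlist n C l).length := by
  induction l generalizing p with
  | nil => simp [elems]
  | cons c l ih =>
    intro e he
    rw [elems, List.mem_cons] at he
    cases l with
    | nil =>
      rw [rlist_singleton, length_rstr]
      rcases he with rfl | he
      · exact le_rfl
      · simp [elems] at he
    | cons d l =>
      rw [rlist_cons_cons, List.length_append, List.length_cons, length_rstr]
      rcases he with rfl | he
      · dsimp only
        omega
      · have := ih e he
        omega

theorem pairwise_elems {C : Ty} {l : List (Val σ C)} {p : ℕ} :
    (elems C p l).Pairwise fun e f => e.2 + (str C e.1).length < f.2 := by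
  induction l generalizing p with
  | nil => simp [elems]
  | cons c l ih =>
    rw [elems, List.pairwise_cons]
    refine ⟨fun f hf => ?_, ih⟩
    have := le_of_mem_elems f hf
    dsimp only
    omega

theorem items_bound (C : Ty) : ∀ (A : Ty) (a : Val σ A) (p : ℕ), ∀ t ∈ items C A a p,
    p < t.2.1 ∧ t.2.1 < p + (str A a).length
  | .unit, _, _ => by simp [items]
  | .base, _, _ => by simp [items]
  | .prod A B, (a, b), p => by
    intro t ht
    rw [items, List.mem_append] at ht
    have hl := length_prod A B a b
    rcases ht with ht | ht
    · have := items_bound C A a _ t ht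
      omega
    · have := items_bound C B b _ t ht
      omega
  | .bag A, l, p => by
    intro t ht
    rw [items, List.mem_append] at ht
    have hl := length_bag (n := 0) A l
    rcases ht with ht | ht
    · split_ifs at ht
      · obtain ⟨e, he, rfl⟩ := List.mem_map.1 ht
        have h1 := le_of_mem_elems e he
        have h2 := add_length_le_of_mem_elems (n := 0) e he
        dsimp only
        omega
      · simp at ht
    · obtain ⟨e, he, ht⟩ := List.mem_flatMap.1 ht
      have h1 := le_of_mem_elems e he
      have h2 := add_length_le_of_mem_elems (n := 0) e he
      have h3 := items_bound C A e.1 _ t ht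
      omega

/-- Different entries of a dictionary describe elements at different positions. -/
theorem nodup_items (C : Ty) : ∀ (A : Ty) (a : Val σ A) (p : ℕ),
    ((items C A a p).map fun t => t.2.1).Nodup
  | .unit, _, _ => by simp [items]
  | .base, _, _ => by simp [items]
  | .prod A B, (a, b), p => by
    rw [items, List.map_append]
    refine List.Nodup.append (nodup_items C A _ _) (nodup_items C B _ _) ?_
    intro q hq hq'
    obtain ⟨t, ht, rfl⟩ := List.mem_map.1 hq
    obtain ⟨t', ht', h⟩ := List.mem_map.1 hq'
    have h1 := items_bound C A _ _ t ht
    have h2 := items_bound C B _ _ t' ht'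
    omega
  | .bag A, l, p => by
    rw [items]
    by_cases hA : A = C
    · subst hA
      rw [if_pos rfl, List.flatMap_eq_nil_iff.2 fun e _ => items_eq_nil A A _ _ le_rfl,
        List.append_nil, List.map_map]
      exact List.pairwise_map.2 (pairwise_elems.imp fun h => by
        dsimp only [Function.comp_apply]
        omega)
    · rw [if_neg hA, List.nil_append, List.map_flatMap, List.nodup_flatMap]
      refine ⟨fun e _ => nodup_items C A _ _, pairwise_elems.imp fun {e f} h => ?_⟩
      intro q hq hq'
      obtain ⟨t, ht, rfl⟩ := List.mem_map.1 hq
      obtain ⟨t', ht', h'⟩ := List.mem_map.1 hq'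
      have h1 := items_bound C A _ _ t ht
      have h2 := items_bound C A _ _ t' ht'
      omega

/-- An entry of a dictionary is the flat version of a value that occurs at the position. -/
theorem occ_items (C : Ty) : ∀ (A : Ty) (a : Val σ A) (p : ℕ), Occ n R A a p →
    ∀ t ∈ items C A a p, ∃ c : Val σ C, Occ n R C c t.2.1 ∧ flat C c t.2.1 = t.2.2
  | .unit, _, _ => by simp [items]
  | .base, _, _ => by simp [items]
  | .prod A B, (a, b), p => by
    intro h t ht
    rw [items, List.mem_append] at ht
    rcases ht with ht | ht
    · exact occ_items C A a _ h.fst t ht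
    · exact occ_items C B b _ h.snd t ht
  | .bag A, l, p => by
    intro h t ht
    rw [items, List.mem_append] at ht
    rcases ht with ht | ht
    · split_ifs at ht with hA
      · subst hA
        obtain ⟨e, he, rfl⟩ := List.mem_map.1 ht
        exact ⟨e.1, h.elem he, rfl⟩
      · simp at ht
    · obtain ⟨e, he, ht⟩ := List.mem_flatMap.1 ht
      exact occ_items C A e.1 _ (h.elem he) t ht

theorem Occ.lt_length {A : Ty} {a : Val σ A} {p : ℕ} (h : Occ n R A a p) : p < R.length := by
  obtain ⟨Y, hY⟩ := h
  have h1 := congrArg List.length hY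
  have h2 := str_length_pos A a
  rw [List.length_drop, List.length_append, length_rstr] at h1
  omega

theorem length_flat : ∀ (A : Ty) (a : Val σ A) (p : ℕ), (flat A a p).length = width A
  | .unit, _, _ => rfl
  | .base, _, _ => rfl
  | .prod A B, (a, b), p => by
    rw [flat, List.length_append, length_flat A, length_flat B, width]
  | .bag _, _, _ => rfl

/-! ### Formulas for the bracket structure -/

namespace Form

variable {x : List Bool} {c : ℕ} {e : ℕ → ℕ}

/-- The formula is true. -/
def Holds (x : List Bool) (φ : Form) (c : ℕ) (e : ℕ → ℕ) : Prop := φ.eval x c e = true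

/-- The number of values of the next variable for which the formula is true. -/
def count (x : List Bool) (φ : Form) (c : ℕ) (e : ℕ → ℕ) : ℕ :=
  (List.range (e 0)).countP fun y => φ.eval x (c + 1) (Function.update e (c + 1) y)

/-- Truth. -/
def tt : Form := lt (.const 0) (.const 1)

/-- Falsity. -/
def ff : Form := lt (.const 0) (.const 0)

/-- Disjunction. -/
def or (φ ψ : Form) : Form := not (and (not φ) (not ψ))

/-- Equality of the values of two expressions. -/
def eq (a b : Exp) : Form := and (not (lt a b)) (not (lt b a))

/-- Some value of the next variable satisfies `φ`: together with all `m` values, which satisfy `tt`,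
these are more than `m`. -/
def ex (φ : Form) : Form := maj φ tt

/-- More values of the next variable satisfy `φ` than satisfy `ψ`. -/
def gt (φ ψ : Form) : Form := maj φ (not ψ)

/-- As many values of the next variable satisfy `φ` as satisfy `ψ`. -/
def eqc (φ ψ : Form) : Form := and (not (gt φ ψ)) (not (gt ψ φ))

@[simp] theorem holds_tt : tt.Holds x c e := by simp [Holds, tt, eval, Exp.val]
@[simp] theorem holds_ff : ¬ ff.Holds x c e := by simp [Holds, ff, eval, Exp.val]
@[simp] theorem holds_lt {a b : Exp} : (lt a b).Holds x c e ↔ a.val e < b.val e := by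
  simp [Holds, eval]
@[simp] theorem holds_not {φ : Form} : (not φ).Holds x c e ↔ ¬ φ.Holds x c e := by
  simp [Holds, eval]
@[simp] theorem holds_and {φ ψ : Form} :
    (and φ ψ).Holds x c e ↔ φ.Holds x c e ∧ ψ.Holds x c e := by
  simp [Holds, eval]
@[simp] theorem holds_or {φ ψ : Form} :
    (or φ ψ).Holds x c e ↔ φ.Holds x c e ∨ ψ.Holds x c e := by
  rw [or, holds_not, holds_and, holds_not, holds_not]
  tauto
@[simp] theorem holds_eq {a b : Exp} : (eq a b).Holds x c e ↔ a.val e = b.val e := by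
  rw [eq, holds_and, holds_not, holds_not, holds_lt, holds_lt]
  omega

@[simp] theorem holds_ex {φ : Form} : (ex φ).Holds x c e ↔
    ∃ y < e 0, φ.Holds x (c + 1) (Function.update e (c + 1) y) := by
  have h : ∀ e, tt.eval x (c + 1) e = true := fun e => holds_tt
  simp only [Holds, ex, eval, h, List.countP_true, List.length_range, decide_eq_true_eq]
  rw [show ∀ a b : ℕ, b < a + b ↔ 0 < a from fun a b => by omega, List.countP_pos_iff]
  simp

@[simp] theorem holds_gt {φ ψ : Form} : (gt φ ψ).Holds x c e ↔ ψ.count x c e < φ.count x c e := by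
  have := List.length_eq_countP_add_countP
    (fun y => ψ.eval x (c + 1) (Function.update e (c + 1) y)) (l := List.range (e 0))
  simp only [Bool.not_eq_true, Bool.decide_eq_false, List.length_range] at this
  rw [Holds, gt, eval, decide_eq_true_eq, count, count]
  simp only [eval]
  omega

@[simp] theorem holds_eqc {φ ψ : Form} :
    (eqc φ ψ).Holds x c e ↔ φ.count x c e = ψ.count x c e := by
  rw [eqc, holds_and, holds_not, holds_not, holds_gt, holds_gt]
  omega

theorem ws_ex {φ : Form} : (ex φ).WS c ↔ φ.WS (c + 1) := by
  simp [ex, WS, tt, Exp.WF]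
theorem ws_gt {φ ψ : Form} : (gt φ ψ).WS c ↔ φ.WS (c + 1) ∧ ψ.WS (c + 1) := Iff.rfl
theorem ws_eqc {φ ψ : Form} : (eqc φ ψ).WS c ↔ φ.WS (c + 1) ∧ ψ.WS (c + 1) := by
  simp only [eqc, gt, WS]
  tauto
theorem ws_eq {a b : Exp} : (eq a b).WS c ↔ a.WF (c + 1) ∧ b.WF (c + 1) := by
  simp only [eq, WS]
  tauto
theorem ws_ff : ff.WS c := by simp [ff, WS, Exp.WF]
theorem ws_tt : tt.WS c := by simp [tt, WS, Exp.WF]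

end Form

open Form

/-- The string `x` of bits represents the text `R` as a relation between positions, counted from
`5`, and symbols. -/
structure Inp (x : List Bool) (m : ℕ) (R : List ℕ) : Prop where
  iff : ∀ a < m, ∀ s < m, x.getD (a * m + s) false = true ↔ 5 ≤ a ∧ R[a - 5]? = some s
  five : 5 ≤ m
  len : 5 + R.length ≤ m
  lt : ∀ s ∈ R, s < m

variable {x : List Bool} {m c : ℕ} {e : ℕ → ℕ}

theorem holds_inp (hx : Inp x m R) (he : e ∈ envs m c) {i j : ℕ} (hi : 1 ≤ i ∧ i ≤ c)
    (hj : 1 ≤ j ∧ j ≤ c) :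
    (inp i j).Holds x c e ↔ 5 ≤ e i ∧ R[e i - 5]? = some (e j) := by
  rw [← hx.iff _ (env_lt he hi.1 hi.2) _ (env_lt he hj.1 hj.2), Holds, eval, env_zero he]

/-- The symbol at position `q` is `s`. -/
def symF (c q s : ℕ) : Form := ex (.and (eq (.var (c + 1)) (.const s)) (inp q (c + 1)))

theorem holds_symF (hx : Inp x m R) (he : e ∈ envs m c) {q s : ℕ} (hq : 1 ≤ q ∧ q ≤ c)
    (hs : s < 5) : (symF c q s).Holds x c e ↔ 5 ≤ e q ∧ R[e q - 5]? = some s := by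
  have hm := hx.five
  have hne : q ≠ c + 1 := by omega
  rw [symF, holds_ex, env_zero he]
  constructor
  · rintro ⟨y, hy, h⟩
    rw [holds_and, holds_eq, holds_inp hx (update_mem_envs he hy) (by omega) (by omega)] at h
    simp only [Exp.val, Function.update_self, Function.update_of_ne hne] at h
    obtain ⟨rfl, h⟩ := h
    exact h
  · intro h
    have hy : s < m := by omega
    refine ⟨s, hy, ?_⟩
    rw [holds_and, holds_eq, holds_inp hx (update_mem_envs he hy) (by omega) (by omega)]
    simp only [Exp.val, Function.update_self, Function.update_of_ne hne]
    exact ⟨trivial, h⟩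

/-- The symbol at a position, counted from `5`, exists and satisfies `P`. -/
def AtSym (R : List ℕ) (P : ℕ → Bool) (y : ℕ) : Bool := decide (5 ≤ y) && (R[y - 5]?).any P

/-- The symbol at position `q` is an opening bracket. -/
def opF (c q : ℕ) : Form := .or (symF c q 0) (symF c q 3)

/-- The symbol at position `q` is a closing bracket. -/
def clF (c q : ℕ) : Form := .or (symF c q 1) (symF c q 4)

theorem holds_opF (hx : Inp x m R) (he : e ∈ envs m c) {q : ℕ} (hq : 1 ≤ q ∧ q ≤ c) :
    (opF c q).Holds x c e ↔ AtSym R isOp (e q) = true := by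
  rw [opF, holds_or, holds_symF hx he hq (by omega), holds_symF hx he hq (by omega), AtSym]
  cases h : R[e q - 5]? <;> simp [isOp]
  tauto

theorem holds_clF (hx : Inp x m R) (he : e ∈ envs m c) {q : ℕ} (hq : 1 ≤ q ∧ q ≤ c) :
    (clF c q).Holds x c e ↔ AtSym R isCl (e q) = true := by
  rw [clF, holds_or, holds_symF hx he hq (by omega), holds_symF hx he hq (by omega), AtSym]
  cases h : R[e q - 5]? <;> simp [isCl]
  tauto

/-- The next variable is strictly between `p` and `q` and satisfies `φ`. -/
def segF (φ : ℕ → ℕ → Form) (c p q : ℕ) : Form :=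
  .and (.lt (.var p) (.var (c + 1))) (.and (.lt (.var (c + 1)) (.var q)) (φ (c + 1) (c + 1)))

theorem countP_range'_atSym (R : List ℕ) (P : ℕ → Bool) (k : ℕ) : ∀ a, 5 ≤ a →
    (List.range' a k).countP (AtSym R P) = ((R.drop (a - 5)).take k).countP P := by
  induction k with
  | zero => simp
  | succ k ih =>
    intro a ha
    rw [List.range'_succ, List.countP_cons, ih (a + 1) (by omega),
      show a + 1 - 5 = a - 5 + 1 by omega]
    by_cases h : a - 5 < R.length
    · rw [List.drop_eq_getElem_cons h, List.take_succ_cons, List.countP_cons]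
      simp [AtSym, ha, List.getElem?_eq_getElem h]
    · rw [List.drop_eq_nil_of_le (by omega), List.drop_eq_nil_of_le (by omega)]
      simp [AtSym, List.getElem?_eq_none (show R.length ≤ a - 5 by omega)]

theorem countP_range_between {p z : ℕ} (hp : p < z) (hz : z ≤ m) (Q : ℕ → Bool) :
    ((List.range m).countP fun y => decide (p < y) && (decide (y < z) && Q y)) =
      (List.range' (p + 1) (z - (p + 1))).countP Q := by
  have h : List.range m = List.range' 0 (p + 1) ++ (List.range' (p + 1) (z - (p + 1)) ++
      List.range' z (m - z)) := by
    rw [List.range_eq_range']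
    have h1 := List.range'_append_1 (s := p + 1) (m := z - (p + 1)) (n := m - z)
    rw [show p + 1 + (z - (p + 1)) = z by omega] at h1
    rw [h1]
    have h2 := List.range'_append_1 (s := 0) (m := p + 1) (n := z - (p + 1) + (m - z))
    rw [Nat.zero_add] at h2
    rw [h2]
    congr 1
    omega
  rw [h, List.countP_append, List.countP_append]
  rw [List.countP_eq_zero.2, List.countP_eq_zero (l := List.range' z (m - z)) |>.2, zero_add,
    add_zero]
  · refine List.countP_congr fun y hy => ?_
    rw [List.mem_range'_1] at hy
    simp [show p < y by omega, show y < z by omega]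
  · intro y hy
    rw [List.mem_range'_1] at hy
    simp [show ¬ y < z by omega]
  · intro y hy
    rw [List.mem_range'_1] at hy
    simp [show ¬ p < y by omega]

/-- Counting symbols between two positions. The formula `φ` says of a position that its symbol
satisfies `P`. -/
theorem count_segF {φ : ℕ → ℕ → Form} {P : ℕ → Bool}
    (hφ : ∀ {c e q}, e ∈ envs m c → 1 ≤ q ∧ q ≤ c →
      ((φ c q).Holds x c e ↔ AtSym R P (e q) = true))
    (he : e ∈ envs m c) {p q : ℕ} (hp : 1 ≤ p ∧ p ≤ c) (hq : 1 ≤ q ∧ q ≤ c)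
    (h5 : 5 ≤ e p) (hpq : e p < e q) :
    (segF φ c p q).count x c e =
      ((R.drop (e p - 5 + 1)).take (e q - (e p + 1))).countP P := by
  have hp' : p ≠ c + 1 := by omega
  have hq' : q ≠ c + 1 := by omega
  rw [show e p - 5 + 1 = e p + 1 - 5 by omega, ← countP_range'_atSym _ _ _ _ (by omega),
    ← countP_range_between (m := m) hpq (env_lt he hq.1 hq.2).le, count, env_zero he]
  refine List.countP_congr fun y hy => ?_
  change (segF φ c p q).Holds x _ _ ↔ _
  rw [segF, holds_and, holds_and, holds_lt, holds_lt,
    hφ (update_mem_envs he (List.mem_range.1 hy)) (by omega)]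
  simp [Exp.val, hp', hq']

/-- A component of the value at position `p` starts at position `q`. -/
def childF (c p q : ℕ) : Form :=
  .and (.lt (.var p) (.var q))
    (.and (.not (ex (.and (.lt (.var p) (.var (c + 1))) (.and (.not (.lt (.var q) (.var (c + 1))))
        (gt (segF clF (c + 1) p (c + 1)) (segF opF (c + 1) p (c + 1)))))))
      (.and (eqc (segF opF c p q) (segF clF c p q))
        (.and (.or (eq (.var q) (.add (.var p) (.const 1)))
            (ex (.and (eq (.var q) (.add (.var (c + 1)) (.const 1))) (symF (c + 1) (c + 1) 2))))
          (.and (ex (inp q (c + 1))) (.not (clF c q))))))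

theorem ws_symF {q s : ℕ} (hq : 1 ≤ q ∧ q ≤ c) : (symF c q s).WS c := by
  rw [symF, ws_ex]
  simp only [WS, eq, Exp.WF, and_true, true_and]
  omega

theorem ws_segF {φ : ℕ → ℕ → Form} (hφ : ∀ {c q}, 1 ≤ q ∧ q ≤ c → (φ c q).WS c) {p q : ℕ}
    (hp : 1 ≤ p ∧ p ≤ c) (hq : 1 ≤ q ∧ q ≤ c) : (segF φ c p q).WS (c + 1) := by
  refine ⟨?_, ?_, hφ (by omega)⟩ <;> constructor <;> simp only [Exp.WF] <;> omega

theorem ws_opF {q : ℕ} (hq : 1 ≤ q ∧ q ≤ c) : (opF c q).WS c := ⟨ws_symF hq, ws_symF hq⟩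

theorem ws_clF {q : ℕ} (hq : 1 ≤ q ∧ q ≤ c) : (clF c q).WS c := ⟨ws_symF hq, ws_symF hq⟩

theorem ws_childF {p q : ℕ} (hp : 1 ≤ p ∧ p ≤ c) (hq : 1 ≤ q ∧ q ≤ c) : (childF c p q).WS c := by
  refine ⟨?_, ?_, ?_, ⟨?_, ?_⟩, ?_, ws_clF hq⟩
  · simp only [WS, Exp.WF]; omega
  · refine ws_ex.2 ⟨?_, ?_, ws_gt.2 ⟨ws_segF ws_clF ?_ ?_, ws_segF ws_opF ?_ ?_⟩⟩
    · simp only [WS, Exp.WF]; omega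
    · simp only [WS, Exp.WF]; omega
    all_goals omega
  · exact ws_eqc.2 ⟨ws_segF ws_opF hp hq, ws_segF ws_clF hp hq⟩
  · refine ws_eq.2 ?_
    simp only [Exp.WF, and_true]; omega
  · refine ws_ex.2 ⟨ws_eq.2 ?_, ws_symF (by omega)⟩
    simp only [Exp.WF, and_true]; omega
  · refine ws_ex.2 ?_
    simp only [WS]; omega

/-- The formula `childF` defines the relation `Child`. Positions in the domain are counted from `5`. -/
theorem holds_childF (hx : Inp x m R) (he : e ∈ envs m c) {p q : ℕ} (hp : 1 ≤ p ∧ p ≤ c)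
    (hq : 1 ≤ q ∧ q ≤ c) {p₀ : ℕ} (hp₀ : e p = 5 + p₀) :
    (childF c p q).Holds x c e ↔ ∃ q₀, e q = 5 + q₀ ∧ Child R p₀ q₀ := by
  have hp' : p ≠ c + 1 := by omega
  have hq' : q ≠ c + 1 := by omega
  have hqm := env_lt he hq.1 hq.2
  rw [childF, holds_and, holds_lt]
  simp only [Exp.val]
  by_cases hpq : e p < e q
  swap
  · simp only [hpq, false_and, false_iff, not_exists, not_and]
    rintro q₀ h ⟨h1, -⟩
    omega
  obtain ⟨j, hj⟩ : ∃ j, e q = 5 + (p₀ + 1 + j) := ⟨e q - (5 + (p₀ + 1)), by omega⟩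
  set s := R.drop (p₀ + 1) with hs
  have key : (∃ q₀, e q = 5 + q₀ ∧ Child R p₀ q₀) ↔ Ch s j := by
    constructor
    · rintro ⟨q₀, h, -, h2⟩
      rwa [show q₀ - (p₀ + 1) = j by omega] at h2
    · intro h
      exact ⟨p₀ + 1 + j, hj, by omega, by rwa [show p₀ + 1 + j - (p₀ + 1) = j by omega]⟩
  rw [key, Ch, holds_and, holds_and, holds_and, holds_and]
  simp only [hpq, true_and]
  have hdrop : e p - 5 + 1 = p₀ + 1 := by omega
  refine and_congr ?_ (and_congr ?_ (and_congr ?_ ?_))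
  · rw [holds_not, holds_ex, env_zero he]
    push Not
    constructor
    · intro h i hi
      rcases Nat.eq_zero_or_pos i with rfl | hi0
      · simp
      have hy : 5 + (p₀ + 1 + i) < m := by omega
      have he' := update_mem_envs he hy
      have h1 := h _ hy
      simp only [holds_and, holds_not, holds_lt, holds_gt, Exp.val, Function.update_self,
        Function.update_of_ne hp', Function.update_of_ne hq', not_and, not_lt] at h1
      have h2 := h1 (by omega) (by omega)
      rw [count_segF (fun h => holds_clF hx h) he' (by omega) (by omega)
          (by rw [Function.update_of_ne hp']; omega)
          (by rw [Function.update_of_ne hp', Function.update_self]; omega),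
        count_segF (fun h => holds_opF hx h) he' (by omega) (by omega)
          (by rw [Function.update_of_ne hp']; omega)
          (by rw [Function.update_of_ne hp', Function.update_self]; omega),
        Function.update_of_ne hp', Function.update_self, hdrop,
        show 5 + (p₀ + 1 + i) - (e p + 1) = i by omega] at h2
      exact h2
    · intro h y hy h1
      have he' := update_mem_envs he hy
      simp only [holds_and, holds_not, holds_lt, holds_gt, Exp.val, Function.update_self,
        Function.update_of_ne hp', Function.update_of_ne hq', not_lt] at h1
      obtain ⟨h1, h2, h3⟩ := h1
      rw [count_segF (fun h => holds_clF hx h) he' (by omega) (by omega)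
          (by rw [Function.update_of_ne hp']; omega)
          (by rw [Function.update_of_ne hp', Function.update_self]; omega),
        count_segF (fun h => holds_opF hx h) he' (by omega) (by omega)
          (by rw [Function.update_of_ne hp']; omega)
          (by rw [Function.update_of_ne hp', Function.update_self]; omega),
        Function.update_of_ne hp', Function.update_self, hdrop, ← hs] at h3
      have := h (y - (e p + 1)) (by omega)
      omega
  · rw [holds_eqc, count_segF (fun h => holds_clF hx h) he hp hq (by omega) hpq,
      count_segF (fun h => holds_opF hx h) he hp hq (by omega) hpq, hdrop,
      show e q - (e p + 1) = j by omega]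
  · rw [holds_or, holds_eq, holds_ex, env_zero he]
    simp only [Exp.val]
    rcases Nat.eq_zero_or_pos j with rfl | hj0
    · simp only [true_or, iff_true]
      omega
    refine or_congr (by omega) ?_
    -- For `j > 0`, the position before `q` is at offset `j - 1`.
    rw [hs, List.getElem?_drop]
    constructor
    · rintro ⟨y, hy, h⟩
      rw [holds_and, holds_eq, holds_symF hx (update_mem_envs he hy) (by omega) (by omega)] at h
      simp only [Exp.val, Function.update_self, Function.update_of_ne hq'] at h
      obtain ⟨h1, h2, h3⟩ := h
      rwa [show y - 5 = p₀ + 1 + (j - 1) by omega] at h3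
    · intro h
      have hy : 5 + (p₀ + 1 + (j - 1)) < m := by omega
      refine ⟨_, hy, ?_⟩
      rw [holds_and, holds_eq, holds_symF hx (update_mem_envs he hy) (by omega) (by omega)]
      simp only [Exp.val, Function.update_self, Function.update_of_ne hq']
      refine ⟨by omega, by omega, ?_⟩
      rwa [Nat.add_sub_cancel_left]
  · rw [holds_ex, holds_not, holds_clF hx he hq, env_zero he, hs, List.getElem?_drop]
    have hq5 : e q - 5 = p₀ + 1 + j := by omega
    simp only [AtSym, hq5]
    constructor
    · rintro ⟨⟨y, hy, h⟩, h2⟩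
      rw [holds_inp hx (update_mem_envs he hy) (by omega) (by omega)] at h
      simp only [Function.update_self, Function.update_of_ne hq', hq5] at h
      refine ⟨y, h.2, ?_⟩
      simpa [h.2, show 5 ≤ e q by omega] using h2
    · rintro ⟨y, h1, h2⟩
      have hy := hx.lt y (List.mem_of_getElem? h1)
      refine ⟨⟨y, hy, ?_⟩, by simp [h1, h2]⟩
      rw [holds_inp hx (update_mem_envs he hy) (by omega) (by omega)]
      simp only [Function.update_self, Function.update_of_ne hq', hq5]
      exact ⟨by omega, h1⟩

end Formulas

section Shredding

open Form

variable {σ n : ℕ} {R : List ℕ} {x : List Bool} {m c : ℕ} {e : ℕ → ℕ}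

/-! ### Formulas for shredding -/

/-- The next variable is the position where the second component of the pair at position `q`
starts. -/
def sndF (c q : ℕ) : Form :=
  .and (childF (c + 1) q (c + 1)) (.not (eq (.var (c + 1)) (.add (.var q) (.const 1))))

/-- The flat version of the value of type `A` at position `q` is the tuple of the variables
`i, i + 1, …`. -/
def flatF : Ty → (c q i : ℕ) → Form
  | .unit, _, _, _ => tt
  | .base, _, q, i => inp q i
  | .prod A B, c, q, i =>
    .and (ex (.and (eq (.var (c + 1)) (.add (.var q) (.const 1))) (flatF A (c + 1) (c + 1) i)))
      (ex (.and (sndF c q) (flatF B (c + 1) (c + 1) (i + width A))))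
  | .bag _, _, q, i => eq (.var q) (.var i)

/-- The value of type `A` whose position satisfies `At` contains a bag of type `Bag(C)` with label
`ℓ` and an element at position `q`. -/
def dictF (C : Ty) : Ty → (ℕ → ℕ → Form) → (c ℓ q : ℕ) → Form
  | .unit, _, _, _, _ => ff
  | .base, _, _, _, _ => ff
  | .prod A B, At, c, ℓ, q =>
    .or (dictF C A (fun c p => ex (.and (At (c + 1) (c + 1))
        (eq (.var p) (.add (.var (c + 1)) (.const 1))))) c ℓ q)
      (dictF C B (fun c p => ex (.and (At (c + 1) (c + 1)) (.and (childF (c + 1) (c + 1) p)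
        (.not (eq (.var p) (.add (.var (c + 1)) (.const 1))))))) c ℓ q)
  | .bag A, At, c, ℓ, q =>
    .or (if A = C then .and (At c ℓ) (childF c ℓ q) else ff)
      (dictF C A (fun c p => ex (.and (At (c + 1) (c + 1)) (childF (c + 1) (c + 1) p))) c ℓ q)

theorem ws_flatF : ∀ (A : Ty) (c q i : ℕ), 1 ≤ q ∧ q ≤ c → 1 ≤ i → i + width A ≤ c + 1 →
    (flatF A c q i).WS c
  | .unit, _, _, _, _, _, _ => ws_tt
  | .base, c, q, i, hq, hi, hic => by
    simp only [width] at hic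
    exact ⟨hq, hi, by omega⟩
  | .prod A B, c, q, i, hq, hi, hic => by
    simp only [width] at hic
    refine ⟨ws_ex.2 ⟨ws_eq.2 ?_, ws_flatF A _ _ _ (by omega) hi (by omega)⟩,
      ws_ex.2 ⟨⟨ws_childF (by omega) (by omega), ws_eq.2 ?_⟩,
        ws_flatF B _ _ _ (by omega) (by omega) (by omega)⟩⟩ <;>
    · simp only [Exp.WF, and_true]; omega
  | .bag C, c, q, i, hq, hi, hic => by
    simp only [width] at hic
    refine ws_eq.2 ?_
    simp only [Exp.WF]; omega

theorem ws_dictF (C : Ty) : ∀ (A : Ty) (At : ℕ → ℕ → Form) (c ℓ q : ℕ),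
    (∀ c p, 1 ≤ p ∧ p ≤ c → (At c p).WS c) → 1 ≤ ℓ ∧ ℓ ≤ c → 1 ≤ q ∧ q ≤ c →
    (dictF C A At c ℓ q).WS c
  | .unit, _, _, _, _, _, _, _ => ws_ff
  | .base, _, _, _, _, _, _, _ => ws_ff
  | .prod A B, At, c, ℓ, q, hAt, hl, hq => by
    refine ⟨ws_dictF C A _ c ℓ q (fun c p hp => ws_ex.2 ⟨hAt _ _ (by omega), ws_eq.2 ?_⟩) hl hq,
      ws_dictF C B _ c ℓ q (fun c p hp => ws_ex.2 ⟨hAt _ _ (by omega),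
        ws_childF (by omega) (by omega), ws_eq.2 ?_⟩) hl hq⟩ <;>
    · simp only [Exp.WF, and_true]; omega
  | .bag A, At, c, ℓ, q, hAt, hl, hq => by
    refine ⟨?_, ws_dictF C A _ c ℓ q (fun c p hp => ws_ex.2 ⟨hAt _ _ (by omega),
      ws_childF (by omega) (by omega)⟩) hl hq⟩
    split_ifs
    · exact ⟨hAt _ _ hl, ws_childF hl hq⟩
    · exact ws_ff

/-- The position of a value is an element of the domain. -/
theorem Occ.lt_dom (hx : Inp x m R) {A : Ty} {a : Val σ A} {p : ℕ} (h : Occ n R A a p) :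
    5 + p < m := by
  have := h.lt_length
  have := hx.len
  omega

theorem holds_sndF (hx : Inp x m R) (he : e ∈ envs m c) {A B : Ty} {a : Val σ A} {b : Val σ B}
    {p q y : ℕ} (h : Occ n R (.prod A B) (a, b) p) (hq : 1 ≤ q ∧ q ≤ c) (hqp : e q = 5 + p)
    (hy : y < m) :
    (sndF c q).Holds x (c + 1) (Function.update e (c + 1) y) ↔
      y = 5 + (p + 1 + (str A a).length + 1) := by
  have hq' : q ≠ c + 1 := by omega
  have he' := update_mem_envs he hy
  have hA := str_length_pos A a
  rw [sndF, holds_and, holds_not, holds_eq, holds_childF hx he' (by omega) (by omega)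
    (by rwa [Function.update_of_ne hq'])]
  simp only [h.child_prod, Exp.val, Function.update_self, Function.update_of_ne hq', hqp]
  constructor
  · rintro ⟨⟨q₀, rfl, h1⟩, h2⟩
    omega
  · rintro rfl
    exact ⟨⟨_, rfl, Or.inr rfl⟩, by omega⟩

/-- The formula `flatF` defines the flat version of a value that occurs at position `q`. -/
theorem holds_flatF (hx : Inp x m R) : ∀ (A : Ty) (a : Val σ A) (p c q i : ℕ) (e : ℕ → ℕ),
    Occ n R A a p → e ∈ envs m c → 1 ≤ q ∧ q ≤ c → e q = 5 + p → 1 ≤ i → i + width A ≤ c + 1 →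
    ((flatF A c q i).Holds x c e ↔
      (flat A a p).map (Sym.rank n) = (List.range' i (width A)).map e)
  | .unit, _, _, _, _, _, _, _, _, _, _, _, _ => by simp [flatF, flat, width]
  | .base, a, p, c, q, i, e, h, he, hq, hqp, hi, hic => by
    simp only [width] at hic
    obtain ⟨Y, hY⟩ := h
    have h1 : R[p]? = some (Sym.rank n (.atom a : Sym σ)) := by
      have := congrArg (fun l => l[0]?) hY
      simpa [rstr, str] using this
    rw [flatF, holds_inp hx he hq (by omega), hqp, Nat.add_sub_cancel_left, h1]
    simp [flat, width]
  | .bag C, l, p, c, q, i, e, h, he, hq, hqp, hi, hic => by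
    simp [flatF, flat, width, Exp.val, hqp, Sym.rank]
  | .prod A B, (a, b), p, c, q, i, e, h, he, hq, hqp, hi, hic => by
    simp only [width] at hic
    have hq' : q ≠ c + 1 := by omega
    have hupd : ∀ y j k, j + k ≤ c + 1 →
        (List.range' j k).map (Function.update e (c + 1) y) = (List.range' j k).map e :=
      fun y j k hjk => List.map_congr_left fun l hl => by
        rw [List.mem_range'_1] at hl
        exact Function.update_of_ne (by omega) _ _
    have hlt1 := h.fst.lt_dom hx
    have hlt2 := h.snd.lt_dom hx
    have e1 : (ex (.and (eq (.var (c + 1)) (.add (.var q) (.const 1)))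
        (flatF A (c + 1) (c + 1) i))).Holds x c e ↔
        (flat A a (p + 1)).map (Sym.rank n) = (List.range' i (width A)).map e := by
      have key : (flatF A (c + 1) (c + 1) i).Holds x (c + 1)
          (Function.update e (c + 1) (5 + (p + 1))) ↔ _ :=
        holds_flatF hx A a (p + 1) (c + 1) (c + 1) i _ h.fst (update_mem_envs he hlt1)
          (by omega) (by simp) hi (by omega)
      rw [hupd _ _ _ (by omega)] at key
      rw [← key, holds_ex, env_zero he]
      simp only [holds_and, holds_eq, Exp.val, Function.update_self, Function.update_of_ne hq', hqp]
      constructor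
      · rintro ⟨y, hy, rfl, h⟩
        exact h
      · exact fun h => ⟨_, hlt1, by omega, h⟩
    have e2 : (ex (.and (sndF c q) (flatF B (c + 1) (c + 1) (i + width A)))).Holds x c e ↔
        (flat B b (p + 1 + (str A a).length + 1)).map (Sym.rank n) =
          (List.range' (i + width A) (width B)).map e := by
      have key : (flatF B (c + 1) (c + 1) (i + width A)).Holds x (c + 1)
          (Function.update e (c + 1) (5 + (p + 1 + (str A a).length + 1))) ↔ _ :=
        holds_flatF hx B b _ (c + 1) (c + 1) (i + width A) _ h.snd (update_mem_envs he hlt2)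
          (by omega) (by simp) (by omega) (by omega)
      rw [hupd _ _ _ (by omega)] at key
      rw [← key, holds_ex, env_zero he]
      constructor
      · rintro ⟨y, hy, hh⟩
        rw [holds_and, holds_sndF hx he h hq hqp hy] at hh
        obtain ⟨rfl, h⟩ := hh
        exact h
      · intro hh
        refine ⟨_, hlt2, ?_⟩
        rw [holds_and, holds_sndF hx he h hq hqp hlt2]
        exact ⟨rfl, hh⟩
    rw [flatF, holds_and, e1, e2, flat, width, List.map_append,
      ← List.range'_append_1 (s := i) (m := width A) (n := width B), List.map_append]
    constructor
    · rintro ⟨h1, h2⟩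
      rw [h1, h2]
    · intro h
      exact List.append_inj h (by simp [length_flat])

theorem exists_mem_map_iff {α β : Type*} {l : List α} {f : α → β} {P : β → Prop} :
    (∃ b ∈ l.map f, P b) ↔ ∃ a ∈ l, P (f a) := by
  simp

/-- The formula `dictF` defines the entries of the dictionaries for the values in `L`, if `At` defines
the positions of these values. -/
theorem holds_dictF (hx : Inp x m R) (C : Ty) : ∀ (A : Ty) (At : ℕ → ℕ → Form)
    (L : List (Val σ A × ℕ)),
    (∀ o ∈ L, Occ n R A o.1 o.2) →
    (∀ c, ∀ e ∈ envs m c, ∀ p, 1 ≤ p ∧ p ≤ c →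
      ((At c p).Holds x c e ↔ ∃ o ∈ L, e p = 5 + o.2)) →
    ∀ c, ∀ e ∈ envs m c, ∀ ℓ q, 1 ≤ ℓ ∧ ℓ ≤ c → 1 ≤ q ∧ q ≤ c →
      ((dictF C A At c ℓ q).Holds x c e ↔
        ∃ o ∈ L, ∃ t ∈ items C A o.1 o.2, e ℓ = 5 + t.1 ∧ e q = 5 + t.2.1)
  | .unit, _, _, _, _, _, _, _, _, _, _, _ => by simp [dictF, items]
  | .base, _, _, _, _, _, _, _, _, _, _, _ => by simp [dictF, items]
  | .prod A B, At, L, hL, hAt, c, e, he, ℓ, q, hl, hq => by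
    have hA := holds_dictF hx C A (fun c p => ex (.and (At (c + 1) (c + 1))
        (eq (.var p) (.add (.var (c + 1)) (.const 1))))) (L.map fun o => (o.1.1, o.2 + 1)) ?_ ?_
        c e he ℓ q hl hq
    have hB := holds_dictF hx C B (fun c p => ex (.and (At (c + 1) (c + 1))
        (.and (childF (c + 1) (c + 1) p)
        (.not (eq (.var p) (.add (.var (c + 1)) (.const 1)))))))
        (L.map fun o => (o.1.2, o.2 + 1 + (str A o.1.1).length + 1)) ?_ ?_ c e he ℓ q hl hq
    · rw [dictF, holds_or, hA, hB]
      simp only [exists_mem_map_iff]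
      constructor
      · rintro (⟨o, ho, t, ht, h⟩ | ⟨o, ho, t, ht, h⟩)
        · exact ⟨o, ho, t, List.mem_append_left _ ht, h⟩
        · exact ⟨o, ho, t, List.mem_append_right _ ht, h⟩
      · rintro ⟨o, ho, t, ht, h⟩
        rcases List.mem_append.1 ht with ht | ht
        · exact Or.inl ⟨o, ho, t, ht, h⟩
        · exact Or.inr ⟨o, ho, t, ht, h⟩
    · intro o ho
      obtain ⟨⟨⟨a, b⟩, p⟩, ho', rfl⟩ := List.mem_map.1 ho
      exact (hL _ ho').snd
    · intro c e he p hp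
      have hp' : p ≠ c + 1 := by omega
      rw [holds_ex, env_zero he]
      constructor
      · rintro ⟨y, hy, h⟩
        have he' := update_mem_envs he hy
        rw [holds_and, hAt _ _ he' _ (by omega), Function.update_self] at h
        obtain ⟨⟨⟨⟨a, b⟩, p₀⟩, ho, rfl⟩, h⟩ := h
        rw [holds_and, holds_childF hx he' (by omega) (by omega) (Function.update_self _ _ _)] at h
        simp only [(hL _ ho).child_prod, holds_not, holds_eq, Exp.val, Function.update_self,
          Function.update_of_ne hp'] at h
        refine ⟨_, List.mem_map_of_mem ho, ?_⟩
        obtain ⟨⟨q₀, h1, h2⟩, h3⟩ := h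
        dsimp only
        omega
      · rintro ⟨o, ho, h⟩
        obtain ⟨⟨⟨a, b⟩, p₀⟩, ho', rfl⟩ := List.mem_map.1 ho
        have hy := (hL _ ho').lt_dom hx
        have he' := update_mem_envs he hy
        have hA := str_length_pos A a
        refine ⟨_, hy, ?_⟩
        rw [holds_and, hAt _ _ he' _ (by omega), Function.update_self, holds_and,
          holds_childF hx he' (by omega) (by omega) (Function.update_self _ _ _)]
        simp only [(hL _ ho').child_prod, holds_not, holds_eq, Exp.val, Function.update_self,
          Function.update_of_ne hp']
        dsimp only at h
        exact ⟨⟨_, ho', rfl⟩, ⟨_, h, Or.inr rfl⟩, by omega⟩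
    · intro o ho
      obtain ⟨⟨⟨a, b⟩, p⟩, ho', rfl⟩ := List.mem_map.1 ho
      exact (hL _ ho').fst
    · intro c e he p hp
      have hp' : p ≠ c + 1 := by omega
      rw [holds_ex, env_zero he]
      constructor
      · rintro ⟨y, hy, h⟩
        have he' := update_mem_envs he hy
        rw [holds_and, hAt _ _ he' _ (by omega), Function.update_self] at h
        obtain ⟨⟨o, ho, rfl⟩, h⟩ := h
        simp only [holds_eq, Exp.val, Function.update_self, Function.update_of_ne hp'] at h
        exact ⟨_, List.mem_map_of_mem ho, by dsimp only; omega⟩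
      · rintro ⟨o, ho, h⟩
        obtain ⟨o, ho', rfl⟩ := List.mem_map.1 ho
        have hy := (hL _ ho').lt_dom hx
        have he' := update_mem_envs he hy
        refine ⟨_, hy, ?_⟩
        rw [holds_and, hAt _ _ he' _ (by omega), Function.update_self]
        simp only [holds_eq, Exp.val, Function.update_self, Function.update_of_ne hp']
        dsimp only at h
        exact ⟨⟨_, ho', rfl⟩, by omega⟩
  | .bag A, At, L, hL, hAt, c, e, he, ℓ, q, hl, hq => by
    have hA := holds_dictF hx C A (fun c p => ex (.and (At (c + 1) (c + 1))
        (childF (c + 1) (c + 1) p))) (L.flatMap fun o => elems A (o.2 + 1) o.1) ?_ ?_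
        c e he ℓ q hl hq
    · rw [dictF, holds_or, hA]
      simp only [items, List.mem_append, List.mem_flatMap]
      have h1 : (if A = C then Form.and (At c ℓ) (childF c ℓ q) else ff).Holds x c e ↔
          ∃ o ∈ L, ∃ t ∈ (if A = C then (elems A (o.2 + 1) o.1).map fun e =>
            (o.2, e.2, flat A e.1 e.2) else []), e ℓ = 5 + t.1 ∧ e q = 5 + t.2.1 := by
        split_ifs with hAC
        · rw [holds_and, hAt c e he ℓ hl]
          simp only [exists_mem_map_iff]
          constructor
          · rintro ⟨⟨o, ho, h1⟩, h2⟩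
            rw [holds_childF hx he hl hq h1] at h2
            obtain ⟨q₀, h3, h4⟩ := h2
            obtain ⟨f, hf, rfl⟩ := (hL _ ho).child_bag.1 h4
            exact ⟨o, ho, f, hf, h1, h3⟩
          · rintro ⟨o, ho, f, hf, h1, h2⟩
            rw [holds_childF hx he hl hq h1]
            exact ⟨⟨o, ho, h1⟩, _, h2, (hL _ ho).child_bag.2 ⟨f, hf, rfl⟩⟩
        · simp
      rw [h1]
      constructor
      · rintro (⟨o, ho, t, ht, h⟩ | ⟨f, ⟨o, ho, hf⟩, t, ht, h⟩)
        · exact ⟨o, ho, t, Or.inl ht, h⟩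
        · exact ⟨o, ho, t, Or.inr ⟨f, hf, ht⟩, h⟩
      · rintro ⟨o, ho, t, ht | ⟨f, hf, ht⟩, h⟩
        · exact Or.inl ⟨o, ho, t, ht, h⟩
        · exact Or.inr ⟨f, ⟨o, ho, hf⟩, t, ht, h⟩
    · intro f hf
      obtain ⟨o, ho, hf⟩ := List.mem_flatMap.1 hf
      exact (hL o ho).elem hf
    · intro c e he p hp
      have hp' : p ≠ c + 1 := by omega
      rw [holds_ex, env_zero he]
      constructor
      · rintro ⟨y, hy, h⟩
        have he' := update_mem_envs he hy
        rw [holds_and, hAt _ _ he' _ (by omega), Function.update_self] at h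
        obtain ⟨⟨o, ho, rfl⟩, h⟩ := h
        rw [holds_childF hx he' (by omega) (by omega) (Function.update_self _ _ _),
          Function.update_of_ne hp'] at h
        obtain ⟨q₀, h3, h4⟩ := h
        obtain ⟨f, hf, rfl⟩ := (hL _ ho).child_bag.1 h4
        exact ⟨f, List.mem_flatMap.2 ⟨o, ho, hf⟩, h3⟩
      · rintro ⟨f, hf, h⟩
        obtain ⟨o, ho, hf⟩ := List.mem_flatMap.1 hf
        have hy := (hL _ ho).lt_dom hx
        have he' := update_mem_envs he hy
        refine ⟨_, hy, ?_⟩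
        rw [holds_and, hAt _ _ he' _ (by omega), Function.update_self,
          holds_childF hx he' (by omega) (by omega) (Function.update_self _ _ _),
          Function.update_of_ne hp']
        exact ⟨⟨_, ho, rfl⟩, _, h, (hL _ ho).child_bag.2 ⟨f, hf, rfl⟩⟩

/-! ### Binary digits of a multiplicity -/

/-- Binary digit `i` of the number of values of `q` that satisfy `φ`. The next variable `y` is this
number, the following ones are its higher and lower digits, shifted to form numbers. -/
def bitF (φ : ℕ → ℕ → Form) (i c : ℕ) : Form :=
  ex (.and (eqc (φ (c + 2) (c + 2)) (.lt (.var (c + 2)) (.var (c + 1))))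
    (ex (ex (.and (.lt (.var (c + 3)) (.const (2 ^ i)))
      (eq (.var (c + 1)) (.add (.mul (.const (2 ^ (i + 1))) (.var (c + 2)))
        (.add (.const (2 ^ i)) (.var (c + 3)))))))))

theorem ws_bitF {φ : ℕ → ℕ → Form} {i c : ℕ} (hφ : (φ (c + 2) (c + 2)).WS (c + 2)) :
    (bitF φ i c).WS c := by
  refine ws_ex.2 ⟨ws_eqc.2 ⟨hφ, ?_⟩, ws_ex.2 (ws_ex.2 ⟨?_, ws_eq.2 ?_⟩)⟩ <;>
  · simp only [WS, Exp.WF, and_true, true_and]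
    omega

theorem testBit_iff {N i m : ℕ} (hN : N < m) : N.testBit i = true ↔
    ∃ a < m, ∃ b < m, b < 2 ^ i ∧ N = 2 ^ (i + 1) * a + (2 ^ i + b) := by
  rw [Nat.testBit_eq_decide_div_mod_eq, decide_eq_true_eq]
  have hp : 0 < 2 ^ i := Nat.two_pow_pos i
  constructor
  · intro h
    have h1 := Nat.div_add_mod N (2 ^ i)
    have h2 := Nat.div_add_mod (N / 2 ^ i) 2
    have h3 := Nat.mod_lt N hp
    refine ⟨N / 2 ^ i / 2, ?_, N % 2 ^ i, ?_, h3, ?_⟩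
    · exact ((Nat.div_le_self _ _).trans (Nat.div_le_self _ _)).trans_lt hN
    · exact (Nat.mod_le _ _).trans_lt hN
    · rw [h] at h2
      calc N = 2 ^ i * (2 * (N / 2 ^ i / 2) + 1) + N % 2 ^ i := by rw [h2, h1]
        _ = _ := by ring
  · rintro ⟨a, -, b, -, hb, rfl⟩
    rw [show 2 ^ (i + 1) * a + (2 ^ i + b) = b + 2 ^ i * (2 * a + 1) by ring,
      Nat.add_mul_div_left _ _ hp, Nat.div_eq_of_lt hb]
    omega

theorem holds_bitF {φ : ℕ → ℕ → Form} {i N : ℕ} (he : e ∈ envs m c) (hN : N < m)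
    (hφ : ∀ y < m, (φ (c + 2) (c + 2)).count x (c + 1) (Function.update e (c + 1) y) = N) :
    (bitF φ i c).Holds x c e ↔ N.testBit i = true := by
  have h1 : ∀ y < m, (Form.lt (.var (c + 2)) (.var (c + 1))).count x (c + 1)
      (Function.update e (c + 1) y) = y := by
    intro y hy
    have h0 := env_zero (update_mem_envs he hy)
    rw [count, h0]
    simp only [eval, Exp.val, Function.update_self, Function.update_of_ne (show c + 1 ≠ c + 1 + 1
      by omega)]
    have : List.range m = List.range' 0 y ++ List.range' y (m - y) := by
      have := List.range'_append_1 (s := 0) (m := y) (n := m - y)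
      rw [Nat.zero_add] at this
      rw [this, List.range_eq_range']
      congr 1
      omega
    rw [this, List.countP_append, List.countP_eq_length.2, List.countP_eq_zero.2]
    · simp
    · intro z hz
      rw [List.mem_range'_1] at hz
      simp
      omega
    · intro z hz
      rw [List.mem_range'_1] at hz
      simp
      omega
  rw [testBit_iff hN, bitF, holds_ex, env_zero he]
  have h2 : ∀ y < m, (Form.and (eqc (φ (c + 2) (c + 2)) (.lt (.var (c + 2)) (.var (c + 1))))
    (ex (ex (.and (.lt (.var (c + 3)) (.const (2 ^ i)))
      (eq (.var (c + 1)) (.add (.mul (.const (2 ^ (i + 1))) (.var (c + 2)))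
        (.add (.const (2 ^ i)) (.var (c + 3))))))))).Holds x (c + 1)
        (Function.update e (c + 1) y) ↔ N = y ∧ ∃ a < m, ∃ b < m, b < 2 ^ i ∧
          y = 2 ^ (i + 1) * a + (2 ^ i + b) := by
    intro y hy
    have he' := update_mem_envs he hy
    rw [holds_and, holds_eqc, h1 y hy, hφ y hy, holds_ex, env_zero he']
    refine and_congr_right fun _ => exists_congr fun a => and_congr_right fun ha => ?_
    rw [holds_ex, env_zero (update_mem_envs he' ha)]
    simp [Exp.val, Function.update_of_ne]
  constructor
  · rintro ⟨y, hy, h⟩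
    obtain ⟨rfl, h⟩ := (h2 y hy).1 h
    exact h
  · intro h
    exact ⟨N, hN, (h2 N hN).2 ⟨rfl, h⟩⟩

/-- If the values of `φ` are the positions of those entries of `T` that satisfy `Q`, and different
entries have different positions, then they count these entries. -/
theorem countP_range_eq {τ : Type*} (T : List τ) (g : τ → ℕ) (Q : τ → Prop) [DecidablePred Q]
    (hg : (T.map g).Nodup) (hm : ∀ t ∈ T, 5 + g t < m) (f : ℕ → Bool)
    (hf : ∀ y < m, f y = true ↔ ∃ t ∈ T, 5 + g t = y ∧ Q t) :
    (List.range m).countP f = T.countP Q := by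
  have h1 : ((T.filter Q).map fun t => 5 + g t).Nodup := by
    have : (T.map fun t => 5 + g t).Nodup := by
      have := hg.map (f := fun y => 5 + y) fun a b h => by simpa using h
      simpa [Function.comp_def] using this
    exact this.sublist (List.filter_sublist.map _)
  have h2 : ((List.range m).filter f).Nodup := List.nodup_range.filter _
  have h3 : ((List.range m).filter f).Perm ((T.filter Q).map fun t => 5 + g t) := by
    rw [List.perm_ext_iff_of_nodup h2 h1]
    intro y
    simp only [List.mem_filter, List.mem_range, List.mem_map, decide_eq_true_eq]
    constructor
    · rintro ⟨hy, h⟩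
      obtain ⟨t, ht, h4, h5⟩ := (hf y hy).1 h
      exact ⟨t, ⟨ht, h5⟩, h4⟩
    · rintro ⟨t, ⟨ht, h5⟩, rfl⟩
      exact ⟨hm t ht, (hf _ (hm t ht)).2 ⟨t, ht, rfl, h5⟩⟩
  rw [List.countP_eq_length_filter, List.countP_eq_length_filter, h3.length_eq, List.length_map]

end Shredding

section Output

open Form

variable {σ n : ℕ} {R : List ℕ} {x : List Bool} {m c : ℕ} {e : ℕ → ℕ}

/-! ### Bit representations -/

theorem tuples_succ (m r : ℕ) : tuples m (r + 1) =
    (tuples m r).flatMap fun t => (List.range m).map fun a => t ++ [a] := by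
  induction r with
  | zero =>
    simp only [tuples, List.map_cons, List.map_nil, List.flatMap_cons, List.flatMap_nil,
      List.append_nil, List.nil_append]
    exact List.flatMap_pure_eq_map _ _
  | succ r ih =>
    conv_lhs => rw [tuples, ih]
    rw [tuples, List.flatMap_assoc]
    refine List.flatMap_congr fun a _ => ?_
    rw [List.map_flatMap, List.flatMap_map]
    refine List.flatMap_congr fun t _ => ?_
    rw [List.map_map]
    rfl

theorem tuples_eq (m r : ℕ) :
    tuples m r = (envs m r).map fun e => (List.range' 1 r).map e := by
  induction r with
  | zero => rfl
  | succ r ih =>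
    rw [tuples_succ, ih, envs, List.flatMap_map, List.map_flatMap]
    refine List.flatMap_congr fun e _ => ?_
    rw [List.map_map]
    refine List.map_congr_left fun a _ => ?_
    rw [Function.comp_apply, List.range'_concat, List.map_append]
    congr 1
    · refine List.map_congr_left fun l hl => ?_
      rw [List.mem_range'_1] at hl
      exact (Function.update_of_ne (by omega) _ _).symm
    · simp [add_comm 1 r]

theorem rank_lt : ∀ (A : Ty) (a : Val σ A), ∀ s ∈ rstr n A a, s < σ + 5 + n
  | .unit, _ => by
    simp [rstr, str, Sym.rank]
    omega
  | .base, a => by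
    have h := Fin.is_lt (n := σ) a
    simp [rstr, str, Sym.rank]
    omega
  | .prod A B, (a, b) => by
    rw [rstr_prod]
    intro s hs
    simp only [List.mem_cons, List.mem_append, List.not_mem_nil, or_false] at hs
    rcases hs with rfl | h | rfl | h | rfl
    · omega
    · exact rank_lt A a s h
    · omega
    · exact rank_lt B b s h
    · omega
  | .bag C, l => by
    have h := rstr_bag (n := n) C l
    rw [h]
    clear h
    intro s hs
    simp only [List.mem_cons, List.mem_append, List.not_mem_nil, or_false] at hs
    rcases hs with rfl | h | rfl
    · omega
    · induction l with
      | nil => simp [rlist_nil] at h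
      | cons c l ih =>
        cases l with
        | nil =>
          rw [rlist_singleton] at h
          exact rank_lt C c s h
        | cons d l =>
          rw [rlist_cons_cons] at h
          simp only [List.mem_cons, List.mem_append] at h
          rcases h with h | rfl | h
          · exact rank_lt C c s h
          · omega
          · exact ih h
    · omega

theorem inp_nStr (B : Ty) (v : Val σ (.bag B)) :
    Inp (nStr B v) (domSize B v) (rstr (strLen B v) (.bag B) v) := by
  refine ⟨fun a ha s hs => ?_, ?_, ?_, rank_lt (.bag B) v⟩
  · have he : Function.update (Function.update (fun _ => domSize B v) 1 a) 2 s ∈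
        envs (domSize B v) 2 :=
      update_mem_envs (update_mem_envs (List.mem_singleton_self _) ha) hs
    have h := getElem?_envs he
    have h2 : (Exp.idx 2).val (Function.update (Function.update (fun _ => domSize B v) 1 a) 2 s) =
        a * domSize B v + s := by
      simp [Exp.idx, Exp.val, Function.update_of_ne]
    rw [h2] at h
    rw [nStr, fSet, tuples_eq, List.getD_eq_getElem?_getD, List.getElem?_map, List.getElem?_map, h]
    simp only [Option.map_some, Option.getD_some, decide_eq_true_eq, List.mem_map, Prod.exists,
      List.mem_zipIdx_iff_getElem?]
    have h3 : (List.range' 1 2).map (Function.update (Function.update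
        (fun _ => domSize B v) 1 a) 2 s) = [a, s] := by
      simp [List.range', Function.update_of_ne]
    rw [h3, rstr, List.getElem?_map]
    simp only [Sym.rank, List.cons.injEq, and_true, Option.map_eq_some_iff]
    constructor
    · rintro ⟨y, i, h4, rfl, rfl⟩
      exact ⟨by omega, y, by rwa [Nat.add_sub_cancel_left], rfl⟩
    · rintro ⟨h5, y, h4, rfl⟩
      exact ⟨y, a - 5, h4, by omega, rfl⟩
  · rw [domSize]
    omega
  · rw [length_rstr, domSize, strLen]
    omega

theorem length_nStr (B : Ty) (v : Val σ (.bag B)) :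
    (nStr B v).length = domSize B v * domSize B v := by
  rw [nStr, fSet, tuples_eq, List.length_map, List.length_map, length_envs, pow_two]

/-- The formulas for the `k` binary digits of the number of values of `q` that satisfy `φ`. -/
def bagForms (k : ℕ) (φ : ℕ → ℕ → Form) (r : ℕ) : List Form :=
  (List.range k).map fun i => bitF φ i r

/-- If `φ` says that `q` is the position of an entry of `T` with the tuple of the variables
`1, …, r`, then the digits of the numbers of such `q` represent the bag of the tuples. -/
theorem eval_bagForms {τ : Type*} {k r : ℕ} {φ : ℕ → ℕ → Form} (T : List τ) (g : τ → ℕ)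
    (X : τ → List ℕ) (hg : (T.map g).Nodup) (hm : ∀ t ∈ T, 5 + g t < m) (h0 : 0 < m)
    (hφ : ∀ e ∈ envs m (r + 2), (φ (r + 2) (r + 2)).Holds x (r + 2) e ↔
      ∃ t ∈ T, 5 + g t = e (r + 2) ∧ X t = (List.range' 1 r).map e) :
    ((envs m r).flatMap fun e => (bagForms k φ r).map fun ψ => ψ.eval x r e) =
      fBag k m r (T.map X) := by
  rw [fBag, tuples_eq, List.flatMap_map]
  refine List.flatMap_congr fun e he => ?_
  rw [bagForms, List.map_map]
  refine List.map_congr_left fun i hi => ?_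
  have hcount : ∀ y < m, (φ (r + 2) (r + 2)).count x (r + 1) (Function.update e (r + 1) y) =
      T.countP fun t => X t = (List.range' 1 r).map e := by
    intro y hy
    have he' := update_mem_envs he hy
    rw [count, env_zero he']
    refine countP_range_eq T g _ hg hm _ fun z hz => ?_
    refine (hφ _ (update_mem_envs he' hz)).trans ?_
    have : (List.range' 1 r).map
        (Function.update (Function.update e (r + 1) y) (r + 1 + 1) z) =
        (List.range' 1 r).map e := List.map_congr_left fun l hl => by
      rw [List.mem_range'_1] at hl
      rw [Function.update_of_ne (by omega), Function.update_of_ne (by omega)]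
    rw [this, Function.update_self]
  have hlt : (T.countP fun t => X t = (List.range' 1 r).map e) < m := by
    rw [← hcount 0 h0, count, env_zero (update_mem_envs he h0)]
    refine lt_of_le_of_ne (List.countP_le_length.trans (by simp)) fun h => ?_
    -- No entry has position `0` of the domain, so not all elements of the domain are counted.
    have h1 := List.countP_eq_length.1 (h.trans List.length_range.symm) 0 (List.mem_range.2 h0)
    obtain ⟨t, -, h2, -⟩ := (hφ _ (update_mem_envs (update_mem_envs he h0) h0)).1 h1
    rw [Function.update_self] at h2
    omega
  rw [Function.comp_apply, Nat.testBit_mod_two_pow]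
  have := holds_bitF (i := i) he hlt hcount
  rw [List.mem_range] at hi
  simp only [hi, decide_true, Bool.true_and]
  rw [Bool.eq_iff_iff]
  refine this.trans ?_
  rw [List.count, List.countP_map]
  have hc : (T.countP fun t => decide (X t = (List.range' 1 r).map e)) =
      T.countP ((fun y => y == (List.range' 1 r).map e) ∘ X) :=
    List.countP_congr fun t _ => by simp
  rw [hc]

/-! ### Shredding -/

/-- The variable `q` is the position of an element of the whole bag. -/
def topF (c q : ℕ) : Form :=
  ex (.and (eq (.var (c + 1)) (.const 5)) (childF (c + 1) (c + 1) q))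

/-- The element of the whole bag at position `q` has a given flat version. -/
def flatBagF (B : Ty) (c q : ℕ) : Form := .and (topF c q) (flatF B c q 1)

/-- The element at position `q` of a bag of type `Bag(C)` with a given label has a given flat
version. -/
def dictBagF (B C : Ty) (c q : ℕ) : Form :=
  .and (dictF C (.bag B) (fun _ p => eq (.var p) (.const 5)) c 1 q) (flatF C c q 2)

/-- The formulas for shredding bags of type `Bag(B)`. -/
def shredForms (B : Ty) (k : ℕ) : List (ℕ × List Form) :=
  (width B, bagForms k (flatBagF B) (width B)) ::
    (ctxTypes B).map fun C => (1 + width C, bagForms k (dictBagF B C) (1 + width C))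

theorem ws_shredForms (B : Ty) (k : ℕ) : ∀ c ∈ shredForms B k, ∀ φ ∈ c.2, φ.WS c.1 := by
  intro c hc φ hφ
  rcases List.mem_cons.1 hc with rfl | hc
  · obtain ⟨i, -, rfl⟩ := List.mem_map.1 hφ
    refine ws_bitF ⟨ws_ex.2 ⟨ws_eq.2 ?_, ws_childF (by omega) (by omega)⟩,
      ws_flatF _ _ _ _ (by omega) (by omega) (by omega)⟩
    simp only [Exp.WF, and_true]
    omega
  · obtain ⟨C, -, rfl⟩ := List.mem_map.1 hc
    obtain ⟨i, -, rfl⟩ := List.mem_map.1 hφ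
    refine ws_bitF ⟨ws_dictF _ _ _ _ _ _ (fun c p hp => ws_eq.2 ?_) (by omega) (by omega),
      ws_flatF _ _ _ _ (by omega) (by omega) (by omega)⟩
    simp only [Exp.WF, and_true]
    omega

theorem holds_flatBagF (hx : Inp x m R) {B : Ty} {l : List (Val σ B)} (h : Occ n R (.bag B) l 0)
    {q : ℕ} (he : e ∈ envs m c) (hq : 1 ≤ q ∧ q ≤ c) (hc : width B ≤ c) :
    (flatBagF B c q).Holds x c e ↔ ∃ t ∈ elems B 1 l, 5 + t.2 = e q ∧
      (flat B t.1 t.2).map (Sym.rank n) = (List.range' 1 (width B)).map e := by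
  have hq' : q ≠ c + 1 := by omega
  have h5 : 5 < m := h.lt_dom hx
  have htop : (topF c q).Holds x c e ↔ ∃ t ∈ elems B 1 l, 5 + t.2 = e q := by
    rw [topF, holds_ex, env_zero he]
    constructor
    · rintro ⟨y, hy, h1⟩
      rw [holds_and, holds_eq] at h1
      simp only [Exp.val, Function.update_self] at h1
      obtain ⟨rfl, h1⟩ := h1
      rw [holds_childF hx (update_mem_envs he hy) (by omega) (by omega) (p₀ := 0) (by simp),
        Function.update_of_ne hq'] at h1
      obtain ⟨q₀, h2, h3⟩ := h1
      obtain ⟨t, ht, rfl⟩ := h.child_bag.1 h3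
      exact ⟨t, ht, h2.symm⟩
    · rintro ⟨t, ht, h1⟩
      refine ⟨5, h5, ?_⟩
      rw [holds_and, holds_eq,
        holds_childF hx (update_mem_envs he h5) (by omega) (by omega) (p₀ := 0) (by simp),
        Function.update_of_ne hq']
      exact ⟨by simp [Exp.val], t.2, h1.symm, h.child_bag.2 ⟨t, ht, rfl⟩⟩
  rw [flatBagF, holds_and, htop]
  constructor
  · rintro ⟨⟨t, ht, h1⟩, h2⟩
    rw [holds_flatF hx B t.1 t.2 c q 1 e (h.elem ht) he hq h1.symm le_rfl (by omega)] at h2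
    exact ⟨t, ht, h1, h2⟩
  · rintro ⟨t, ht, h1, h2⟩
    rw [holds_flatF hx B t.1 t.2 c q 1 e (h.elem ht) he hq h1.symm le_rfl (by omega)]
    exact ⟨⟨t, ht, h1⟩, h2⟩

theorem holds_dictBagF (hx : Inp x m R) {B C : Ty} {v : Val σ (.bag B)}
    (h : Occ n R (.bag B) v 0) {q : ℕ} (he : e ∈ envs m c) (hq : 1 ≤ q ∧ q ≤ c)
    (hc : 1 + width C ≤ c) :
    (dictBagF B C c q).Holds x c e ↔ ∃ t ∈ items C (.bag B) v 0, 5 + t.2.1 = e q ∧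
      (Sym.pos t.1 :: t.2.2).map (Sym.rank n) = (List.range' 1 (1 + width C)).map e := by
  have hd := holds_dictF hx C (.bag B) (fun _ p => eq (.var p) (.const 5)) [(v, 0)]
    (by simpa using h) (fun c e _ p _ => by simp [Exp.val]) c e he 1 q (by omega) hq
  rw [dictBagF, holds_and, hd]
  simp only [List.mem_singleton, exists_eq_left]
  have hr : (List.range' 1 (1 + width C)).map e = e 1 :: (List.range' 2 (width C)).map e := by
    rw [add_comm, List.range'_succ]
    rfl
  rw [hr]
  simp only [List.map_cons, List.cons.injEq, Sym.rank]
  constructor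
  · rintro ⟨⟨t, ht, h1, h2⟩, h3⟩
    obtain ⟨a, ha, h4⟩ := occ_items C (.bag B) v 0 h t ht
    rw [holds_flatF hx C a t.2.1 c q 2 e ha he hq h2 (by omega) (by omega), h4] at h3
    exact ⟨t, ht, h2.symm, h1.symm, h3⟩
  · rintro ⟨t, ht, h1, h2, h3⟩
    obtain ⟨a, ha, h4⟩ := occ_items C (.bag B) v 0 h t ht
    rw [holds_flatF hx C a t.2.1 c q 2 e ha he hq h1.symm (by omega) (by omega), h4]
    exact ⟨⟨t, ht, h2.symm, h1.symm⟩, h3⟩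

theorem formOutput_shredForms (B : Ty) (k : ℕ) (v : Val σ (.bag B)) :
    formOutput (shredForms B k) (domSize B v) (nStr B v) = shredBits k B v := by
  have hx := inp_nStr B v
  have h : Occ (strLen B v) (rstr (strLen B v) (.bag B) v) (.bag B) v 0 := ⟨[], by simp⟩
  have h0 : 0 < domSize B v := by have := hx.five; omega
  rw [formOutput, shredForms, List.flatMap_cons, List.flatMap_map]
  refine congrArg₂ (· ++ ·) ?_ (List.flatMap_congr fun C _ => ?_)
  · refine (eval_bagForms (elems B 1 v) (fun t => t.2)
      (fun t => (flat B t.1 t.2).map (Sym.rank (strLen B v))) ?_ ?_ h0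
      fun e he => holds_flatBagF hx h he (by omega) (by omega)).trans ?_
    · exact List.pairwise_map.2 (pairwise_elems.imp fun h => by omega)
    · exact fun t ht => (h.elem ht).lt_dom hx
    · simp only [flatElems, List.map_map]
      rfl
  · refine (eval_bagForms (items C (.bag B) v 0) (fun t => t.2.1)
      (fun t => (Sym.pos t.1 :: t.2.2).map (Sym.rank (strLen B v))) (nodup_items C _ v 0) ?_ h0
      fun e he => holds_dictBagF hx h he (by omega) (by omega)).trans ?_
    · intro t ht
      obtain ⟨c, hc, -⟩ := occ_items C _ v 0 h t ht
      exact hc.lt_dom hx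
    · rw [← map_items, List.map_map]
      rfl

end Output

end ShredTC0

theorem mainTheorem7 (B : ShredTC0.Ty) (k : ℕ) : ShredTC0.InTC0 (ShredTC0.shredGraph B k) := by
  refine ShredTC0.inTC0_of_forms (ShredTC0.ws_shredForms B k) fun x y hxy => ?_
  obtain ⟨σ, v, h⟩ := hxy
  obtain ⟨rfl, rfl⟩ := Prod.mk.inj h
  exact ⟨_, ShredTC0.length_nStr B v, (ShredTC0.formOutput_shredForms B k v).symm⟩
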